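/- **Laakso spaces.** Let $Q>1$, let $k\ge 1$ be an integer with $\frac{Q-1}{k}\in(0,1)$, and let $t\in(0,1)$ satisfy $\ln 2/\ln(1/t)=\frac{Q-1}{k}$. Let $K\subset\mathbb R$ be the Cantor set with $K=tK\cup(tK+1-t)$; for a finite word $a=a_1\dots a_n$ in $\{0,1\}$ let $K_a=\psi_{a_1}\circ\dots\circ\psi_{a_n}(K)$, where $\psi_0(x)=tx$, $\psi_1(x)=tx+1-t$, be the corresponding cell of level $n$. Let $j$ be the integer with $\frac1{j+1}<t\le\frac1j$, and let $j_1,j_2,\dots\in\{j,j+1\}$ satisfy $\frac{j}{j+1}\prod_{i=1}^m j_i^{-1}\le t^m\le\frac{j+1}{j}\prod_{i=1}^m j_i^{-1}$ for all $m\ge 1$. The wormhole locations of level $l\ge 1$ are the numbers $\sum_{i=1}^l m_i\prod_{h=1}^i j_h^{-1}$ with $0\le m_i<j_i$ for $i<l$ and $0<m_l<j_l$. Put $I=[0,1]$. The Laakso space $L$ is the quotient of $I\times K^k$ by the equivalence relation generated by identifying, for every $l\ge1$, $(x,v)$ with $(x,v')$ whenever $x$ is a wormhole location of level $l$ and, for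 some coordinate $i$ and some word $a$ of length $l-1$, $v_i\in K_{a0}$, $v_i'=v_i+t^{l-1}(1-t)$, and $v'_m=v_m$ for $m\ne i$. Let $\iota:I\times K^k\to L$ be the quotient map, and let $\mu$ be the image under $\iota$ of the product of Lebesgue measure on $I$ and the Bernoulli probability measures on the factors $K$ (cells of level $n$ have mass $2^{-n}$). The length of a path in $L$ is the total variation of its $I$-coordinate. **Function spaces.** $\mathcal G_n$ is the set of $f\in C(L)$ such that $\hat f=f\circ\iota$ satisfies: for fixed $x$, $\hat f(x,\cdot)$ is constant on each product of cells of level $n$; for fixed $v$, $\hat f(\cdot,v)$ is continuously differentiable on $I$ away from the wormhole locations of level at most $n$, and its derivative has finite one-sided limits there. $\mathcal G=\bigcup_n\mathcal G_n$, and $\partial_x f$ (defined $\mu$-a.e.) denotes the derivative of $\hat f$ in $x$. A Borel function $g:L\to[0,\infty]$ is an upper gradient of $f:L\to\mathbb R$ if $|f(\gamma(0))-f(\gamma(\ell))|\le\int_0^\ell g(\gamma(s))\,ds$ for every rectifiable curve $\gamma:[0,\ell]\to L$ parametrized by arc length. A function $p\in L^2(L,\mu)$ is a generalized upper gradient of $u\in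 L^2(L,\mu)$ if there are $f_n\to u$ and $g_n\to p$ in $L^2$ with $g_n$ an upper gradient of $f_n$; it is the minimal one, $p=p_u$, if $p\le p'$ a.e. for every other generalized upper gradient $p'$. Cheeger's Sobolev space $H^{1,2}$ is the set of $u\in L^2(L,\mu)$ for which $p_u\in L^2$ exists, with norm $\|u\|_2+\|p_u\|_2$. **Theorem.** The operator $f\mapsto\partial_x f$ with domain $\mathcal G$ is closable in $L^2(L,\mu)$. Denote its closure again by $\partial_x$, and let $\mathrm{Dom}(\mathcal E)$ be the domain of this closure and $\mathcal E(u,v)=\int_L\partial_xu\,\partial_xv\,d\mu$. Then: 1. For $u\in\mathrm{Dom}(\mathcal E)$ the minimal generalized upper gradient exists, $p_u=|\partial_xu|$ a.e., and $\mathcal E(u,u)=\int_Lp_u^2\,d\mu=\int_L(\partial_xu)^2\,d\mu$. 2. $\mathcal E$ is a Dirichlet form on $L^2(L,\mu)$ (densely defined, nonnegative, symmetric, closed, and if $u\in\mathrm{Dom}(\mathcal E)$, then $v=(u\vee0)\wedge1\in\mathrm{Dom}(\mathcal E)$ and $\mathcal E(v,v)\le\mathcal E(u,u)$). It is local: $\mathcal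 E(u,v)=0$ whenever $u,v\in\mathrm{Dom}(\mathcal E)$ have disjoint compact supports. It is regular: the compactly supported continuous functions in $\mathrm{Dom}(\mathcal E)$ are dense in $\mathrm{Dom}(\mathcal E)$ for $\mathcal E(u,u)+\|u\|_2^2$ and uniformly dense in the compactly supported continuous functions on $L$. 3. $\mathrm{Dom}(\mathcal E)\subset H^{1,2}$, and $\mathrm{Dom}(\mathcal E)$ is the closure of $\mathcal G$ for the norm $\|u\|_2+\|p_u\|_2$. 4. The operator $-A$ associated with $\mathcal E$ (that is, $u\in\mathrm{Dom}(A)$ and $-Au=f$ if and only if $u\in\mathrm{Dom}(\mathcal E)$ and $\mathcal E(u,v)=\int_L fv\,d\mu$ for all $v\in\mathrm{Dom}(\mathcal E)$) is self-adjoint and nonnegative and has a nonnegative self-adjoint square root. For $\sqrt{-A}$ one has $\mathcal G\subset\mathrm{Dom}(\sqrt{-A})$, $\mathcal E(u,v)=\int_L\sqrt{-A}u\,\sqrt{-A}v\,d\mu$ for all $u,v\in\mathrm{Dom}(\mathcal E)$, and $$\overline{\mathcal G}=\mathrm{Dom}(\sqrt{-A})=\mathrm{Dom}(\mathcal E),$$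 where $\overline{\mathcal G}$ is the closure of $\mathcal G$ for the graph norm $\|u\|_2+\|\sqrt{-A}u\|_2$. -/

import Mathlib

open MeasureTheory Set Filter Topology
open scoped ENNReal InnerProductSpace

noncomputable section

/-! ## Symmetric forms, generators and square roots on real `L²` spaces -/

/-- The real Hilbert space `L²(X, μ)`. -/
abbrev L2 {X : Type*} [MeasurableSpace X] (μ : Measure X) : Type _ := Lp ℝ 2 μ

/-- A bilinear form on a linear subspace of `L²(X, μ)`. -/
structure FormL2 {X : Type*} [MeasurableSpace X] (μ : Measure X) where
  domain : Submodule ℝ (L2 μ)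
  form : domain →ₗ[ℝ] domain →ₗ[ℝ] ℝ

namespace FormL2

variable {X : Type*} [MeasurableSpace X] {μ : Measure X} (E : FormL2 μ)

/-- The squared form norm `E₁(u, u) = E(u, u) + (u, u)`. -/
def normSq (u : E.domain) : ℝ := E.form u u + ‖(u : L2 μ)‖ ^ 2

/-- Completeness of the domain for `E₁`. -/
def IsClosed : Prop :=
  ∀ u : ℕ → E.domain,
    (∀ ε > 0, ∃ N, ∀ m ≥ N, ∀ n ≥ N, E.normSq (u m - u n) < ε) →
    ∃ v : E.domain, Tendsto (fun n => E.normSq (u n - v)) atTop (𝓝 0)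

/-- A Dirichlet form: a densely defined, nonnegative, symmetric, closed bilinear form on which
the unit contraction `u ↦ (u ∨ 0) ∧ 1` operates. -/
structure IsDirichlet : Prop where
  dense : Dense (E.domain : Set (L2 μ))
  symm : ∀ u v, E.form u v = E.form v u
  nonneg : ∀ u, 0 ≤ E.form u u
  closed : E.IsClosed
  markov : ∀ u : E.domain, ∃ v : E.domain,
    ((v : L2 μ) : X → ℝ) =ᵐ[μ] (fun x => min (max ((u : L2 μ) x) 0) 1) ∧
      E.form v v ≤ E.form u u

/-- The (closed) support of a function defined up to null sets: the complement of the union of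
the open sets on which it vanishes almost everywhere. -/
def aeSupport [TopologicalSpace X] (μ : Measure X) (u : X → ℝ) : Set X :=
  {x | ∀ U : Set X, IsOpen U → x ∈ U → ¬ (∀ᵐ y ∂μ, y ∈ U → u y = 0)}

/-- The local property. -/
def IsLocal [TopologicalSpace X] : Prop :=
  ∀ u v : E.domain, IsCompact (aeSupport μ (u : L2 μ)) → IsCompact (aeSupport μ (v : L2 μ)) →
    Disjoint (aeSupport μ (u : L2 μ)) (aeSupport μ (v : L2 μ)) → E.form u v = 0

/-- Regularity: the compactly supported continuous functions in the domain are dense in the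
domain for `E₁`, and dense in all compactly supported continuous functions for the sup norm. -/
structure IsRegular [TopologicalSpace X] : Prop where
  dense_domain : ∀ u : E.domain, ∀ ε > 0, ∃ f : X → ℝ, Continuous f ∧ HasCompactSupport f ∧
    ∃ v : E.domain, ((v : L2 μ) : X → ℝ) =ᵐ[μ] f ∧ E.normSq (u - v) < ε
  dense_continuous : ∀ g : X → ℝ, Continuous g → HasCompactSupport g → ∀ ε > 0,
    ∃ f : X → ℝ, Continuous f ∧ HasCompactSupport f ∧
      (∃ v : E.domain, ((v : L2 μ) : X → ℝ) =ᵐ[μ] f) ∧ ∀ x, |g x - f x| < ε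

/-- The graph of the operator associated with `E`: all `(u, f)` with `u` in the domain of the form
and `E(u, v) = (f, v)` for every `v` in that domain. -/
def generatorGraph : Submodule ℝ (L2 μ × L2 μ) where
  carrier := {p | ∃ hu : p.1 ∈ E.domain, ∀ v : E.domain, E.form ⟨p.1, hu⟩ v = ⟪p.2, (v : L2 μ)⟫_ℝ}
  zero_mem' := ⟨E.domain.zero_mem, fun v => by
    have h : (⟨(0 : L2 μ × L2 μ).1, E.domain.zero_mem⟩ : E.domain) = 0 := rfl
    rw [h]; simp⟩
  add_mem' := by
    rintro ⟨u, f⟩ ⟨u', f'⟩ ⟨hu, h⟩ ⟨hu', h'⟩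
    refine ⟨E.domain.add_mem hu hu', fun v => ?_⟩
    have e : (⟨((u, f) + (u', f')).1, E.domain.add_mem hu hu'⟩ : E.domain)
        = ⟨u, hu⟩ + ⟨u', hu'⟩ := rfl
    have h1 := h v
    have h2 := h' v
    simp only at h1 h2
    rw [e, map_add, LinearMap.add_apply, h1, h2, Prod.snd_add, inner_add_left]
  smul_mem' := by
    rintro c ⟨u, f⟩ ⟨hu, h⟩
    refine ⟨E.domain.smul_mem c hu, fun v => ?_⟩
    have e : (⟨(c • (u, f)).1, E.domain.smul_mem c hu⟩ : E.domain) = c • ⟨u, hu⟩ := rfl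
    have h1 := h v
    simp only at h1
    rw [e, map_smul, LinearMap.smul_apply, h1, Prod.smul_snd, real_inner_smul_left, smul_eq_mul]

/-- The operator `-A` associated with the form `E`. -/
def negGenerator : L2 μ →ₗ.[ℝ] L2 μ := E.generatorGraph.toLinearPMap

end FormL2

/-- `S` is a nonnegative self-adjoint square root of the (unbounded) operator `T`: `S ∘ S = T`,
with equality of domains. -/
structure IsPosSqrt {H : Type*} [NormedAddCommGroup H] [InnerProductSpace ℝ H] [CompleteSpace H]
    (S T : H →ₗ.[ℝ] H) : Prop where
  selfAdjoint : IsSelfAdjoint S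
  nonneg : ∀ u : S.domain, 0 ≤ ⟪S u, (u : H)⟫_ℝ
  sq : ∀ u f : H, (u, f) ∈ T.graph ↔ ∃ g : H, (u, g) ∈ S.graph ∧ (g, f) ∈ S.graph

/-- The closure of `V`, within the domain of `S`, for the graph norm `‖u‖ + ‖S u‖`. -/
def graphNormClosure {H : Type*} [NormedAddCommGroup H] [InnerProductSpace ℝ H]
    (S : H →ₗ.[ℝ] H) (V : Set H) : Set H :=
  {u | ∃ hu : u ∈ S.domain, ∀ ε > 0, ∃ f ∈ V, ∃ hf : f ∈ S.domain,
    ‖u - f‖ + ‖S ⟨u, hu⟩ - S ⟨f, hf⟩‖ < ε}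

/-! ## Cantor sets -/

/-- The two contractions `x ↦ t x` and `x ↦ t x + 1 - t`. -/
def cantorContr (t : ℝ) (b : Bool) (x : ℝ) : ℝ := t * x + if b then 1 - t else 0

/-- The point of the Cantor set with address `a 0, a 1, a 2, …`. -/
def cantorPoint (t : ℝ) (a : ℕ → Bool) : ℝ := ∑' i, if a i then (1 - t) * t ^ i else 0

/-- The Cantor set with contraction factor `t`, see `cantorK_eq`. -/
def cantorK (t : ℝ) : Set ℝ := range (cantorPoint t)

/-- The cell `K_a` with finite address `a`; its level is the length of `a`. -/
def cantorCell (t : ℝ) (a : List Bool) : Set ℝ :=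
  (fun x => a.foldr (cantorContr t) x) '' cantorK t

theorem cantorPoint_eq {t : ℝ} (h0 : 0 < t) (h1 : t < 1) (a : ℕ → Bool) :
    cantorPoint t a = cantorContr t (a 0) (cantorPoint t (fun i => a (i + 1))) := by
  have hs : ∀ a : ℕ → Bool, Summable (fun i => if a i then (1 - t) * t ^ i else 0) := by
    intro a
    refine Summable.of_nonneg_of_le (fun i => ?_) (fun i => ?_)
      ((summable_geometric_of_lt_one h0.le h1).mul_left (1 - t))
    · split_ifs
      · have : 0 ≤ 1 - t := by linarith
        positivity
      · exact le_rfl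
    · split_ifs
      · exact le_rfl
      · have : 0 ≤ 1 - t := by linarith
        positivity
  unfold cantorPoint cantorContr
  rw [(hs a).tsum_eq_zero_add, ← tsum_mul_left, add_comm]
  congr 1
  · refine tsum_congr fun i => ?_
    split_ifs
    · ring
    · simp
  · simp

/-- The self-similarity relation that characterizes the Cantor set. -/
theorem cantorK_eq {t : ℝ} (h0 : 0 < t) (h1 : t < 1) :
    cantorK t = cantorContr t false '' cantorK t ∪ cantorContr t true '' cantorK t := by
  ext x
  constructor
  · rintro ⟨a, rfl⟩
    rw [cantorPoint_eq h0 h1]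
    cases h : a 0
    · exact Or.inl ⟨_, ⟨_, rfl⟩, rfl⟩
    · exact Or.inr ⟨_, ⟨_, rfl⟩, rfl⟩
  · have key : ∀ b, ∀ a, cantorContr t b (cantorPoint t a) ∈ cantorK t := fun b a =>
      ⟨fun i => Nat.casesOn i b a, cantorPoint_eq h0 h1 _⟩
    rintro (⟨_, ⟨a, rfl⟩, rfl⟩ | ⟨_, ⟨a, rfl⟩, rfl⟩)
    · exact key _ _
    · exact key _ _

/-- The Bernoulli probability measure on the Cantor set: the law of the point whose address is a
sequence of independent fair coin tosses. Each cell of level `n` has mass `2⁻ⁿ`. -/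
def cantorMeasure (t : ℝ) : Measure (cantorK t) :=
  (Measure.infinitePi fun _ : ℕ => (PMF.uniformOfFintype Bool).toMeasure).map
    (fun a => (⟨cantorPoint t a, a, rfl⟩ : cantorK t))

/-! ## Laakso spaces -/

/-- The data of a Laakso space: the dimension `Q > 1`, the number `k` of Cantor sets, the
contraction factor `t` of the Cantor sets, so that each of them has dimension `(Q - 1) / k`, and the
integers `j` and `j₁, j₂, … ∈ {j, j + 1}` (the value of `js` at `0` is not used). -/
structure LaaksoData where
  Q : ℝ
  k : ℕ
  t : ℝ
  j : ℕ
  js : ℕ → ℕ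
  one_lt_Q : 1 < Q
  dim_pos : 0 < (Q - 1) / k
  dim_lt_one : (Q - 1) / k < 1
  t_pos : 0 < t
  t_lt_one : t < 1
  dim_eq : Real.log 2 / Real.log (1 / t) = (Q - 1) / k
  lt_t : 1 / ((j : ℝ) + 1) < t
  t_le : t ≤ 1 / (j : ℝ)
  js_mem : ∀ i ≥ 1, js i = j ∨ js i = j + 1
  le_pow : ∀ m ≥ 1, (j : ℝ) / (j + 1) * ∏ i ∈ Finset.Icc 1 m, (js i : ℝ)⁻¹ ≤ t ^ m
  pow_le : ∀ m ≥ 1, t ^ m ≤ ((j : ℝ) + 1) / j * ∏ i ∈ Finset.Icc 1 m, (js i : ℝ)⁻¹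

namespace LaaksoData

variable (D : LaaksoData)

/-- The location `w(m₁, …, m_l) = ∑_{i ≤ l} m_i ∏_{h ≤ i} j_h⁻¹`. -/
def w (l : ℕ) (m : ℕ → ℕ) : ℝ :=
  ∑ i ∈ Finset.Icc 1 l, (m i : ℝ) * ∏ h ∈ Finset.Icc 1 i, (D.js h : ℝ)⁻¹

/-- The `I`-coordinates of the wormholes of level `l ≥ 1`. -/
def wormholes (l : ℕ) : Set ℝ :=
  {x | ∃ m : ℕ → ℕ, (∀ i, 1 ≤ i → i < l → m i < D.js i) ∧ 0 < m l ∧ m l < D.js l ∧ x = D.w l m}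

/-- The `I`-coordinates of the wormholes of level at most `n`. -/
def wormholesUpTo (n : ℕ) : Set ℝ := {x | ∃ l, 1 ≤ l ∧ l ≤ n ∧ x ∈ D.wormholes l}

/-- The product `I × K^k`. -/
abbrev Pre : Type := unitInterval × (Fin D.k → cantorK D.t)

/-- The elementary identifications of level `l`: at a wormhole location of level `l`, a point one of
whose Cantor coordinates lies in a cell `K_{a0}` with `|a| = l - 1` is identified with the
corresponding point in `K_{a1}`, the other Cantor coordinates being unchanged. -/
def Ident (p q : D.Pre) : Prop :=
  p.1 = q.1 ∧ ∃ l, 1 ≤ l ∧ (p.1 : ℝ) ∈ D.wormholes l ∧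
    ∃ i : Fin D.k, (∃ a : List Bool, a.length = l - 1 ∧ (p.2 i : ℝ) ∈ cantorCell D.t (a ++ [false])) ∧
      (q.2 i : ℝ) = p.2 i + D.t ^ (l - 1) * (1 - D.t) ∧ ∀ i', i' ≠ i → q.2 i' = p.2 i'

/-- The Laakso space `L`, with the quotient topology. -/
def Space : Type := Quotient (Relation.EqvGen.setoid D.Ident)

instance : TopologicalSpace D.Space :=
  inferInstanceAs (TopologicalSpace (Quotient (Relation.EqvGen.setoid D.Ident)))

instance : MeasurableSpace D.Space := borel _

instance : BorelSpace D.Space := ⟨rfl⟩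

/-- The identification map `ι : I × K^k → L`. -/
def proj (p : D.Pre) : D.Space := Quotient.mk (Relation.EqvGen.setoid D.Ident) p

/-- The `I`-coordinate of a point of `L`. -/
def coord : D.Space → ℝ :=
  Quotient.lift (fun p : D.Pre => (p.1 : ℝ)) (by
    intro p q h
    induction h with
    | rel _ _ h => exact congrArg Subtype.val h.1
    | refl _ => rfl
    | symm _ _ _ ih => exact ih.symm
    | trans _ _ _ _ _ ih₁ ih₂ => exact ih₁.trans ih₂)

/-- The measure on `L`: the image of the product of Lebesgue measure on `I` and of the Bernoulli
measures on the Cantor sets. -/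
def μ : Measure D.Space :=
  ((volume : Measure unitInterval).prod (Measure.pi fun _ : Fin D.k => cantorMeasure D.t)).map D.proj

/-- The function `x ↦ f(ι(x, v))` on `I`, extended to `ℝ` by constants. -/
def slice (f : D.Space → ℝ) (v : Fin D.k → cantorK D.t) (x : ℝ) : ℝ :=
  f (D.proj (projIcc 0 1 zero_le_one x, v))

/-- The derivative of `f` in the direction of `I`. At a point of `L` that is not a wormhole `out` is
the only preimage under `ι`; the wormholes form a null set. -/
def dx (f : D.Space → ℝ) (q : D.Space) : ℝ :=
  deriv (D.slice f (Quotient.out q).2) ((Quotient.out q).1 : ℝ)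

/-- The class `𝒢_n`. -/
def GLevel (n : ℕ) : Set C(D.Space, ℝ) :=
  {f | (∀ (x : unitInterval) (c : Fin D.k → List Bool), (∀ i, (c i).length = n) →
        ∀ v v' : Fin D.k → cantorK D.t, (∀ i, (v i : ℝ) ∈ cantorCell D.t (c i)) →
          (∀ i, (v' i : ℝ) ∈ cantorCell D.t (c i)) → f (D.proj (x, v)) = f (D.proj (x, v'))) ∧
      ∀ v : Fin D.k → cantorK D.t,
        ContDiffOn ℝ 1 (D.slice f v) (Icc 0 1 \ D.wormholesUpTo n) ∧
          ∀ s ∈ D.wormholesUpTo n,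
            (∃ a : ℝ, Tendsto (deriv (D.slice f v)) (𝓝[<] s) (𝓝 a)) ∧
            (∃ b : ℝ, Tendsto (deriv (D.slice f v)) (𝓝[>] s) (𝓝 b))}

/-- The class `𝒢 = ⋃ 𝒢_n`. -/
def G : Set C(D.Space, ℝ) := ⋃ n, D.GLevel n

/-- The elements of `𝒢` as elements of `L²(L, μ)`. -/
def GL2 : Set (L2 D.μ) := {u | ∃ f ∈ D.G, (u : D.Space → ℝ) =ᵐ[D.μ] f}

/-! ### Upper gradients and Cheeger's Sobolev space -/

/-- A rectifiable curve in `L`, parametrized by arc length on `[0, ℓ]`. The length of a curve in `L`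
is the total distance that it travels in the direction of `I`: crossing a wormhole costs nothing. -/
structure IsArcLengthCurve (γ : ℝ → D.Space) (ℓ : ℝ) : Prop where
  nonneg : 0 ≤ ℓ
  cont : ContinuousOn γ (Icc 0 ℓ)
  unitSpeed : HasUnitSpeedOn (D.coord ∘ γ) (Icc 0 ℓ)

/-- `g` is an upper gradient of the function `f`. -/
def IsUpperGradient (f : D.Space → ℝ) (g : D.Space → ℝ≥0∞) : Prop :=
  ∀ (γ : ℝ → D.Space) (ℓ : ℝ), D.IsArcLengthCurve γ ℓ →
    ENNReal.ofReal |f (γ 0) - f (γ ℓ)| ≤ ∫⁻ s in Icc 0 ℓ, g (γ s)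

/-- `p` is a generalized upper gradient of `u` in the sense of Cheeger: there are functions
`f n → u` in `L²` with Borel upper gradients `g n → p` in `L²`. -/
def IsGenUpperGradient (u p : L2 D.μ) : Prop :=
  ∃ (f : ℕ → D.Space → ℝ) (g : ℕ → D.Space → ℝ≥0∞),
    (∀ n, MemLp (f n) 2 D.μ ∧ Measurable (g n) ∧ ∫⁻ q, g n q ^ 2 ∂D.μ < ∞ ∧
      D.IsUpperGradient (f n) (g n)) ∧
    Tendsto (fun n => eLpNorm (fun q => f n q - u q) 2 D.μ) atTop (𝓝 0) ∧
    Tendsto (fun n => eLpNorm (fun q => (g n q).toReal - p q) 2 D.μ) atTop (𝓝 0)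

/-- `p` is the minimal generalized upper gradient `p_u` of `u`. -/
def IsMinGenUpperGradient (u p : L2 D.μ) : Prop :=
  D.IsGenUpperGradient u p ∧ ∀ p', D.IsGenUpperGradient u p' → ∀ᵐ q ∂D.μ, p q ≤ p' q

/-- Cheeger's Sobolev space `H^{1,2}(L)`: the `u ∈ L²` that have a minimal generalized upper
gradient in `L²`. -/
def H12 : Set (L2 D.μ) := {u | ∃ p, D.IsMinGenUpperGradient u p}

/-- The closure of a set of functions for the norm `‖u‖ + ‖p_u‖` of `H^{1,2}`. -/
def sobolevClosure (V : Set (L2 D.μ)) : Set (L2 D.μ) :=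
  {u | ∀ ε > 0, ∃ f ∈ V, ∃ p, D.IsMinGenUpperGradient (u - f) p ∧ ‖u - f‖ + ‖p‖ < ε}

/-! ### The form -/

/-- The closure in `L² × L²` of the graph of `f ↦ ∂f/∂x` on `𝒢`. -/
def gradientGraph : Submodule ℝ (L2 D.μ × L2 D.μ) :=
  (Submodule.span ℝ {p : L2 D.μ × L2 D.μ | ∃ f ∈ D.G,
    (p.1 : D.Space → ℝ) =ᵐ[D.μ] f ∧ (p.2 : D.Space → ℝ) =ᵐ[D.μ] D.dx f}).topologicalClosure

/-- The closure of the operator `f ↦ ∂f/∂x` with domain `𝒢`. -/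
def gradient : L2 D.μ →ₗ.[ℝ] L2 D.μ := D.gradientGraph.toLinearPMap

/-- The form `E(u, v) = ∫ (∂u/∂x) (∂v/∂x) dμ`; its domain is the closure of `𝒢`. -/
def energy : FormL2 D.μ where
  domain := D.gradient.domain
  form := (innerₗ (L2 D.μ)).compl₁₂ D.gradient.toFun D.gradient.toFun

end LaaksoData

end

/-! Everything is read off along the segments `ι(I × {v})`. They are curves parametrized by arc
length, and by Fubini `μ` integrates Lebesgue measure over them (`measurePreserving_path`). `SubGrad
f g` says that on almost all of them the increments of `f` are at most the integrals of `g`. This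
relation survives changes on null sets, sums and `L²` limits, and by Lebesgue differentiation `f =
0` forces `g ≥ 0` (`SubGrad.nonneg`). It holds for `(u, ∂u)` and `(-u, -∂u)` whenever `(u, ∂u)` lies
in the closed graph, and for `(±u, p)` whenever `p` is a generalized upper gradient of `u`. Adding
two such relations with opposite first entries gives closability of `∂/∂x` and `|∂u| ≤ p`.

Conversely, for `f ∈ 𝒢` the function `|∂f|`, enlarged on a null set, is an upper gradient
(`isUpperGradient_absDx`): `f` is locally determined by finitely many digits, so along a curve of
unit speed it is Lipschitz, with derivative at most `|∂f|`. Passing to the limit, `|∂u|` is the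
minimal generalized upper gradient. This rests on the description of the fibres of `ι` by addresses
(`proj_eq_iff`), which also shows that `L` is compact and metrizable.

The Dirichlet form properties come from the chain rule in the closed graph
(`comp_indicator_mem_gradientGraph`), which yields both the unit contraction and the vanishing of
`∂u` on `{u = 0}`, hence locality. Regularity is the Stone–Weierstrass theorem for the algebra `𝒢`.

For the generator, let `T` be the closed operator `∂/∂x`, so that `-A = T⋆ T`. The resolvent `B = (1
+ T⋆ T)⁻¹` comes from the orthogonal projection onto the graph of `T`. Since `0 ≤ B ≤ 1`, the roots
`C = √B` and `D = √(1 - B)` are given by a power series, and `{(C a, D a)}` is the graph of `√(-A)`.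
Any self-adjoint `S` with `S² = -A` satisfies `S⋆ S = T⋆ T`; since the domain of `T⋆ T` is a core
for both, `S` and `T` have the same domain and the same form. -/

noncomputable section

/-! ## Square roots of `1 - x` in Banach algebras -/

/-- The coefficients of the power series of `(1 - √(1 - x)) / 2`. -/
def halfSqrtCoeff (n : ℕ) : ℝ := catalan n / 4 ^ (n + 1)

theorem halfSqrtCoeff_nonneg (n : ℕ) : 0 ≤ halfSqrtCoeff n := by
  unfold halfSqrtCoeff; positivity

theorem halfSqrtCoeff_succ (n : ℕ) :
    halfSqrtCoeff (n + 1) =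
      ∑ p ∈ Finset.HasAntidiagonal.antidiagonal n, halfSqrtCoeff p.1 * halfSqrtCoeff p.2 := by
  unfold halfSqrtCoeff
  rw [catalan_succ', Nat.cast_sum, Finset.sum_div]
  refine Finset.sum_congr rfl fun p hp => ?_
  rw [← Finset.HasAntidiagonal.mem_antidiagonal.1 hp, Nat.cast_mul, div_mul_div_comm]
  congr 1
  ring

/-- The recurrence bounds the partial sums by `S (N + 1) ≤ 1 / 4 + S N ^ 2`, and `1 / 2` is the
fixed point of `s ↦ 1 / 4 + s ^ 2`. Summability of the coefficients makes the series converge up to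
and including norm one. -/
theorem sum_halfSqrtCoeff_le (N : ℕ) : ∑ n ∈ Finset.range N, halfSqrtCoeff n ≤ 1 / 2 := by
  induction N with
  | zero => simp
  | succ N ih =>
    rw [Finset.sum_range_succ']
    have h0 : halfSqrtCoeff 0 = 1 / 4 := by simp [halfSqrtCoeff]
    have h1 : ∑ n ∈ Finset.range N, halfSqrtCoeff (n + 1)
        ≤ (∑ n ∈ Finset.range N, halfSqrtCoeff n) * ∑ n ∈ Finset.range N, halfSqrtCoeff n := by
      rw [Finset.sum_mul_sum, ← Finset.sum_product']
      simp_rw [halfSqrtCoeff_succ]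
      rw [← Finset.sum_biUnion]
      · refine Finset.sum_le_sum_of_subset_of_nonneg ?_ fun p _ _ =>
          mul_nonneg (halfSqrtCoeff_nonneg _) (halfSqrtCoeff_nonneg _)
        intro p hp
        simp only [Finset.mem_biUnion, Finset.mem_range,
          Finset.HasAntidiagonal.mem_antidiagonal] at hp
        obtain ⟨n, hn, hp⟩ := hp
        simp only [Finset.mem_product, Finset.mem_range]
        omega
      · intro m _ n _ hmn
        rw [Function.onFun, Finset.disjoint_left]
        intro p hp hp'
        rw [Finset.HasAntidiagonal.mem_antidiagonal] at hp hp'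
        omega
    have h2 : 0 ≤ ∑ n ∈ Finset.range N, halfSqrtCoeff n :=
      Finset.sum_nonneg fun n _ => halfSqrtCoeff_nonneg n
    rw [h0]
    nlinarith

theorem summable_halfSqrtCoeff : Summable halfSqrtCoeff :=
  summable_of_sum_range_le halfSqrtCoeff_nonneg sum_halfSqrtCoeff_le

/-- `(1 - √(1 - x)) / 2` for an element `x` of norm at most one of a Banach algebra. -/
def halfSqrtSeries {A : Type*} [NormedRing A] [NormedAlgebra ℝ A] (x : A) : A :=
  ∑' n, halfSqrtCoeff n • x ^ (n + 1)

theorem norm_halfSqrtTerm_le {A : Type*} [NormedRing A] [NormedAlgebra ℝ A] {x : A}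
    (hx : ‖x‖ ≤ 1) (n : ℕ) : ‖halfSqrtCoeff n • x ^ (n + 1)‖ ≤ halfSqrtCoeff n := by
  rw [norm_smul, Real.norm_of_nonneg (halfSqrtCoeff_nonneg n)]
  exact mul_le_of_le_one_right (halfSqrtCoeff_nonneg n)
    ((norm_pow_le' x n.succ_pos).trans (pow_le_one₀ (norm_nonneg x) hx))

theorem summable_norm_halfSqrtTerm {A : Type*} [NormedRing A] [NormedAlgebra ℝ A] {x : A}
    (hx : ‖x‖ ≤ 1) : Summable fun n => ‖halfSqrtCoeff n • x ^ (n + 1)‖ :=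
  Summable.of_nonneg_of_le (fun _ => norm_nonneg _) (norm_halfSqrtTerm_le hx)
    summable_halfSqrtCoeff

theorem norm_halfSqrtSeries_le {A : Type*} [NormedRing A] [NormedAlgebra ℝ A] {x : A}
    (hx : ‖x‖ ≤ 1) : ‖halfSqrtSeries x‖ ≤ 1 / 2 :=
  (tsum_of_norm_bounded summable_halfSqrtCoeff.hasSum (norm_halfSqrtTerm_le hx)).trans
    (summable_halfSqrtCoeff.tsum_le_of_sum_range_le sum_halfSqrtCoeff_le)

/-- By the Catalan recurrence the Cauchy square of the series is the series without its first term
`x / 4`. -/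
theorem halfSqrtSeries_mul_self {A : Type*} [NormedRing A] [NormedAlgebra ℝ A] [CompleteSpace A]
    {x : A} (hx : ‖x‖ ≤ 1) :
    halfSqrtSeries x * halfSqrtSeries x = halfSqrtSeries x - (1 / 4 : ℝ) • x := by
  have hs := summable_norm_halfSqrtTerm hx
  unfold halfSqrtSeries
  rw [tsum_mul_tsum_eq_tsum_sum_antidiagonal_of_summable_norm hs hs, hs.of_norm.tsum_eq_zero_add]
  have h0 : halfSqrtCoeff 0 = 1 / 4 := by simp [halfSqrtCoeff]
  rw [h0, zero_add, pow_one, add_sub_cancel_left]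
  refine tsum_congr fun n => ?_
  rw [halfSqrtCoeff_succ, Finset.sum_smul]
  refine Finset.sum_congr rfl fun p hp => ?_
  rw [smul_mul_smul_comm, ← pow_add]
  congr 2
  have := Finset.HasAntidiagonal.mem_antidiagonal.1 hp
  omega

/-- The square root `√(1 - x)` for an element `x` of norm at most one of a Banach algebra. -/
def sqrtOneSub {A : Type*} [NormedRing A] [NormedAlgebra ℝ A] (x : A) : A :=
  1 - (2 : ℝ) • halfSqrtSeries x

theorem sqrtOneSub_mul_self {A : Type*} [NormedRing A] [NormedAlgebra ℝ A] [CompleteSpace A]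
    {x : A} (hx : ‖x‖ ≤ 1) : sqrtOneSub x * sqrtOneSub x = 1 - x := by
  have h := halfSqrtSeries_mul_self hx
  unfold sqrtOneSub
  rw [sub_mul, mul_sub, mul_sub, smul_mul_smul_comm, h, one_mul, mul_one, one_mul]
  module

/-- This allows the construction to be repeated: replacing `x` by `1 - sqrtOneSub x` gives a fourth
root of `1 - x`. -/
theorem norm_one_sub_sqrtOneSub_le {A : Type*} [NormedRing A] [NormedAlgebra ℝ A] {x : A}
    (hx : ‖x‖ ≤ 1) : ‖1 - sqrtOneSub x‖ ≤ 1 := by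
  rw [sqrtOneSub, sub_sub_cancel, norm_smul, Real.norm_eq_abs, abs_two]
  linarith [norm_halfSqrtSeries_le hx]

theorem Commute.sqrtOneSub_right {A : Type*} [NormedRing A] [NormedAlgebra ℝ A] [CompleteSpace A]
    {x y : A} (hx : ‖x‖ ≤ 1) (h : Commute y x) : Commute y (sqrtOneSub x) := by
  have hs := (summable_norm_halfSqrtTerm hx).of_norm
  refine (Commute.one_right y).sub_right (Commute.smul_right ?_ _)
  unfold halfSqrtSeries
  rw [Commute, SemiconjBy, ← hs.tsum_mul_left, ← hs.tsum_mul_right]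
  exact tsum_congr fun n => ((h.pow_right _).smul_right _).eq

theorem IsSelfAdjoint.sqrtOneSub {A : Type*} [NormedRing A] [NormedAlgebra ℝ A] [StarRing A]
    [ContinuousStar A] [StarModule ℝ A] {x : A} (h : IsSelfAdjoint x) :
    IsSelfAdjoint (sqrtOneSub x) := by
  have : IsSelfAdjoint (halfSqrtSeries x) := by
    unfold halfSqrtSeries
    rw [IsSelfAdjoint, tsum_star]
    refine tsum_congr fun n => ?_
    rw [star_smul, star_pow, h.star_eq, star_trivial]
  exact (IsSelfAdjoint.one A).sub ((IsSelfAdjoint.all (2 : ℝ)).smul this)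

/-! ## The operator associated with a closed operator -/

section FormRep

variable {H : Type*} [NormedAddCommGroup H] [InnerProductSpace ℝ H]

/-- `(w, f)` belongs to the graph of `T⋆ T`, in the weak sense. -/
def IsFormRep (T : H →ₗ.[ℝ] H) (w f : H) : Prop :=
  ∃ hw : w ∈ T.domain, ∀ v : T.domain, ⟪T ⟨w, hw⟩, T v⟫_ℝ = ⟪f, (v : H)⟫_ℝ

/-- The resolvent `(1 + T⋆ T)⁻¹` of a closed operator. -/
theorem exists_resolvent [CompleteSpace H] {T : H →ₗ.[ℝ] H} (hT : T.IsClosed) :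
    ∃ B : H →L[ℝ] H, ∀ f, IsFormRep T (B f) (f - B f) := by
  -- `B f` is the first entry of the projection of `(f, 0)` onto the graph. That `(f - w, -T w)` is
  -- orthogonal to every `(v, T v)` is the weak equation `⟪T w, T v⟫ = ⟪f - w, v⟫`.
  let K : Submodule ℝ (WithLp 2 (H × H)) :=
    T.graph.comap (WithLp.linearEquiv 2 ℝ (H × H)).toLinearMap
  have hK : IsClosed (K : Set (WithLp 2 (H × H))) :=
    hT.preimage (WithLp.prod_continuous_ofLp 2 H H)
  have : CompleteSpace K := hK.completeSpace_coe
  refine ⟨(WithLp.fstL 2 ℝ H H).comp (K.starProjection.comp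
    ((WithLp.prodContinuousLinearEquiv 2 ℝ H H).symm.toContinuousLinearMap.comp
      (ContinuousLinearMap.inl ℝ H H))), fun f => ?_⟩
  set x : WithLp 2 (H × H) := WithLp.toLp 2 (f, 0) with hx
  have hmem : K.starProjection x ∈ K := K.starProjection_apply_mem x
  change IsFormRep T (K.starProjection x).fst (f - (K.starProjection x).fst)
  obtain ⟨hd, he⟩ : ∃ h : (K.starProjection x).fst ∈ T.domain,
      T ⟨(K.starProjection x).fst, h⟩ = (K.starProjection x).snd := by
    have h1 : ((K.starProjection x).fst, (K.starProjection x).snd) ∈ T.graph := hmem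
    rw [LinearPMap.mem_graph_iff] at h1
    obtain ⟨y, hy, hy'⟩ := h1
    simp only at hy hy'
    refine ⟨hy ▸ y.2, ?_⟩
    rw [← hy']
    congr 1
    exact Subtype.ext hy.symm
  refine ⟨hd, fun v => ?_⟩
  have h2 := K.starProjection_inner_eq_zero x (WithLp.toLp 2 ((v : H), T v))
    (by exact T.mem_graph v)
  rw [WithLp.prod_inner_apply] at h2
  simp only [WithLp.ofLp_sub, Prod.fst_sub, Prod.snd_sub, hx, zero_sub, inner_neg_left] at h2
  rw [he]
  exact (sub_eq_zero.1 (by rw [← sub_eq_add_neg] at h2; exact h2)).symm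

theorem IsFormRep.sub {T : H →ₗ.[ℝ] H} {w f w' f' : H} (h : IsFormRep T w f)
    (h' : IsFormRep T w' f') : IsFormRep T (w - w') (f - f') := by
  obtain ⟨hw, h⟩ := h
  obtain ⟨hw', h'⟩ := h'
  refine ⟨T.domain.sub_mem hw hw', fun v => ?_⟩
  have e : (⟨w - w', T.domain.sub_mem hw hw'⟩ : T.domain) = ⟨w, hw⟩ - ⟨w', hw'⟩ := rfl
  rw [e, LinearPMap.map_sub, inner_sub_left, h, h', inner_sub_left]

/-- Testing with `d` itself gives `‖T d‖ ^ 2 = -‖d‖ ^ 2`. This is the injectivity of `1 + T⋆ T`,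
from which uniqueness in the resolvent equation follows. -/
theorem IsFormRep.eq_zero_of_neg {T : H →ₗ.[ℝ] H} {d : H} (h : IsFormRep T d (-d)) : d = 0 := by
  obtain ⟨hd, h⟩ := h
  have h1 := h ⟨d, hd⟩
  rw [real_inner_self_eq_norm_sq, inner_neg_left, real_inner_self_eq_norm_sq] at h1
  have h2 : ‖d‖ ^ 2 = 0 := by nlinarith [sq_nonneg ‖T ⟨d, hd⟩‖, sq_nonneg ‖d‖]
  simpa using h2

theorem isFormRep_iff_resolvent {T : H →ₗ.[ℝ] H} {B : H →L[ℝ] H}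
    (hB : ∀ f, IsFormRep T (B f) (f - B f)) (w f : H) : IsFormRep T w f ↔ w = B (w + f) := by
  constructor
  · intro h
    have h1 := h.sub (hB (w + f))
    have e : f - (w + f - B (w + f)) = -(w - B (w + f)) := by abel
    rw [e] at h1
    exact sub_eq_zero.1 h1.eq_zero_of_neg
  · intro h
    have h1 := hB (w + f)
    rwa [← h, add_sub_cancel_left] at h1

theorem inner_resolvent_comm {T : H →ₗ.[ℝ] H} {B : H →L[ℝ] H}
    (hB : ∀ f, IsFormRep T (B f) (f - B f)) (f g : H) : ⟪B f, g⟫_ℝ = ⟪f, B g⟫_ℝ := by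
  obtain ⟨hf, h1⟩ := hB f
  obtain ⟨hg, h2⟩ := hB g
  have h3 := h1 ⟨B g, hg⟩
  have h4 := h2 ⟨B f, hf⟩
  rw [inner_sub_left] at h3 h4
  have h5 := real_inner_comm (T ⟨B f, hf⟩) (T ⟨B g, hg⟩)
  have h6 := real_inner_comm (B f) (B g)
  have h7 := real_inner_comm (B f) g
  linarith

theorem norm_sq_resolvent_le {T : H →ₗ.[ℝ] H} {B : H →L[ℝ] H}
    (hB : ∀ f, IsFormRep T (B f) (f - B f)) (f : H) : ‖B f‖ ^ 2 ≤ ⟪f, B f⟫_ℝ := by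
  obtain ⟨hf, h1⟩ := hB f
  have h2 := h1 ⟨B f, hf⟩
  rw [inner_sub_left, real_inner_self_eq_norm_sq, real_inner_self_eq_norm_sq] at h2
  nlinarith [sq_nonneg ‖T ⟨B f, hf⟩‖]

theorem norm_resolvent_le {T : H →ₗ.[ℝ] H} {B : H →L[ℝ] H}
    (hB : ∀ f, IsFormRep T (B f) (f - B f)) : ‖B‖ ≤ 1 := by
  refine B.opNorm_le_bound zero_le_one fun f => ?_
  have h1 := (norm_sq_resolvent_le hB f).trans (real_inner_le_norm _ _)
  rcases (norm_nonneg (B f)).eq_or_lt with h0 | h0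
  · rw [← h0]; positivity
  · nlinarith

/-- Expanding the square, `‖f - B f‖ ^ 2 ≤ ‖f‖ ^ 2 - ‖B f‖ ^ 2`. Together with `‖B‖ ≤ 1` this makes
the power series available for both `√B` and `√(1 - B)`. -/
theorem norm_one_sub_resolvent_le {T : H →ₗ.[ℝ] H} {B : H →L[ℝ] H}
    (hB : ∀ f, IsFormRep T (B f) (f - B f)) : ‖1 - B‖ ≤ 1 := by
  refine (1 - B).opNorm_le_bound zero_le_one fun f => ?_
  have h1 := norm_sq_resolvent_le hB f
  have h2 := norm_sub_sq_real f (B f)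
  have h3 : (1 - B) f = f - B f := rfl
  rw [h3, one_mul]
  refine abs_le_of_sq_le_sq' ?_ (norm_nonneg f) |>.2
  nlinarith [sq_nonneg ‖B f‖]

theorem resolvent_injective {T : H →ₗ.[ℝ] H} (hd : Dense (T.domain : Set H)) {B : H →L[ℝ] H}
    (hB : ∀ f, IsFormRep T (B f) (f - B f)) {f : H} (hf : B f = 0) : f = 0 := by
  obtain ⟨hw, h⟩ := hB f
  refine hd.eq_zero_of_inner_left ℝ fun v hv => ?_
  have h1 := h ⟨v, hv⟩
  have e : (⟨B f, hw⟩ : T.domain) = 0 := Subtype.ext hf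
  rw [e, LinearPMap.map_zero, inner_zero_left, hf, sub_zero] at h1
  exact h1.symm

theorem dense_range_of_selfAdjoint_of_injective [CompleteSpace H] {B : H →L[ℝ] H}
    (hs : ∀ f g, ⟪B f, g⟫_ℝ = ⟪f, B g⟫_ℝ) (hi : ∀ f, B f = 0 → f = 0) :
    Dense (LinearMap.range (B : H →ₗ[ℝ] H) : Set H) := by
  rw [Submodule.dense_iff_topologicalClosure_eq_top, Submodule.topologicalClosure_eq_top_iff,
    Submodule.eq_bot_iff]
  intro x hx
  refine hi x (ext_inner_right ℝ fun y => ?_)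
  rw [hs, inner_zero_left, real_inner_comm]
  exact hx _ ⟨y, rfl⟩

theorem isSelfAdjoint_of_graph [CompleteSpace H] {A : H →ₗ.[ℝ] H} (hd : Dense (A.domain : Set H))
    (h : ∀ y z, (∀ w f, (w, f) ∈ A.graph → ⟪f, y⟫_ℝ = ⟪w, z⟫_ℝ) ↔ (y, z) ∈ A.graph) :
    IsSelfAdjoint A := by
  rw [LinearPMap.isSelfAdjoint_def]
  refine LinearPMap.eq_of_eq_graph ?_
  rw [LinearPMap.adjoint_graph_eq_graph_adjoint hd]
  ext ⟨y, z⟩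
  rw [← h, Submodule.mem_adjoint_iff]
  simp only [sub_eq_zero]

/-- The operator `T⋆ T` associated with a closed operator is self-adjoint. -/
theorem isSelfAdjoint_of_isFormRep [CompleteSpace H] {T A : H →ₗ.[ℝ] H} (hT : T.IsClosed)
    (hd : Dense (T.domain : Set H)) (hA : ∀ w f, (w, f) ∈ A.graph ↔ IsFormRep T w f) :
    IsSelfAdjoint A := by
  obtain ⟨B, hB⟩ := exists_resolvent hT
  have hs := inner_resolvent_comm hB
  have hA' : ∀ w f, (w, f) ∈ A.graph ↔ w = B (w + f) := fun w f =>
    (hA w f).trans (isFormRep_iff_resolvent hB w f)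
  refine isSelfAdjoint_of_graph
    ((dense_range_of_selfAdjoint_of_injective hs fun f => resolvent_injective hd hB).mono ?_) ?_
  · rintro _ ⟨f, rfl⟩
    exact LinearPMap.mem_domain_of_mem_graph ((hA _ _).2 (hB f))
  · intro y z
    rw [hA']
    constructor
    · intro h
      -- On the graph element `(B g, g - B g)` the adjoint relation reads `⟪g, y⟫ = ⟪g, B (y + z)⟫`.
      refine ext_inner_left ℝ fun g => ?_
      have h1 := h _ _ ((hA _ _).2 (hB g))
      rw [inner_sub_left, hs, hs, sub_eq_iff_eq_add] at h1
      rw [map_add, inner_add_right, h1, add_comm]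
    · intro h w f hw
      rw [hA'] at hw
      have h1 := hs (w + f) (y + z)
      rw [← hw, ← h, inner_add_left, inner_add_right] at h1
      linarith

/-- Formally `A = (1 - B) B⁻¹`, so the root is `D C⁻¹` with `C = √B` and `D = √(1 - B)`. Its graph
is parametrized by `a ↦ (C a, D a)`, and all properties follow from `C² + D² = 1` and `C D = D C`.
-/
theorem exists_isPosSqrt_of_isFormRep [CompleteSpace H] {T A : H →ₗ.[ℝ] H} (hT : T.IsClosed)
    (hd : Dense (T.domain : Set H)) (hA : ∀ w f, (w, f) ∈ A.graph ↔ IsFormRep T w f) :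
    ∃ S, IsPosSqrt S A := by
  obtain ⟨B, hB⟩ := exists_resolvent hT
  have hA' : ∀ w f, (w, f) ∈ A.graph ↔ w = B (w + f) := fun w f =>
    (hA w f).trans (isFormRep_iff_resolvent hB w f)
  have hB1 := norm_resolvent_le hB
  have hB2 := norm_one_sub_resolvent_le hB
  have hBs : IsSelfAdjoint B :=
    (ContinuousLinearMap.isSelfAdjoint_iff_isSymmetric).2 (inner_resolvent_comm hB)
  set C := sqrtOneSub (1 - B) with hC
  set D := sqrtOneSub B with hD
  have hCC : C * C = B := by rw [hC, sqrtOneSub_mul_self hB2, sub_sub_cancel]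
  have hDD : D * D = 1 - B := sqrtOneSub_mul_self hB1
  have hCs : IsSelfAdjoint C := ((IsSelfAdjoint.one _).sub hBs).sqrtOneSub
  have hDs : IsSelfAdjoint D := hBs.sqrtOneSub
  have hC1 : ‖1 - C‖ ≤ 1 := norm_one_sub_sqrtOneSub_le hB2
  have hD1 : ‖1 - D‖ ≤ 1 := norm_one_sub_sqrtOneSub_le hB1
  have hDB : Commute D (1 - B) :=
    ((Commute.one_left _).sub_left (Commute.refl B)).sqrtOneSub_right hB1 |>.symm
  have hDC : Commute D C := hDB.sqrtOneSub_right hB2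
  -- The roots of `C` and `D` serve only for nonnegativity: `⟪D a, C a⟫ = ‖G F a‖ ^ 2`.
  set F := sqrtOneSub (1 - C) with hF
  set G := sqrtOneSub (1 - D) with hG
  have hFF : F * F = C := by rw [hF, sqrtOneSub_mul_self hC1, sub_sub_cancel]
  have hGG : G * G = D := by rw [hG, sqrtOneSub_mul_self hD1, sub_sub_cancel]
  have hFs : IsSelfAdjoint F := ((IsSelfAdjoint.one _).sub hCs).sqrtOneSub
  have hGs : IsSelfAdjoint G := ((IsSelfAdjoint.one _).sub hDs).sqrtOneSub
  have hGC : Commute G C :=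
    (((Commute.one_right C).sub_right hDC.symm).sqrtOneSub_right hD1).symm
  have hGF : Commute G F := ((Commute.one_right G).sub_right hGC).sqrtOneSub_right hC1
  have sC : ∀ f g, ⟪C f, g⟫_ℝ = ⟪f, C g⟫_ℝ := hCs.isSymmetric
  have sD : ∀ f g, ⟪D f, g⟫_ℝ = ⟪f, D g⟫_ℝ := hDs.isSymmetric
  have eB : ∀ f, C (C f) = B f := fun f => DFunLike.congr_fun hCC f
  have eD : ∀ f, D (D f) = f - B f := fun f => DFunLike.congr_fun hDD f
  have eDC : ∀ f, D (C f) = C (D f) := fun f => DFunLike.congr_fun hDC.eq f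
  have hsum : ∀ f, f = C (C f) + D (D f) := fun f => by rw [eB, eD]; abel
  have hCi : ∀ f, C f = 0 → f = 0 := fun f hf =>
    resolvent_injective hd hB (by rw [← eB, hf, map_zero])
  let Γ : Submodule ℝ (H × H) := LinearMap.range ((C : H →ₗ[ℝ] H).prod (D : H →ₗ[ℝ] H))
  have hΓ : Γ.toLinearPMap.graph = Γ := by
    refine Submodule.toLinearPMap_graph_eq _ ?_
    rintro _ ⟨f, rfl⟩ hf
    have : f = 0 := hCi f hf
    simp [this]
  have hmem : ∀ u g, (u, g) ∈ Γ.toLinearPMap.graph ↔ ∃ a, C a = u ∧ D a = g := by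
    intro u g
    rw [hΓ]
    constructor
    · rintro ⟨a, ha⟩
      exact ⟨a, congrArg Prod.fst ha, congrArg Prod.snd ha⟩
    · rintro ⟨a, rfl, rfl⟩
      exact ⟨a, rfl⟩
  refine ⟨Γ.toLinearPMap, ?_, ?_, ?_⟩
  · refine isSelfAdjoint_of_graph
      ((dense_range_of_selfAdjoint_of_injective sC hCi).mono ?_) fun y z => ?_
    · rintro _ ⟨a, rfl⟩
      exact LinearPMap.mem_domain_of_mem_graph ((hmem _ _).2 ⟨a, rfl, rfl⟩)
    · rw [hmem]
      constructor
      · intro h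
        have h1 : D y = C z := ext_inner_left ℝ fun a => by
          rw [← sD, ← sC]
          exact h _ _ ((hmem _ _).2 ⟨a, rfl, rfl⟩)
        -- Solving `C a = y`, `D a = z`: from `C² + D² = 1` necessarily `a = C y + D z`, and `D y =
        -- C z` is the compatibility condition.
        refine ⟨C y + D z, ?_, ?_⟩
        · rw [map_add, ← eDC, ← h1, ← hsum]
        · rw [map_add, eDC, h1, ← hsum]
      · rintro ⟨a, rfl, rfl⟩ w f hw
        obtain ⟨b, rfl, rfl⟩ := (hmem _ _).1 hw
        rw [sD, eDC, ← sC]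
  · intro u
    obtain ⟨a, ha, ha'⟩ := (hmem _ _).1 (LinearPMap.mem_graph _ u)
    rw [← ha, ← ha', ← sC, ← eDC, ← hGG, ← hFF]
    have e1 : (G * G) ((F * F) a) = (G * F) ((G * F) a) := by
      have : G * G * (F * F) = G * F * (G * F) := by
        rw [mul_assoc, ← mul_assoc G F F, hGF.eq, mul_assoc F, ← mul_assoc G, ← hGF.eq]
      exact DFunLike.congr_fun this a
    have hs : IsSelfAdjoint (G * F) := hGs.commute_iff hFs |>.1 hGF
    rw [e1]
    have := hs.isSymmetric ((G * F) a) a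
    simp only [ContinuousLinearMap.coe_coe] at this
    rw [this]
    exact real_inner_self_nonneg
  · intro u f
    rw [hA']
    simp only [hmem]
    constructor
    · intro h
      refine ⟨D (C (u + f)), ⟨C (u + f), ?_, rfl⟩, D (u + f), ?_, ?_⟩
      · rw [eB]; exact h.symm
      · rw [eDC]
      · rw [eD, ← h, add_sub_cancel_left]
    · rintro ⟨g, ⟨a, rfl, rfl⟩, b, hb, rfl⟩
      have h1 : a = C (C a + D b) := by rw [map_add, ← eDC, hb, ← hsum]
      have h2 : b = D (C a + D b) := by rw [map_add, eDC, ← hb, ← hsum]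
      rw [← eB, ← h1]

/-- The domain of `T⋆ T` is a core of the closed operator `T`. -/
theorem exists_seq_isFormRep_tendsto [CompleteSpace H] {T : H →ₗ.[ℝ] H} (hT : T.IsClosed) {u a : H}
    (hu : (u, a) ∈ T.graph) :
    ∃ w b : ℕ → H, (∀ n, (w n, b n) ∈ T.graph) ∧ (∀ n, ∃ f, IsFormRep T (w n) f) ∧
      Tendsto w atTop (𝓝 u) ∧ Tendsto b atTop (𝓝 a) := by
  obtain ⟨B, hB⟩ := exists_resolvent hT
  let K : Submodule ℝ (WithLp 2 (H × H)) :=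
    T.graph.comap (WithLp.linearEquiv 2 ℝ (H × H)).toLinearMap
  have hK : IsClosed (K : Set (WithLp 2 (H × H))) :=
    hT.preimage (WithLp.prod_continuous_ofLp 2 H H)
  let M : Submodule ℝ (WithLp 2 (H × H)) :=
    K ⊓ (LinearMap.range (B : H →ₗ[ℝ] H)).comap (WithLp.fstL 2 ℝ H H).toLinearMap
  have hMK : M.topologicalClosure ≤ K := M.topologicalClosure_minimal inf_le_left hK
  have : CompleteSpace M.topologicalClosure := M.isClosed_topologicalClosure.completeSpace_coe
  set x : WithLp 2 (H × H) := WithLp.toLp 2 (u, a) with hx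
  set p := M.topologicalClosure.starProjection x with hp
  have hpM : p ∈ M.topologicalClosure := M.topologicalClosure.starProjection_apply_mem x
  have hxp : x - p ∈ K := K.sub_mem hu (hMK hpM)
  -- The remainder `(w, b)` lies in the graph and is orthogonal to `(B w, T B w)`. As `⟪b, T B w⟫ =
  -- ⟪w, w - B w⟫`, the sum of the two inner products is `‖w‖ ^ 2`, hence zero.
  have h0 : (x - p).fst = 0 := by
    obtain ⟨hw, h1⟩ := hB (x - p).fst
    have hxp' : ((x - p).fst, (x - p).snd) ∈ T.graph := hxp
    rw [LinearPMap.mem_graph_iff] at hxp'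
    obtain ⟨y, hy, hy'⟩ := hxp'
    simp only at hy hy'
    have h2 := h1 y
    have h3 := M.topologicalClosure.starProjection_inner_eq_zero x
      (WithLp.toLp 2 (B (x - p).fst, T ⟨_, hw⟩))
      (M.le_topologicalClosure ⟨T.mem_graph ⟨_, hw⟩, ⟨_, rfl⟩⟩)
    rw [WithLp.prod_inner_apply, ← hp] at h3
    change ⟪(x - p).fst, B (x - p).fst⟫_ℝ + ⟪(x - p).snd, T ⟨_, hw⟩⟫_ℝ = 0 at h3
    rw [← hy', real_inner_comm _ (T y), h2, hy, inner_sub_left,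
      real_inner_comm (x - p).fst (B _)] at h3
    have h4 : ⟪(x - p).fst, (x - p).fst⟫_ℝ = 0 := by linarith
    exact inner_self_eq_zero.1 h4
  have h0' : (x - p).snd = 0 := T.graph_fst_eq_zero_snd (x := (x - p).fst) hxp h0
  have hpx : p = x := by
    refine (sub_eq_zero.1 ?_).symm
    exact (WithLp.ofLp_injective 2) (Prod.ext h0 h0')
  rw [hpx] at hpM
  obtain ⟨z, hz, hz'⟩ := mem_closure_iff_seq_limit.1 hpM
  refine ⟨fun n => (z n).fst, fun n => (z n).snd, fun n => (hz n).1, fun n => ?_, ?_, ?_⟩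
  · obtain ⟨f, hf⟩ := (hz n).2
    refine ⟨f - B f, ?_⟩
    have := hB f
    rwa [show B f = (z n).fst from hf] at this ⊢
  · exact ((WithLp.continuous_fst 2 H H).tendsto x).comp hz'
  · exact ((WithLp.continuous_snd 2 H H).tendsto x).comp hz'

theorem IsFormRep.norm_sq_eq {T : H →ₗ.[ℝ] H} {w f b : H} (h : IsFormRep T w f)
    (hb : (w, b) ∈ T.graph) : ‖b‖ ^ 2 = ⟪f, w⟫_ℝ := by
  obtain ⟨hw, h⟩ := h
  have : T ⟨w, hw⟩ = b := T.mem_graph_snd_inj (T.mem_graph ⟨w, hw⟩) hb rfl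
  rw [← h ⟨w, hw⟩, this, real_inner_self_eq_norm_sq]

/-- On the core, `‖S w‖ ^ 2 = ⟪f, w⟫ = ‖T w‖ ^ 2`, also for differences. Hence graph convergence for
`T` implies it for `S`, and closedness of `S` carries the limit over. -/
theorem exists_mem_graph_of_isFormRep_imp [CompleteSpace H] {S T : H →ₗ.[ℝ] H}
    (hS : S.IsClosed) (hT : T.IsClosed)
    (h : ∀ w f, IsFormRep T w f → IsFormRep S w f) {u a : H} (hu : (u, a) ∈ T.graph) :
    ∃ b, (u, b) ∈ S.graph ∧ ‖b‖ = ‖a‖ := by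
  obtain ⟨w, b, hwb, hw, hwu, hba⟩ := exists_seq_isFormRep_tendsto hT hu
  choose f hf using hw
  have hc : ∀ n, ∃ c, (w n, c) ∈ S.graph := fun n => by
    obtain ⟨hd, -⟩ := h _ _ (hf n)
    exact ⟨_, S.mem_graph ⟨_, hd⟩⟩
  choose c hc using hc
  have hn : ∀ n, ‖c n‖ = ‖b n‖ := fun n => by
    rw [← sq_eq_sq₀ (norm_nonneg _) (norm_nonneg _), (h _ _ (hf n)).norm_sq_eq (hc n),
      (hf n).norm_sq_eq (hwb n)]
  have hd : ∀ m n, dist (c m) (c n) = dist (b m) (b n) := fun m n => by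
    have h1 := (hf m).sub (hf n)
    rw [dist_eq_norm, dist_eq_norm, ← sq_eq_sq₀ (norm_nonneg _) (norm_nonneg _),
      (h _ _ h1).norm_sq_eq (S.graph.sub_mem (hc m) (hc n)),
      h1.norm_sq_eq (T.graph.sub_mem (hwb m) (hwb n))]
  have hcau : CauchySeq c := by
    have := hba.cauchySeq
    rw [Metric.cauchySeq_iff] at this ⊢
    simpa only [hd] using this
  obtain ⟨y, hy⟩ := cauchySeq_tendsto_of_complete hcau
  refine ⟨y, hS.mem_of_tendsto (hwu.prodMk_nhds hy) (Eventually.of_forall hc), ?_⟩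
  refine tendsto_nhds_unique hy.norm ?_
  simpa only [hn] using hba.norm

/-- Closed operators `S` and `T` with `S⋆ S = T⋆ T` have the same domain and define the same
form. -/
theorem domain_eq_and_inner_eq_of_isFormRep_iff [CompleteSpace H] {S T : H →ₗ.[ℝ] H}
    (hS : S.IsClosed)
    (hT : T.IsClosed) (h : ∀ w f, IsFormRep S w f ↔ IsFormRep T w f) :
    S.domain = T.domain ∧ ∀ (u v : T.domain) (u' v' : S.domain), (u : H) = u' → (v : H) = v' →
      ⟪T u, T v⟫_ℝ = ⟪S u', S v'⟫_ℝ := by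
  have hn : ∀ (u : T.domain) (u' : S.domain), (u : H) = u' → ‖T u‖ = ‖S u'‖ := by
    intro u u' huu
    obtain ⟨b, hb, hb'⟩ :=
      exists_mem_graph_of_isFormRep_imp hS hT (fun w f => (h w f).2) (T.mem_graph u)
    rw [← hb', S.mem_graph_snd_inj (S.mem_graph u') hb huu.symm]
  constructor
  · ext u
    constructor
    · intro hu
      obtain ⟨b, hb, -⟩ := exists_mem_graph_of_isFormRep_imp hT hS (fun w f => (h w f).1)
        (S.mem_graph ⟨u, hu⟩)
      exact LinearPMap.mem_domain_of_mem_graph hb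
    · intro hu
      obtain ⟨b, hb, -⟩ := exists_mem_graph_of_isFormRep_imp hS hT (fun w f => (h w f).2)
        (T.mem_graph ⟨u, hu⟩)
      exact LinearPMap.mem_domain_of_mem_graph hb
  · intro u v u' v' hu hv
    have h1 := hn (u + v) (u' + v') (by simp [hu, hv])
    rw [LinearPMap.map_add, LinearPMap.map_add] at h1
    rw [real_inner_eq_norm_add_mul_self_sub_norm_mul_self_sub_norm_mul_self_div_two,
      real_inner_eq_norm_add_mul_self_sub_norm_mul_self_sub_norm_mul_self_div_two, h1, hn u u' hu,
      hn v v' hv]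

/-- By self-adjointness, `(g, f)` is in the graph of `S` exactly when `⟪g, S v⟫ = ⟪f, v⟫` for all
`v` in the domain. So `S ∘ S` is `S⋆ S` in the weak sense, including domains. -/
theorem IsPosSqrt.mem_graph_iff_isFormRep [CompleteSpace H] {S A : H →ₗ.[ℝ] H}
    (h : IsPosSqrt S A) (w f : H) :
    (w, f) ∈ A.graph ↔ IsFormRep S w f := by
  have hS := h.selfAdjoint
  have hadj : ∀ y z, (y, z) ∈ S.graph ↔ ∀ a b, (a, b) ∈ S.graph → ⟪b, y⟫_ℝ - ⟪a, z⟫_ℝ = 0 := by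
    intro y z
    have e : S.graph = S.graph.adjoint := by
      rw [← LinearPMap.adjoint_graph_eq_graph_adjoint hS.dense_domain,
        LinearPMap.isSelfAdjoint_def.1 hS]
    conv_lhs => rw [e]
    rw [Submodule.mem_adjoint_iff]
  rw [h.sq]
  constructor
  · rintro ⟨g, h1, h2⟩
    refine ⟨LinearPMap.mem_domain_of_mem_graph h1, fun v => ?_⟩
    rw [S.mem_graph_snd_inj (S.mem_graph ⟨w, LinearPMap.mem_domain_of_mem_graph h1⟩) h1 rfl]
    have := (hadj _ _).1 h2 _ _ (S.mem_graph v)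
    rw [real_inner_comm, real_inner_comm (v : H) f]
    linarith
  · rintro ⟨hw, h1⟩
    refine ⟨S ⟨w, hw⟩, S.mem_graph ⟨w, hw⟩, (hadj _ _).2 fun a b hab => ?_⟩
    have h2 := h1 ⟨a, LinearPMap.mem_domain_of_mem_graph hab⟩
    rw [S.mem_graph_snd_inj
      (S.mem_graph ⟨a, LinearPMap.mem_domain_of_mem_graph hab⟩) hab rfl] at h2
    rw [real_inner_comm, h2, real_inner_comm, sub_self]

end FormRep

/-! ## Addresses of points of the Cantor set -/

theorem summable_cantorTerm {t : ℝ} (h0 : 0 < t) (h1 : t < 1) (a : ℕ → Bool) :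
    Summable (fun i => if a i then (1 - t) * t ^ i else 0) := by
  have h2 : 0 ≤ 1 - t := by linarith
  refine Summable.of_nonneg_of_le (fun i => ?_) (fun i => ?_)
    ((summable_geometric_of_lt_one h0.le h1).mul_left (1 - t))
  · split_ifs <;> positivity
  · split_ifs
    · exact le_rfl
    · positivity

theorem cantorPoint_mem_Icc {t : ℝ} (h0 : 0 < t) (h1 : t < 1) (a : ℕ → Bool) :
    cantorPoint t a ∈ Icc (0 : ℝ) 1 := by
  have h2 : 0 ≤ 1 - t := by linarith
  have h3 : HasSum (fun i => (1 - t) * t ^ i) 1 := by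
    have := (hasSum_geometric_of_lt_one h0.le h1).mul_left (1 - t)
    rwa [mul_inv_cancel₀ (by linarith)] at this
  refine ⟨tsum_nonneg fun i => ?_, ?_⟩
  · split_ifs <;> positivity
  · unfold cantorPoint
    refine ((summable_cantorTerm h0 h1 a).tsum_le_tsum (fun i => ?_)
      h3.summable).trans_eq h3.tsum_eq
    split_ifs
    · exact le_rfl
    · positivity

/-- For `t < 1 / 2` the two first-level pieces lie in the disjoint intervals `[0, t]` and `[1 - t,
1]`, so the point determines its first digit and, after rescaling, all others. -/
theorem cantorPoint_injective {t : ℝ} (h0 : 0 < t) (h1 : t < 1 / 2) :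
    Function.Injective (cantorPoint t) := by
  have ht : t < 1 := by linarith
  have key : ∀ a b, cantorPoint t a = cantorPoint t b →
      a 0 = b 0 ∧ cantorPoint t (fun i => a (i + 1)) = cantorPoint t fun i => b (i + 1) := by
    intro a b h
    rw [cantorPoint_eq h0 ht, cantorPoint_eq h0 ht b] at h
    unfold cantorContr at h
    obtain ⟨ha, ha'⟩ := cantorPoint_mem_Icc h0 ht fun i => a (i + 1)
    obtain ⟨hb, hb'⟩ := cantorPoint_mem_Icc h0 ht fun i => b (i + 1)
    cases h2 : a 0 <;> cases h3 : b 0 <;> simp only [h2, h3, if_true, if_false, Bool.false_eq_true,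
      add_zero, add_left_inj, mul_eq_mul_left_iff, h0.ne', or_false] at h
    · exact ⟨rfl, h⟩
    · nlinarith
    · nlinarith
    · exact ⟨rfl, h⟩
  intro a b h
  funext n
  induction n generalizing a b with
  | zero => exact (key a b h).1
  | succ n ih => exact ih (key a b h).2

theorem continuous_cantorPoint {t : ℝ} (h0 : 0 < t) (h1 : t < 1) : Continuous (cantorPoint t) := by
  have h2 : 0 ≤ 1 - t := by linarith
  refine continuous_tsum (u := fun i => (1 - t) * t ^ i) (fun i => ?_)
    ((summable_geometric_of_lt_one h0.le h1).mul_left (1 - t)) fun i a => ?_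
  · exact (continuous_of_discreteTopology
      (f := fun b : Bool => if b then (1 - t) * t ^ i else 0)).comp
      (continuous_apply i)
  · split_ifs
    · rw [Real.norm_of_nonneg (by positivity)]
    · rw [norm_zero]; positivity

theorem cantorPoint_update {t : ℝ} (h0 : 0 < t) (h1 : t < 1) (a : ℕ → Bool) {n : ℕ}
    (hn : a n = false) :
    cantorPoint t (Function.update a n true) = cantorPoint t a + t ^ n * (1 - t) := by
  have h : HasSum (fun i => if i = n then (1 - t) * t ^ n else 0) ((1 - t) * t ^ n) :=
    hasSum_ite_eq n _
  unfold cantorPoint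
  rw [mul_comm (t ^ n), ← h.tsum_eq, ← (summable_cantorTerm h0 h1 a).tsum_add h.summable]
  refine tsum_congr fun i => ?_
  by_cases hi : i = n
  · subst hi
    simp [hn]
  · simp [hi]

theorem mem_cantorCell_iff {t : ℝ} (h0 : 0 < t) (h1 : t < 1) (c : List Bool) (x : ℝ) :
    x ∈ cantorCell t c ↔ ∃ a, cantorPoint t a = x ∧ ∀ i (h : i < c.length), a i = c.get ⟨i, h⟩ := by
  induction c generalizing x with
  | nil => simp [cantorCell, cantorK]
  | cons b c ih =>
    have hc : x ∈ cantorCell t (b :: c) ↔ ∃ y ∈ cantorCell t c, cantorContr t b y = x := by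
      simp [cantorCell]
    rw [hc]
    constructor
    · rintro ⟨y, hy, rfl⟩
      obtain ⟨a, rfl, ha⟩ := (ih y).1 hy
      refine ⟨fun i => Nat.casesOn i b a, cantorPoint_eq h0 h1 _, fun i hi => ?_⟩
      cases i with
      | zero => rfl
      | succ i => exact ha i (by simpa using hi)
    · rintro ⟨a, rfl, ha⟩
      refine ⟨cantorPoint t fun i => a (i + 1), (ih _).2 ⟨_, rfl, fun i hi => ?_⟩, ?_⟩
      · exact ha (i + 1) (by simpa using hi)
      · rw [cantorPoint_eq h0 h1 a, ha 0 (by simp)]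
        rfl

namespace LaaksoData

variable (D : LaaksoData)

/-- This is the condition that the Cantor sets have dimension less than one; it makes addresses
unique. -/
theorem t_lt_half : D.t < 1 / 2 := by
  have h1 := D.dim_eq ▸ D.dim_lt_one
  have h2 : 0 < Real.log (1 / D.t) := Real.log_pos (by
    rw [lt_div_iff₀ D.t_pos, one_mul]; exact D.t_lt_one)
  rw [div_lt_one h2] at h1
  have h3 := (Real.log_lt_log_iff two_pos (by have := D.t_pos; positivity)).1 h1
  rw [lt_div_iff₀ D.t_pos] at h3
  linarith

theorem js_pos {i : ℕ} (hi : 1 ≤ i) : 0 < D.js i := by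
  have h1 := D.lt_t.trans D.t_lt_half
  have h2 : (0 : ℝ) < D.j := by
    rw [div_lt_div_iff₀ (by positivity) two_pos] at h1
    linarith
  have h3 : 0 < D.j := by exact_mod_cast h2
  rcases D.js_mem i hi with h | h <;> omega

/-- The homeomorphism between the Cantor space and the Cantor set. -/
def cantorHomeo : (ℕ → Bool) ≃ₜ cantorK D.t :=
  Continuous.homeoOfEquivCompactToT2
    (f := Equiv.ofInjective _ (cantorPoint_injective D.t_pos D.t_lt_half))
    ((continuous_cantorPoint D.t_pos D.t_lt_one).subtype_mk _)

instance : CompactSpace (cantorK D.t) := D.cantorHomeo.compactSpace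

/-- The `n`-th digit of the address of a point of the Cantor set. -/
def digit (y : cantorK D.t) (n : ℕ) : Bool := D.cantorHomeo.symm y n

theorem continuous_digit (n : ℕ) : Continuous fun y => D.digit y n :=
  (continuous_apply n).comp D.cantorHomeo.symm.continuous

theorem cantorPoint_digit (y : cantorK D.t) : cantorPoint D.t (D.digit y) = y := by
  change (D.cantorHomeo (D.cantorHomeo.symm y) : ℝ) = y
  rw [Homeomorph.apply_symm_apply]

theorem digit_eq_of_cantorPoint_eq {y : cantorK D.t} {a : ℕ → Bool} (h : cantorPoint D.t a = y) :
    D.digit y = a :=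
  cantorPoint_injective D.t_pos D.t_lt_half ((D.cantorPoint_digit y).trans h.symm)

theorem digit_injective {y z : cantorK D.t} (h : ∀ n, D.digit y n = D.digit z n) : y = z := by
  rw [Subtype.ext_iff, ← D.cantorPoint_digit y, ← D.cantorPoint_digit z, funext h]

theorem mem_cantorCell_iff_digit (y : cantorK D.t) (c : List Bool) :
    (y : ℝ) ∈ cantorCell D.t c ↔ ∀ i (h : i < c.length), D.digit y i = c.get ⟨i, h⟩ := by
  rw [mem_cantorCell_iff D.t_pos D.t_lt_one]
  constructor
  · rintro ⟨a, ha, h⟩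
    rwa [D.digit_eq_of_cantorPoint_eq ha]
  · exact fun h => ⟨_, D.cantorPoint_digit y, h⟩

/-! ## Wormhole locations -/

theorem prod_js_pos (l : ℕ) : 0 < ∏ h ∈ Finset.Icc 1 l, (D.js h : ℝ) :=
  Finset.prod_pos fun _ hi => Nat.cast_pos.2 (D.js_pos (Finset.mem_Icc.1 hi).1)

theorem w_succ (l : ℕ) (m : ℕ → ℕ) :
    D.w (l + 1) m = D.w l m + m (l + 1) / ∏ h ∈ Finset.Icc 1 (l + 1), (D.js h : ℝ) := by
  unfold w
  rw [Finset.sum_Icc_succ_top (by omega), Finset.prod_inv_distrib, ← div_eq_mul_inv]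

theorem w_le {l : ℕ} {m : ℕ → ℕ} (hm : ∀ i, 1 ≤ i → i ≤ l → m i < D.js i) :
    D.w l m ≤ 1 - 1 / ∏ h ∈ Finset.Icc 1 l, (D.js h : ℝ) := by
  induction l with
  | zero => simp [w]
  | succ l ih =>
    have h1 := ih fun i h1 h2 => hm i h1 (by omega)
    have hJ := D.prod_js_pos l
    have hj : (0 : ℝ) < D.js (l + 1) := Nat.cast_pos.2 (D.js_pos (by omega))
    rw [w_succ, Finset.prod_Icc_succ_top (by omega)]
    have h2 : (m (l + 1) : ℝ) + 1 ≤ D.js (l + 1) := by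
      exact_mod_cast hm (l + 1) (by omega) le_rfl
    have h3 : ((m (l + 1) : ℝ) + 1) / ((∏ h ∈ Finset.Icc 1 l, (D.js h : ℝ)) * D.js (l + 1))
        ≤ 1 / ∏ h ∈ Finset.Icc 1 l, (D.js h : ℝ) := by
      rw [div_le_div_iff₀ (by positivity) hJ]
      nlinarith
    rw [add_div] at h3
    linarith

theorem wormholes_subset_Ioo {l : ℕ} (hl : 1 ≤ l) : D.wormholes l ⊆ Ioo 0 1 := by
  rintro _ ⟨m, h1, h2, h3, rfl⟩
  have hJ := D.prod_js_pos l
  constructor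
  · have h4 : (0 : ℝ) < m l * ∏ h ∈ Finset.Icc 1 l, (D.js h : ℝ)⁻¹ := by
      rw [Finset.prod_inv_distrib]
      have : (0 : ℝ) < m l := Nat.cast_pos.2 h2
      positivity
    refine h4.trans_le (Finset.single_le_sum (f := fun i => (m i : ℝ) *
      ∏ h ∈ Finset.Icc 1 i, (D.js h : ℝ)⁻¹) (fun i _ => ?_) (Finset.mem_Icc.2 ⟨hl, le_rfl⟩))
    exact mul_nonneg (Nat.cast_nonneg _)
      (Finset.prod_nonneg fun h _ => inv_nonneg.2 (Nat.cast_nonneg _))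
  · have h4 := D.w_le (l := l) (m := m) fun i hi hi' => by
      rcases hi'.eq_or_lt with rfl | h
      · exact h3
      · exact h1 i hi h
    have : 0 < 1 / ∏ h ∈ Finset.Icc 1 l, (D.js h : ℝ) := by positivity
    linarith

theorem wormholesUpTo_subset_Ioo (n : ℕ) : D.wormholesUpTo n ⊆ Ioo 0 1 := by
  rintro x ⟨l, hl, -, hx⟩
  exact D.wormholes_subset_Ioo hl hx

theorem exists_int_w_mul {l l' : ℕ} (h : l ≤ l') (m : ℕ → ℕ) :
    ∃ z : ℤ, D.w l m * ∏ h ∈ Finset.Icc 1 l', (D.js h : ℝ) = z := by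
  induction l' generalizing l with
  | zero =>
    obtain rfl : l = 0 := by omega
    exact ⟨0, by simp [w]⟩
  | succ l' ih =>
    have hJ := D.prod_js_pos (l' + 1)
    rcases h.eq_or_lt with rfl | h
    · obtain ⟨z, hz⟩ := ih le_rfl
      refine ⟨z * D.js (l' + 1) + m (l' + 1), ?_⟩
      rw [w_succ, add_mul, div_mul_cancel₀ _ hJ.ne', Finset.prod_Icc_succ_top (by omega),
        ← mul_assoc, hz]
      push_cast
      ring
    · obtain ⟨z, hz⟩ := ih (by omega : l ≤ l')
      refine ⟨z * D.js (l' + 1), ?_⟩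
      rw [Finset.prod_Icc_succ_top (by omega), ← mul_assoc, hz]
      push_cast
      ring

/-- A location of level at most `l'` becomes an integer when multiplied by `j₁ ⋯ j_{l'}`; one of
level `l' + 1` does not, because its last numerator lies strictly between `0` and `j_{l'+1}`. -/
theorem not_mem_wormholes_of_lt {l l' : ℕ} (h : l < l') {x : ℝ} (hx : x ∈ D.wormholes l) :
    x ∉ D.wormholes l' := by
  obtain ⟨l', rfl⟩ : ∃ p, l' = p + 1 := ⟨l' - 1, by omega⟩
  rintro ⟨m', -, h2, h3, hx'⟩
  obtain ⟨m, -, -, -, rfl⟩ := hx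
  obtain ⟨z, hz⟩ := D.exists_int_w_mul (by omega : l ≤ l') m
  obtain ⟨z', hz'⟩ := D.exists_int_w_mul (le_refl l') m'
  have hJ := D.prod_js_pos l'
  have hj : (0 : ℝ) < D.js (l' + 1) := Nat.cast_pos.2 (D.js_pos (by omega))
  rw [hx', w_succ, add_mul, hz', Finset.prod_Icc_succ_top (by omega)] at hz
  have h4 : (m' (l' + 1) : ℝ) = (z - z' : ℤ) * D.js (l' + 1) := by
    rw [Int.cast_sub, ← hz]
    field_simp
    ring
  have h5 : (m' (l' + 1) : ℤ) = (z - z') * D.js (l' + 1) := by exact_mod_cast h4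
  have h6 : ((m' (l' + 1) : ℕ) : ℤ) < D.js (l' + 1) := by exact_mod_cast h3
  have h7 : (0 : ℤ) < m' (l' + 1) := by exact_mod_cast h2
  have h8 : z - z' < 1 := by
    by_contra! hc
    nlinarith
  have h9 : 0 < z - z' := by
    by_contra! hc
    nlinarith
  omega

theorem wormholes_level_unique {l l' : ℕ} {x : ℝ} (hx : x ∈ D.wormholes l)
    (hx' : x ∈ D.wormholes l') : l = l' := by
  rcases lt_trichotomy l l' with h | h | h
  · exact absurd hx' (D.not_mem_wormholes_of_lt h hx)
  · exact h
  · exact absurd hx (D.not_mem_wormholes_of_lt h hx')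

theorem finite_wormholes {l : ℕ} (hl : 1 ≤ l) : (D.wormholes l).Finite := by
  have hJ := D.prod_js_pos l
  refine ((finite_Icc (0 : ℤ) (∏ h ∈ Finset.Icc 1 l, D.js h : ℕ)).image fun z : ℤ =>
    (z : ℝ) / ∏ h ∈ Finset.Icc 1 l, (D.js h : ℝ)).subset fun x hx => ?_
  obtain ⟨h0, h1⟩ := D.wormholes_subset_Ioo hl hx
  obtain ⟨m, -, -, -, rfl⟩ := hx
  obtain ⟨z, hz⟩ := D.exists_int_w_mul (le_refl l) m
  refine ⟨z, ⟨?_, ?_⟩, by simp only; rw [← hz, mul_div_cancel_right₀ _ hJ.ne']⟩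
  · have : (0 : ℝ) ≤ z := by rw [← hz]; positivity
    exact_mod_cast this
  · have : (z : ℝ) ≤ ∏ h ∈ Finset.Icc 1 l, (D.js h : ℝ) := by rw [← hz]; nlinarith
    exact_mod_cast this

theorem finite_wormholesUpTo (n : ℕ) : (D.wormholesUpTo n).Finite := by
  have : D.wormholesUpTo n ⊆ ⋃ l ∈ Icc 1 n, D.wormholes l := by
    rintro x ⟨l, hl, h, hx⟩
    exact mem_biUnion ⟨hl, h⟩ hx
  exact ((finite_Icc 1 n).biUnion fun l hl => D.finite_wormholes hl.1).subset this

theorem wormholesUpTo_mono {m n : ℕ} (h : m ≤ n) : D.wormholesUpTo m ⊆ D.wormholesUpTo n := by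
  rintro x ⟨l, h1, h2, hx⟩
  exact ⟨l, h1, h2.trans h, hx⟩

/-! ## The topology of the Laakso space -/

theorem Ident.fst_eq_and_digit_eq {D : LaaksoData} {p q : D.Pre} (h : D.Ident p q) :
    p.1 = q.1 ∧ ∀ n, (p.1 : ℝ) ∉ D.wormholes (n + 1) → ∀ i,
      D.digit (p.2 i) n = D.digit (q.2 i) n := by
  obtain ⟨h1, l, hl, hx, i, ⟨a, ha, hc⟩, hq, hne⟩ := h
  refine ⟨h1, fun n hn i' => ?_⟩
  have hnl : n ≠ l - 1 := by
    rintro rfl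
    exact hn (by rwa [Nat.sub_add_cancel hl])
  by_cases hi : i' = i
  · subst hi
    have h2 : D.digit (p.2 i') (l - 1) = false := by
      rw [(D.mem_cantorCell_iff_digit _ _).1 hc (l - 1) (by simp [ha])]
      simp [← ha]
    have h3 := cantorPoint_update D.t_pos D.t_lt_one _ h2
    rw [D.cantorPoint_digit, ← hq] at h3
    rw [D.digit_eq_of_cantorPoint_eq h3, Function.update_of_ne hnl]
  · rw [hne i' hi]

theorem ident_of_digit {p q : D.Pre} {l : ℕ} (hl : (p.1 : ℝ) ∈ D.wormholes (l + 1))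
    (h1 : p.1 = q.1) (i : Fin D.k) (hne : ∀ i', i' ≠ i → q.2 i' = p.2 i')
    (hd : ∀ n, n ≠ l → D.digit (p.2 i) n = D.digit (q.2 i) n)
    (hp : D.digit (p.2 i) l = false) (hq : D.digit (q.2 i) l = true) : D.Ident p q := by
  -- Levels start at one and digits at zero: a wormhole of level `l + 1` switches digit `l`, and the
  -- word consists of the `l` digits before it.
  refine ⟨h1, l + 1, by omega, hl, i,
    ⟨List.ofFn fun m : Fin l => D.digit (p.2 i) m, by simp, ?_⟩, ?_, hne⟩
  · rw [D.mem_cantorCell_iff_digit]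
    intro m hm
    have hm' := hm
    rw [List.length_append, List.length_ofFn, List.length_singleton] at hm'
    rw [List.get_eq_getElem]
    rcases (by omega : m < l ∨ m = l) with h | rfl
    · rw [List.getElem_append_left (by simpa using h)]
      simp
    · rw [List.getElem_append_right (by simp)]
      simpa using hp
  · rw [Nat.add_sub_cancel, ← D.cantorPoint_digit (p.2 i),
      ← cantorPoint_update D.t_pos D.t_lt_one _ hp, ← D.cantorPoint_digit (q.2 i)]
    congr 1
    funext n
    by_cases hn : n = l
    · subst hn; simp [hq]
    · rw [Function.update_of_ne hn, hd n hn]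

/-- An elementary identification switches a digit in one Cantor coordinate only, so the coordinates
are treated one after another; the set `s` collects those already switched. -/
theorem eqvGen_of_digit {x : unitInterval} {v v' : Fin D.k → cantorK D.t} {l : ℕ}
    (hl : (x : ℝ) ∈ D.wormholes (l + 1))
    (hd : ∀ n, n ≠ l → ∀ i, D.digit (v i) n = D.digit (v' i) n) (s : Finset (Fin D.k)) :
    Relation.EqvGen D.Ident (x, v) (x, fun i => if i ∈ s then v' i else v i) := by
  induction s using Finset.induction_on with
  | empty => simpa using Relation.EqvGen.refl _
  | insert i s hi ih =>
    refine ih.trans _ _ _ ?_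
    set u : Fin D.k → cantorK D.t := fun i => if i ∈ s then v' i else v i with hu
    set u' : Fin D.k → cantorK D.t := fun i' => if i' ∈ insert i s then v' i' else v i' with hu'
    have hui : u i = v i := by simp [hu, hi]
    have hui' : u' i = v' i := by simp [hu']
    have hne : ∀ i', i' ≠ i → u' i' = u i' := fun i' h => by simp [hu, hu', h]
    have hd' : ∀ n, n ≠ l → D.digit (u i) n = D.digit (u' i) n := fun n hn => by
      rw [hui, hui', hd n hn]
    by_cases he : D.digit (u i) l = D.digit (u' i) l
    · have : u = u' := by
        funext i'
        by_cases h : i' = i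
        · subst h
          refine D.digit_injective fun n => ?_
          by_cases hn : n = l
          · rw [hn, he]
          · exact hd' n hn
        · exact (hne i' h).symm
      rw [this]
      exact Relation.EqvGen.refl _
    · cases h : D.digit (u i) l
      · exact Relation.EqvGen.rel _ _ (D.ident_of_digit hl rfl i hne hd' h (by
          rw [h] at he; simpa using he))
      · exact Relation.EqvGen.symm _ _ (Relation.EqvGen.rel _ _ (D.ident_of_digit hl rfl i
          (fun i' hi' => (hne i' hi').symm) (fun n hn => (hd' n hn).symm)
          (by rw [h] at he; simpa using he) h))

/-- Two points are identified if and only if their addresses differ only in the digits that belong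
to the level of a wormhole. -/
theorem proj_eq_iff {p q : D.Pre} : D.proj p = D.proj q ↔ p.1 = q.1 ∧
    ∀ n, (p.1 : ℝ) ∉ D.wormholes (n + 1) → ∀ i, D.digit (p.2 i) n = D.digit (q.2 i) n := by
  constructor
  · intro h
    replace h : Relation.EqvGen D.Ident p q := Quotient.exact h
    induction h with
    | rel p q h => exact h.fst_eq_and_digit_eq
    | refl => exact ⟨rfl, fun _ _ _ => rfl⟩
    | symm p q _ ih =>
      exact ⟨ih.1.symm, fun n hn i => (ih.2 n (by rwa [ih.1]) i).symm⟩
    | trans p q r _ _ ih ih' =>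
      exact ⟨ih.1.trans ih'.1, fun n hn i => (ih.2 n hn i).trans (ih'.2 n (by rwa [← ih.1]) i)⟩
  · obtain ⟨x, v⟩ := p
    obtain ⟨y, v'⟩ := q
    rintro ⟨h, hd⟩
    obtain rfl : x = y := h
    simp only at hd
    refine Quotient.sound (show Relation.EqvGen D.Ident (x, v) (x, v') from ?_)
    by_cases hx : ∃ l, (x : ℝ) ∈ D.wormholes (l + 1)
    · obtain ⟨l, hl⟩ := hx
      -- The location has a single level, so digit `l` is the only one that may differ.
      have := D.eqvGen_of_digit hl (v := v) (v' := v') (fun n hn => hd n fun h => hn (by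
        have := D.wormholes_level_unique h hl
        omega)) Finset.univ
      simpa using this
    · push Not at hx
      have : v = v' := funext fun i => D.digit_injective fun n => hd n (hx n) i
      rw [this]
      exact Relation.EqvGen.refl _

theorem continuous_proj : Continuous D.proj := continuous_quotient_mk'

theorem proj_surjective : Function.Surjective D.proj := Quotient.mk_surjective

instance : CompactSpace D.Space :=
  inferInstanceAs (CompactSpace (Quotient (Relation.EqvGen.setoid D.Ident)))

theorem coord_proj (p : D.Pre) : D.coord (D.proj p) = p.1 := rfl

theorem continuous_coord : Continuous D.coord :=
  Continuous.quotient_lift (continuous_subtype_val.comp continuous_fst) _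

/-- A polynomial function that vanishes exactly at the wormholes of level `n + 1`. -/
def wormholePoly (n : ℕ) (x : ℝ) : ℝ :=
  ∏ s ∈ (D.finite_wormholes (l := n + 1) (by omega)).toFinset, (x - s)

theorem wormholePoly_eq_zero_iff {n : ℕ} {x : ℝ} :
    D.wormholePoly n x = 0 ↔ x ∈ D.wormholes (n + 1) := by
  simp [wormholePoly, Finset.prod_eq_zero_iff, sub_eq_zero]

theorem contDiff_wormholePoly (n : ℕ) : ContDiff ℝ 1 (D.wormholePoly n) :=
  contDiff_prod fun _ _ => contDiff_id.sub contDiff_const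

/-- The function on `L` that is a polynomial in the direction of `I` and depends on the `n`-th
digit of the `i`-th Cantor coordinate. -/
def digitFun (n : ℕ) (i : Fin D.k) : D.Space → ℝ :=
  Quotient.lift (fun p : D.Pre => if D.digit (p.2 i) n then D.wormholePoly n p.1 else 0) (by
    intro p q h
    obtain ⟨h1, h2⟩ := D.proj_eq_iff.1 (Quotient.sound h)
    -- Where the point of `L` fails to determine the digit, the polynomial vanishes.
    by_cases hp : (p.1 : ℝ) ∈ D.wormholes (n + 1)
    · rw [← h1, D.wormholePoly_eq_zero_iff.2 hp, ite_self, ite_self]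
    · rw [h2 n hp i, h1])

theorem digitFun_proj (n : ℕ) (i : Fin D.k) (p : D.Pre) : D.digitFun n i (D.proj p) =
    if D.digit (p.2 i) n then D.wormholePoly n p.1 else 0 := rfl

theorem continuous_digitFun (n : ℕ) (i : Fin D.k) : Continuous (D.digitFun n i) := by
  have h1 : Continuous fun p : D.Pre => if D.digit (p.2 i) n then (1 : ℝ) else 0 :=
    (continuous_of_discreteTopology (f := fun b : Bool => if b then (1 : ℝ) else 0)).comp
      ((D.continuous_digit n).comp ((continuous_apply i).comp continuous_snd))
  have h2 : Continuous fun p : D.Pre => D.wormholePoly n p.1 :=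
    (D.contDiff_wormholePoly n).continuous.comp (continuous_subtype_val.comp continuous_fst)
  refine Continuous.quotient_lift ((h1.mul h2).congr fun p => ?_) _
  by_cases h : D.digit (p.2 i) n <;> simp [h]

theorem eq_of_coord_eq_of_digitFun_eq {q q' : D.Space} (h : D.coord q = D.coord q')
    (hd : ∀ n i, D.digitFun n i q = D.digitFun n i q') : q = q' := by
  obtain ⟨⟨x, v⟩, rfl⟩ := D.proj_surjective q
  obtain ⟨⟨y, v'⟩, rfl⟩ := D.proj_surjective q'
  have hxy : x = y := Subtype.ext h
  subst hxy
  refine D.proj_eq_iff.2 ⟨rfl, fun n hn i => ?_⟩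
  have h1 := hd n i
  have h2 : D.wormholePoly n x ≠ 0 := fun h => hn (D.wormholePoly_eq_zero_iff.1 h)
  simp only [digitFun_proj] at h1 ⊢
  cases h3 : D.digit (v i) n <;> cases h4 : D.digit (v' i) n <;> simp_all

/-- An injective continuous map from `L` to a metrizable space. -/
def embed (q : D.Space) : ℝ × (ℕ × Fin D.k → ℝ) := (D.coord q, fun j => D.digitFun j.1 j.2 q)

theorem continuous_embed : Continuous D.embed :=
  D.continuous_coord.prodMk (continuous_pi fun j => D.continuous_digitFun j.1 j.2)

theorem embed_injective : Function.Injective D.embed := fun _ _ h =>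
  D.eq_of_coord_eq_of_digitFun_eq (congrArg Prod.fst h) fun n i =>
    congrFun (congrArg Prod.snd h) (n, i)

instance : T2Space D.Space := T2Space.of_injective_continuous D.embed_injective D.continuous_embed

theorem isEmbedding_embed : IsEmbedding D.embed :=
  (D.continuous_embed.isClosedEmbedding D.embed_injective).isEmbedding

instance : TopologicalSpace.MetrizableSpace D.Space := D.isEmbedding_embed.metrizableSpace

instance : SecondCountableTopology D.Space := D.isEmbedding_embed.secondCountableTopology

theorem isClosedMap_proj : IsClosedMap D.proj := D.continuous_proj.isClosedMap

/-- A property that holds near every point of the fibre over `q` holds on the whole fibres over the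
points near `q`. -/
theorem eventually_of_forall_fiber {P : D.Pre → Prop} {q : D.Space}
    (h : ∀ p, D.proj p = q → ∀ᶠ p' in 𝓝 p, P p') : ∀ᶠ q' in 𝓝 q, ∀ p, D.proj p = q' → P p :=
  (D.isClosedMap_proj.eventually_nhds_fiber q h).mono fun _ h p hp => h p hp

end LaaksoData

/-! ## Piecewise continuously differentiable functions on the unit interval -/

/-- `s` is continuously differentiable on `[0, 1]` away from `W`, where its derivative has one-sided
limits. -/
def PiecewiseC1 (W : Set ℝ) (s : ℝ → ℝ) : Prop :=
  ContDiffOn ℝ 1 s (Icc 0 1 \ W) ∧ ∀ x ∈ W,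
    (∃ a : ℝ, Tendsto (deriv s) (𝓝[<] x) (𝓝 a)) ∧ (∃ b : ℝ, Tendsto (deriv s) (𝓝[>] x) (𝓝 b))

namespace PiecewiseC1

variable {W : Set ℝ} {s : ℝ → ℝ}

theorem Icc_diff_mem_nhds (hW : W.Finite) {x : ℝ} (hx : x ∈ Ioo 0 1 \ W) :
    Icc 0 1 \ W ∈ 𝓝 x :=
  inter_mem (Icc_mem_nhds hx.1.1 hx.1.2) (hW.isClosed.isOpen_compl.mem_nhds hx.2)

theorem contDiffAt (h : PiecewiseC1 W s) (hW : W.Finite) {x : ℝ} (hx : x ∈ Ioo 0 1 \ W) :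
    ContDiffAt ℝ 1 s x :=
  h.1.contDiffAt (Icc_diff_mem_nhds hW hx)

theorem differentiableAt (h : PiecewiseC1 W s) (hW : W.Finite) {x : ℝ} (hx : x ∈ Ioo 0 1 \ W) :
    DifferentiableAt ℝ s x :=
  (h.contDiffAt hW hx).differentiableAt one_ne_zero

theorem continuousAt_deriv (h : PiecewiseC1 W s) (hW : W.Finite) {x : ℝ}
    (hx : x ∈ Ioo 0 1 \ W) : ContinuousAt (deriv s) x := by
  have h1 := (h.contDiffAt hW hx).fderiv_right (m := 0) (by norm_num)
  exact h1.continuousAt.clm_apply continuousAt_const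

theorem eventually_mem_nhdsNE (hW : W.Finite) {x : ℝ} (hx : x ∈ Ioo (0 : ℝ) 1) :
    ∀ᶠ y in 𝓝[≠] x, y ∈ Ioo 0 1 \ W := by
  have h1 : ∀ᶠ y in 𝓝[≠] x, y ∈ Ioo (0 : ℝ) 1 :=
    mem_nhdsWithin_of_mem_nhds (Ioo_mem_nhds hx.1 hx.2)
  have h2 : ∀ᶠ y in 𝓝[≠] x, y ∉ W := by
    have h3 : (W \ {x})ᶜ ∈ 𝓝 x :=
      (hW.subset sdiff_subset).isClosed.isOpen_compl.mem_nhds fun h => h.2 rfl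
    filter_upwards [mem_nhdsWithin_of_mem_nhds h3, self_mem_nhdsWithin] with y hy hy' hyW
    exact hy ⟨hyW, hy'⟩
  filter_upwards [h1, h2] with y hy hy' using ⟨hy, hy'⟩

theorem of_contDiff {p : ℝ → ℝ} (hp : ContDiff ℝ 1 p) (hs : ∀ x ∈ Icc (0 : ℝ) 1, s x = p x)
    (hW : W ⊆ Ioo 0 1) : PiecewiseC1 W s := by
  refine ⟨hp.contDiffOn.congr fun x hx => hs x hx.1, fun x hx => ?_⟩
  have h1 : deriv s =ᶠ[𝓝 x] deriv p := by
    refine EventuallyEq.deriv ?_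
    filter_upwards [Icc_mem_nhds (hW hx).1 (hW hx).2] with y hy using hs y hy
  have h2 : Tendsto (deriv s) (𝓝 x) (𝓝 (deriv p x)) :=
    ((hp.continuous_deriv le_rfl).tendsto x).congr' h1.symm
  exact ⟨⟨_, h2.mono_left nhdsWithin_le_nhds⟩, ⟨_, h2.mono_left nhdsWithin_le_nhds⟩⟩

theorem mono (h : PiecewiseC1 W s) (hW : W.Finite) {W' : Set ℝ} (hWW : W ⊆ W')
    (hW' : W' ⊆ Ioo 0 1) : PiecewiseC1 W' s := by
  refine ⟨h.1.mono (sdiff_subset_sdiff_right hWW), fun x hx => ?_⟩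
  by_cases hxW : x ∈ W
  · exact h.2 x hxW
  · have h2 := h.continuousAt_deriv hW ⟨hW' hx, hxW⟩
    exact ⟨⟨_, h2.mono_left nhdsWithin_le_nhds⟩, ⟨_, h2.mono_left nhdsWithin_le_nhds⟩⟩

/-- A general `Φ` of two variables treats sums, products and compositions at once. The one-sided
limits of the two derivatives pass through the continuous derivative of `Φ`. -/
theorem comp₂ {s₁ s₂ : ℝ → ℝ} (h₁ : PiecewiseC1 W s₁) (h₂ : PiecewiseC1 W s₂)
    (hc₁ : Continuous s₁) (hc₂ : Continuous s₂) (hW : W.Finite) (hW' : W ⊆ Ioo 0 1)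
    {Φ : ℝ × ℝ → ℝ} (hΦ : ContDiff ℝ 1 Φ) : PiecewiseC1 W fun x => Φ (s₁ x, s₂ x) := by
  refine ⟨hΦ.comp_contDiffOn (h₁.1.prodMk h₂.1), fun x hx => ?_⟩
  have hd : ∀ y ∈ Ioo 0 1 \ W, deriv (fun x => Φ (s₁ x, s₂ x)) y =
      fderiv ℝ Φ (s₁ y, s₂ y) (deriv s₁ y, deriv s₂ y) := by
    intro y hy
    have h3 := (hΦ.differentiable one_ne_zero (s₁ y, s₂ y)).hasFDerivAt
    exact (h3.comp_hasDerivAt y ((h₁.differentiableAt hW hy).hasDerivAt.prodMk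
      (h₂.differentiableAt hW hy).hasDerivAt)).deriv
  have key : ∀ l : Filter ℝ, l ≤ 𝓝[≠] x → (∃ a, Tendsto (deriv s₁) l (𝓝 a)) →
      (∃ b, Tendsto (deriv s₂) l (𝓝 b)) →
      ∃ c, Tendsto (deriv fun x => Φ (s₁ x, s₂ x)) l (𝓝 c) := by
    rintro l hl ⟨a, ha⟩ ⟨b, hb⟩
    refine ⟨fderiv ℝ Φ (s₁ x, s₂ x) (a, b), Tendsto.congr' (f₁ := fun y =>
      fderiv ℝ Φ (s₁ y, s₂ y) (deriv s₁ y, deriv s₂ y)) ?_ ?_⟩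
    · filter_upwards [hl (eventually_mem_nhdsNE hW (hW' hx))] with y hy using (hd y hy).symm
    · have h4 : Tendsto (fun y => fderiv ℝ Φ (s₁ y, s₂ y)) l (𝓝 (fderiv ℝ Φ (s₁ x, s₂ x))) :=
        (((hΦ.continuous_fderiv one_ne_zero).comp (hc₁.prodMk hc₂)).tendsto x).mono_left
          (hl.trans nhdsWithin_le_nhds)
      have h5 : Continuous fun p : ((ℝ × ℝ) →L[ℝ] ℝ) × (ℝ × ℝ) => p.1 p.2 :=
        continuous_fst.clm_apply continuous_snd
      exact (h5.tendsto (_, (a, b))).comp (h4.prodMk_nhds (ha.prodMk_nhds hb))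
  exact ⟨key _ (nhdsWithin_mono x fun y hy => ne_of_lt hy) (h₁.2 x hx).1 (h₂.2 x hx).1,
    key _ (nhdsWithin_mono x fun y hy => ne_of_gt hy) (h₁.2 x hx).2 (h₂.2 x hx).2⟩

theorem exists_bound (h : PiecewiseC1 W s) (hW : W.Finite) :
    ∃ M : ℝ, ∀ x ∈ Ioo 0 1 \ W, |deriv s x| ≤ M := by
  have hb : ∀ {l : Filter ℝ} {g : ℝ → ℝ} {a : ℝ}, Tendsto g l (𝓝 a) →
      ∀ᶠ x in l, |g x| ≤ |a| + 1 := fun hg =>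
    (hg.abs.eventually (gt_mem_nhds (lt_add_one _))).mono fun _ h => h.le
  have key : ∃ M : ℝ, ∀ x ∈ Icc (0 : ℝ) 1, x ∈ Ioo 0 1 \ W → |deriv s x| ≤ M := by
    refine isCompact_Icc.induction_on (p := fun S => ∃ M : ℝ, ∀ x ∈ S, x ∈ Ioo 0 1 \ W →
      |deriv s x| ≤ M) ⟨0, by simp⟩ ?_ ?_ ?_
    · rintro S T hST ⟨M, hM⟩
      exact ⟨M, fun x hx => hM x (hST hx)⟩
    · rintro S T ⟨M, hM⟩ ⟨N, hN⟩
      refine ⟨max M N, fun x hx hx' => ?_⟩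
      rcases hx with hx | hx
      · exact (hM x hx hx').trans (le_max_left _ _)
      · exact (hN x hx hx').trans (le_max_right _ _)
    · intro x hx
      by_cases hxW : x ∈ W
      · obtain ⟨⟨a, ha⟩, b, hb'⟩ := h.2 x hxW
        have h1 : ∀ᶠ y in 𝓝[≠] x, |deriv s y| ≤ max (|a| + 1) (|b| + 1) := by
          rw [← nhdsLT_sup_nhdsGT, eventually_sup]
          exact ⟨(hb ha).mono fun y hy => hy.trans (le_max_left _ _),
            (hb hb').mono fun y hy => hy.trans (le_max_right _ _)⟩
        rw [eventually_nhdsWithin_iff] at h1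
        exact ⟨_, mem_nhdsWithin_of_mem_nhds h1, _, fun y hy hy' =>
          hy fun h => hy'.2 (by rwa [mem_singleton_iff.1 h])⟩
      -- The derivative within the interval is continuous at the endpoints as well, where `deriv s`
      -- itself is not controlled.
      · have hu : UniqueDiffOn ℝ (Icc 0 1 \ W) :=
          (uniqueDiffOn_Icc zero_lt_one).inter hW.isClosed.isOpen_compl
        have h1 := hb ((h.1.continuousOn_derivWithin hu le_rfl) x ⟨hx, hxW⟩)
        rw [eventually_nhdsWithin_iff] at h1
        refine ⟨_, mem_nhdsWithin_of_mem_nhds h1, |derivWithin s (Icc 0 1 \ W) x| + 1,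
          fun y hy hy' => ?_⟩
        rw [← derivWithin_of_mem_nhds (Icc_diff_mem_nhds hW hy')]
        exact hy ⟨Ioo_subset_Icc_self hy'.1, hy'.2⟩
  obtain ⟨M, hM⟩ := key
  exact ⟨M, fun x hx => hM x (Ioo_subset_Icc_self hx.1) hx⟩

theorem intervalIntegrable_deriv (h : PiecewiseC1 W s) (hW : W.Finite) {a b : ℝ}
    (ha : a ∈ Icc (0 : ℝ) 1) (hb : b ∈ Icc (0 : ℝ) 1) :
    IntervalIntegrable (deriv s) volume a b := by
  obtain ⟨M, hM⟩ := h.exists_bound hW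
  rw [intervalIntegrable_iff]
  refine Measure.integrableOn_of_bounded (M := M) (by simp [uIoc])
    (measurable_deriv s).aestronglyMeasurable ?_
  have h1 : ∀ᵐ x, x ∉ W ∪ {1} := compl_mem_ae_iff.2 ((hW.union (finite_singleton 1)).measure_zero _)
  rw [ae_restrict_iff' measurableSet_uIoc]
  filter_upwards [h1] with x hx hxI
  refine hM x ⟨?_, fun h => hx (Or.inl h)⟩
  have h2 : x ≠ 1 := fun h => hx (Or.inr h)
  have h3 : min a b < x ∧ x ≤ max a b := hxI
  exact ⟨(le_min ha.1 hb.1).trans_lt h3.1, (h3.2.trans (max_le ha.2 hb.2)).lt_of_ne h2⟩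

/-- Continuity of `s` rules out jumps on `W`, so a finite exceptional set does not affect the
fundamental theorem of calculus. -/
theorem integral_deriv (h : PiecewiseC1 W s) (hc : Continuous s) (hW : W.Finite) {a b : ℝ}
    (ha : a ∈ Icc (0 : ℝ) 1) (hb : b ∈ Icc (0 : ℝ) 1) : ∫ x in a..b, deriv s x = s b - s a := by
  refine integral_eq_of_hasDerivAt_off_countable s (deriv s) hW.countable hc.continuousOn
    (fun x hx => (h.differentiableAt hW ⟨?_, hx.2⟩).hasDerivAt)
    (h.intervalIntegrable_deriv hW ha hb)
  exact ⟨(le_min ha.1 hb.1).trans_lt hx.1.1, hx.1.2.trans_le (max_le ha.2 hb.2)⟩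

theorem abs_sub_le (h : PiecewiseC1 W s) (hc : Continuous s) (hW : W.Finite) {M : ℝ}
    (hM : ∀ x ∈ Ioo 0 1 \ W, |deriv s x| ≤ M) {a b : ℝ}
    (ha : a ∈ Icc (0 : ℝ) 1) (hb : b ∈ Icc (0 : ℝ) 1) : |s b - s a| ≤ M * |b - a| := by
  rw [← h.integral_deriv hc hW ha hb]
  refine intervalIntegral.norm_integral_le_of_norm_le_const_ae (f := deriv s) ?_
  have h1 : ∀ᵐ x, x ∉ W ∪ {1} := compl_mem_ae_iff.2 ((hW.union (finite_singleton 1)).measure_zero _)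
  filter_upwards [h1] with x hx hxI
  refine hM x ⟨?_, fun h => hx (Or.inl h)⟩
  have h2 : x ≠ 1 := fun h => hx (Or.inr h)
  have h3 : min a b < x ∧ x ≤ max a b := hxI
  exact ⟨(le_min ha.1 hb.1).trans_lt h3.1, (h3.2.trans (max_le ha.2 hb.2)).lt_of_ne h2⟩

end PiecewiseC1

namespace LaaksoData

variable {D : LaaksoData}

/-! ## The class `𝒢` -/

theorem continuous_slice {f : D.Space → ℝ} (hf : Continuous f) (v : Fin D.k → cantorK D.t) :
    Continuous (D.slice f v) :=
  hf.comp (D.continuous_proj.comp (continuous_projIcc.prodMk continuous_const))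

/-- A cell of level `n` is the set of points with prescribed first `n` digits. -/
theorem mem_GLevel_iff {n : ℕ} {f : C(D.Space, ℝ)} : f ∈ D.GLevel n ↔
    (∀ (x : unitInterval) (v v' : Fin D.k → cantorK D.t),
      (∀ i, ∀ m < n, D.digit (v i) m = D.digit (v' i) m) → f (D.proj (x, v)) = f (D.proj (x, v'))) ∧
    ∀ v, PiecewiseC1 (D.wormholesUpTo n) (D.slice f v) := by
  refine and_congr ⟨fun h x v v' hv => ?_, fun h x c hc v v' hv hv' => ?_⟩ Iff.rfl
  · refine h x (fun i => List.ofFn fun m : Fin n => D.digit (v i) m) (by simp) v v' (fun i => ?_)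
      fun i => ?_
    · rw [D.mem_cantorCell_iff_digit]
      intro m hm
      simp
    · rw [D.mem_cantorCell_iff_digit]
      intro m hm
      rw [← hv i m (by simpa using hm)]
      simp
  · refine h x v v' fun i m hm => ?_
    rw [(D.mem_cantorCell_iff_digit _ _).1 (hv i) m (by rwa [hc]),
      (D.mem_cantorCell_iff_digit _ _).1 (hv' i) m (by rwa [hc])]

theorem GLevel_mono {m n : ℕ} (h : m ≤ n) : D.GLevel m ⊆ D.GLevel n := by
  intro f hf
  rw [mem_GLevel_iff] at hf ⊢
  exact ⟨fun x v v' hv => hf.1 x v v' fun i l hl => hv i l (hl.trans_le h), fun v =>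
    (hf.2 v).mono (D.finite_wormholesUpTo m) (D.wormholesUpTo_mono h)
      (D.wormholesUpTo_subset_Ioo n)⟩

theorem comp₂_mem_G {f g : C(D.Space, ℝ)} (hf : f ∈ D.G) (hg : g ∈ D.G) {Φ : ℝ × ℝ → ℝ}
    (hΦ : ContDiff ℝ 1 Φ) {h : C(D.Space, ℝ)} (hh : ∀ q, h q = Φ (f q, g q)) : h ∈ D.G := by
  obtain ⟨m, hm⟩ := mem_iUnion.1 hf
  obtain ⟨n, hn⟩ := mem_iUnion.1 hg
  have hf' := mem_GLevel_iff.1 (GLevel_mono (le_max_left m n) hm)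
  have hg' := mem_GLevel_iff.1 (GLevel_mono (le_max_right m n) hn)
  refine mem_iUnion.2 ⟨max m n, mem_GLevel_iff.2 ⟨fun x v v' hv => ?_, fun v => ?_⟩⟩
  · rw [hh, hh, hf'.1 x v v' hv, hg'.1 x v v' hv]
  · have e : D.slice h v = fun x => Φ (D.slice f v x, D.slice g v x) := funext fun x => hh _
    rw [e]
    exact (hf'.2 v).comp₂ (hg'.2 v) (continuous_slice f.continuous v)
      (continuous_slice g.continuous v) (D.finite_wormholesUpTo _) (D.wormholesUpTo_subset_Ioo _) hΦ

theorem add_mem_G {f g : C(D.Space, ℝ)} (hf : f ∈ D.G) (hg : g ∈ D.G) : f + g ∈ D.G :=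
  comp₂_mem_G hf hg (contDiff_fst.add contDiff_snd) fun _ => rfl

theorem mul_mem_G {f g : C(D.Space, ℝ)} (hf : f ∈ D.G) (hg : g ∈ D.G) : f * g ∈ D.G :=
  comp₂_mem_G hf hg (contDiff_fst.mul contDiff_snd) fun _ => rfl

theorem smul_mem_G (c : ℝ) {f : C(D.Space, ℝ)} (hf : f ∈ D.G) : c • f ∈ D.G :=
  comp₂_mem_G hf hf (contDiff_const.mul contDiff_fst) fun _ => rfl

theorem comp_mem_G {f : C(D.Space, ℝ)} (hf : f ∈ D.G) {φ : ℝ → ℝ} (hφ : ContDiff ℝ 1 φ) :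
    (⟨φ, hφ.continuous⟩ : C(ℝ, ℝ)).comp f ∈ D.G :=
  comp₂_mem_G hf hf (hφ.comp contDiff_fst) fun _ => rfl

theorem const_mem_G (c : ℝ) : ContinuousMap.const D.Space c ∈ D.G :=
  mem_iUnion.2 ⟨0, mem_GLevel_iff.2 ⟨fun _ _ _ _ => rfl, fun _ =>
    PiecewiseC1.of_contDiff contDiff_const (fun _ _ => rfl) (D.wormholesUpTo_subset_Ioo 0)⟩⟩

theorem coord_mem_G : (⟨D.coord, D.continuous_coord⟩ : C(D.Space, ℝ)) ∈ D.G :=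
  mem_iUnion.2 ⟨0, mem_GLevel_iff.2 ⟨fun _ _ _ _ => rfl, fun v =>
    PiecewiseC1.of_contDiff contDiff_id (fun x hx => by
      change ((projIcc 0 1 zero_le_one x : unitInterval) : ℝ) = x
      rw [projIcc_of_mem _ hx]) (D.wormholesUpTo_subset_Ioo 0)⟩⟩

theorem digitFun_mem_G (n : ℕ) (i : Fin D.k) :
    (⟨D.digitFun n i, D.continuous_digitFun n i⟩ : C(D.Space, ℝ)) ∈ D.G := by
  refine mem_iUnion.2 ⟨n + 1, mem_GLevel_iff.2 ⟨fun x v v' hv => ?_, fun v => ?_⟩⟩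
  · change D.digitFun n i (D.proj (x, v)) = D.digitFun n i (D.proj (x, v'))
    rw [digitFun_proj, digitFun_proj, hv i n (by omega)]
  · by_cases h : D.digit (v i) n
    · refine PiecewiseC1.of_contDiff (D.contDiff_wormholePoly n) (fun x hx => ?_)
        (D.wormholesUpTo_subset_Ioo _)
      change D.digitFun n i (D.proj (projIcc 0 1 zero_le_one x, v)) = _
      rw [digitFun_proj, if_pos h, projIcc_of_mem _ hx]
    · refine PiecewiseC1.of_contDiff (p := fun _ => 0) contDiff_const (fun x hx => ?_)
        (D.wormholesUpTo_subset_Ioo _)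
      change D.digitFun n i (D.proj (projIcc 0 1 zero_le_one x, v)) = _
      rw [digitFun_proj, if_neg h]

/-- `𝒢` as a subalgebra of `C(L)`. -/
def GSubalgebra (D : LaaksoData) : Subalgebra ℝ C(D.Space, ℝ) where
  carrier := D.G
  mul_mem' := mul_mem_G
  add_mem' := add_mem_G
  algebraMap_mem' := const_mem_G

theorem GSubalgebra_separatesPoints : (GSubalgebra D).SeparatesPoints := by
  intro q q' hne
  by_contra! h
  refine hne (D.eq_of_coord_eq_of_digitFun_eq (h _ ⟨_, coord_mem_G, rfl⟩) fun n i =>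
    h _ ⟨_, digitFun_mem_G n i, rfl⟩)

theorem exists_mem_G_near (g : C(D.Space, ℝ)) {ε : ℝ} (hε : 0 < ε) :
    ∃ f ∈ D.G, ‖f - g‖ < ε := by
  obtain ⟨f, hf⟩ := ContinuousMap.exists_mem_subalgebra_near_continuousMap_of_separatesPoints
    (GSubalgebra D) GSubalgebra_separatesPoints g ε hε
  exact ⟨f, f.2, hf⟩

/-! ## Local structure -/

theorem eventually_digit_eq (n : ℕ) (p : D.Pre) :
    ∀ᶠ p' in 𝓝 p, ∀ i, ∀ m < n, D.digit (p.2 i) m = D.digit (p'.2 i) m := by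
  rw [eventually_all]
  intro i
  have h : ∀ m ∈ Finset.range n, ∀ᶠ p' : D.Pre in 𝓝 p, D.digit (p.2 i) m = D.digit (p'.2 i) m := by
    intro m _
    have hc : Continuous fun p' : D.Pre => D.digit (p'.2 i) m :=
      (D.continuous_digit m).comp ((continuous_apply i).comp continuous_snd)
    have h1 := hc.tendsto p (mem_nhds_discrete.2 (mem_singleton (D.digit (p.2 i) m)))
    filter_upwards [h1] with p' hp' using hp'.symm
  filter_upwards [(eventually_all_finset _).2 h] with p' hp' m hm
    using hp' m (Finset.mem_range.2 hm)

/-- A point near `D.proj p` comes from a point near some `p₀` in the fibre and shares its first `n`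
digits. Moved back to the coordinate `p.1`, it therefore has the value of `f` at `D.proj p₀ = D.proj
p`, even if this point is a wormhole. -/
theorem eventually_eq_of_mem_GLevel {n : ℕ} {f : C(D.Space, ℝ)} (hf : f ∈ D.GLevel n) (p : D.Pre) :
    ∀ᶠ q in 𝓝 (D.proj p), ∀ p', D.proj p' = q → f (D.proj (p.1, p'.2)) = f (D.proj p) := by
  refine D.eventually_of_forall_fiber fun p₀ hp₀ => ?_
  filter_upwards [eventually_digit_eq n p₀] with p' hp'
  have h1 : p₀.1 = p.1 := (D.proj_eq_iff.1 hp₀).1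
  rw [← h1, ← (mem_GLevel_iff.1 hf).1 p₀.1 p₀.2 p'.2 hp']
  exact congrArg f hp₀

/-- Away from the wormholes of level at most `n`, all points of a fibre share their first `n`
digits, so near such a point `f` is a function of the `I`-coordinate alone. -/
theorem eventually_slice_eq_of_mem_GLevel {n : ℕ} {f : C(D.Space, ℝ)} (hf : f ∈ D.GLevel n)
    {p : D.Pre} (hp : (p.1 : ℝ) ∉ D.wormholesUpTo n) :
    ∀ᶠ q in 𝓝 (D.proj p), ∀ p', D.proj p' = q → D.slice f p'.2 = D.slice f p.2 := by
  refine D.eventually_of_forall_fiber fun p₀ hp₀ => ?_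
  filter_upwards [eventually_digit_eq n p₀] with p' hp'
  funext x
  refine ((mem_GLevel_iff.1 hf).1 _ p.2 p'.2 fun i m hm => ?_).symm
  rw [← hp' i m hm]
  refine (D.proj_eq_iff.1 hp₀.symm).2 m (fun h => hp ⟨m + 1, by omega, by omega, h⟩) i

theorem dx_proj {n : ℕ} {f : C(D.Space, ℝ)} (hf : f ∈ D.GLevel n) {p : D.Pre}
    (hp : (p.1 : ℝ) ∉ D.wormholesUpTo n) : D.dx f (D.proj p) = deriv (D.slice f p.2) p.1 := by
  have h1 : D.proj (Quotient.out (D.proj p)) = D.proj p := Quotient.out_eq _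
  unfold dx
  rw [(eventually_slice_eq_of_mem_GLevel hf hp).self_of_nhds _ h1, (D.proj_eq_iff.1 h1).1]

theorem eventually_dx_eq {n : ℕ} {f : C(D.Space, ℝ)} (hf : f ∈ D.GLevel n) {p : D.Pre}
    (hp : (p.1 : ℝ) ∉ D.wormholesUpTo n) :
    ∀ᶠ q in 𝓝 (D.proj p), D.dx f q = deriv (D.slice f p.2) (D.coord q) := by
  filter_upwards [eventually_slice_eq_of_mem_GLevel hf hp] with q hq
  unfold dx
  rw [hq _ (Quotient.out_eq q)]
  congr 1
  conv_rhs => rw [← Quotient.out_eq q]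
  rfl

theorem isOpen_regular (D : LaaksoData) (n : ℕ) :
    IsOpen (D.coord ⁻¹' (Ioo 0 1 \ D.wormholesUpTo n)) :=
  (isOpen_Ioo.sdiff (D.finite_wormholesUpTo n).isClosed).preimage D.continuous_coord

theorem continuousOn_dx {n : ℕ} {f : C(D.Space, ℝ)} (hf : f ∈ D.GLevel n) :
    ContinuousOn (D.dx f) (D.coord ⁻¹' (Ioo 0 1 \ D.wormholesUpTo n)) := by
  intro q hq
  obtain ⟨p, rfl⟩ := D.proj_surjective q
  have h1 := ((mem_GLevel_iff.1 hf).2 p.2).continuousAt_deriv (D.finite_wormholesUpTo n) hq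
  exact ((ContinuousAt.comp (f := D.coord) (x := D.proj p) h1
    D.continuous_coord.continuousAt).congr
      ((eventually_dx_eq hf hq.2).mono fun q h => h.symm)).continuousWithinAt

theorem exists_bound_deriv_slice {n : ℕ} {f : C(D.Space, ℝ)} (hf : f ∈ D.GLevel n) :
    ∃ M : ℝ, 0 ≤ M ∧ ∀ v, ∀ x ∈ Ioo 0 1 \ D.wormholesUpTo n, |deriv (D.slice f v) x| ≤ M := by
  have key : ∃ M : ℝ, ∀ p ∈ (univ : Set D.Pre), ∀ x ∈ Ioo 0 1 \ D.wormholesUpTo n,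
      |deriv (D.slice f p.2) x| ≤ M := by
    refine isCompact_univ.induction_on (p := fun S : Set D.Pre => ∃ M : ℝ, ∀ p ∈ S,
      ∀ x ∈ Ioo 0 1 \ D.wormholesUpTo n, |deriv (D.slice f p.2) x| ≤ M) ⟨0, by simp⟩ ?_ ?_ ?_
    · rintro S T hST ⟨M, hM⟩
      exact ⟨M, fun x hx => hM x (hST hx)⟩
    · rintro S T ⟨M, hM⟩ ⟨N, hN⟩
      refine ⟨max M N, fun p hp x hx => ?_⟩
      rcases hp with hp | hp
      · exact (hM p hp x hx).trans (le_max_left _ _)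
      · exact (hN p hp x hx).trans (le_max_right _ _)
    · intro p _
      obtain ⟨M, hM⟩ := ((mem_GLevel_iff.1 hf).2 p.2).exists_bound (D.finite_wormholesUpTo n)
      refine ⟨_, mem_nhdsWithin_of_mem_nhds (eventually_digit_eq n p), M, fun p' hp' => ?_⟩
      have e : D.slice f p'.2 = D.slice f p.2 := funext fun x =>
        ((mem_GLevel_iff.1 hf).1 _ p.2 p'.2 hp').symm
      rwa [e]
  obtain ⟨M, hM⟩ := key
  exact ⟨max M 0, le_max_right _ _, fun v x hx =>
    (hM (0, v) (mem_univ _) x hx).trans (le_max_left _ _)⟩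

theorem abs_slice_sub_le {n : ℕ} {f : C(D.Space, ℝ)} (hf : f ∈ D.GLevel n) {M : ℝ}
    (hM : ∀ v, ∀ x ∈ Ioo 0 1 \ D.wormholesUpTo n, |deriv (D.slice f v) x| ≤ M)
    (x y : unitInterval) (v : Fin D.k → cantorK D.t) :
    |f (D.proj (y, v)) - f (D.proj (x, v))| ≤ M * |(y : ℝ) - x| := by
  have := ((mem_GLevel_iff.1 hf).2 v).abs_sub_le (continuous_slice f.continuous v)
    (D.finite_wormholesUpTo n) (hM v) x.2 y.2
  simpa only [slice, projIcc_val] using this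

/-! ## Upper gradients of functions in `𝒢` -/

open Classical in
/-- A Borel representative of `|∂f/∂x|` that is equal to `M` at the wormholes of level at
most `n`. -/
def absDx (D : LaaksoData) (f : D.Space → ℝ) (n : ℕ) (M : ℝ) (q : D.Space) : ℝ :=
  if q ∈ D.coord ⁻¹' (Ioo 0 1 \ D.wormholesUpTo n) then |D.dx f q| else M

theorem measurable_absDx {n : ℕ} {f : C(D.Space, ℝ)} (hf : f ∈ D.GLevel n) (M : ℝ) :
    Measurable (D.absDx f n M) := by
  classical
  exact ContinuousOn.measurable_piecewise (continuousOn_dx hf).abs continuousOn_const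
    (isOpen_regular D n).measurableSet

theorem absDx_le {n : ℕ} {f : C(D.Space, ℝ)} (hf : f ∈ D.GLevel n) {M : ℝ}
    (hM : ∀ v, ∀ x ∈ Ioo 0 1 \ D.wormholesUpTo n, |deriv (D.slice f v) x| ≤ M) (q : D.Space) :
    D.absDx f n M q ≤ M := by
  unfold absDx
  split_ifs with h
  · obtain ⟨p, rfl⟩ := D.proj_surjective q
    rw [dx_proj hf h.2]
    exact hM p.2 _ h
  · exact le_rfl

theorem absDx_nonneg {f : D.Space → ℝ} {n : ℕ} {M : ℝ} (hM : 0 ≤ M) (q : D.Space) :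
    0 ≤ D.absDx f n M q := by
  unfold absDx
  split_ifs
  · exact abs_nonneg _
  · exact hM

theorem abs_coord_sub_le {γ : ℝ → D.Space} {ℓ : ℝ} (hγ : D.IsArcLengthCurve γ ℓ) {s s' : ℝ}
    (hs : s ∈ Icc 0 ℓ) (hs' : s' ∈ Icc 0 ℓ) : |D.coord (γ s') - D.coord (γ s)| ≤ |s' - s| := by
  wlog h : s ≤ s' generalizing s s'
  · rw [abs_sub_comm, abs_sub_comm s']
    exact this hs' hs (le_of_not_ge h)
  have h1 := hγ.unitSpeed hs hs'
  have h2 := eVariationOn.edist_le (D.coord ∘ γ) (s := Icc 0 ℓ ∩ Icc s s')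
    ⟨hs', h, le_rfl⟩ ⟨hs, le_rfl, h⟩
  rw [h1, NNReal.coe_one, one_mul, edist_dist, Real.dist_eq] at h2
  rw [abs_of_nonneg (sub_nonneg.2 h)]
  exact (ENNReal.ofReal_le_ofReal_iff (sub_nonneg.2 h)).1 h2

/-- Changing sheets at `q` does not change the value of `f`, so near `q` only the displacement in
the direction of `I` counts. -/
theorem eventually_abs_sub_le {n : ℕ} {f : C(D.Space, ℝ)} (hf : f ∈ D.GLevel n) {M : ℝ}
    (hM : ∀ v, ∀ x ∈ Ioo 0 1 \ D.wormholesUpTo n, |deriv (D.slice f v) x| ≤ M) (q : D.Space) :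
    ∀ᶠ q' in 𝓝 q, |f q' - f q| ≤ M * |D.coord q' - D.coord q| := by
  obtain ⟨p, rfl⟩ := D.proj_surjective q
  filter_upwards [eventually_eq_of_mem_GLevel hf p] with q' hq'
  obtain ⟨p', rfl⟩ := D.proj_surjective q'
  rw [← hq' p' rfl]
  exact abs_slice_sub_le hf hM _ _ _

/-- The local estimate together with the fact that the `I`-coordinate is 1-Lipschitz along the curve
bounds the right slopes of `|f ∘ γ - f (γ s)|` by `M`; a one-sided mean value inequality makes this
global. -/
theorem lipschitzOnWith_of_mem_GLevel {n : ℕ} {f : C(D.Space, ℝ)} (hf : f ∈ D.GLevel n) {M : ℝ}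
    (hM0 : 0 ≤ M)
    (hM : ∀ v, ∀ x ∈ Ioo 0 1 \ D.wormholesUpTo n, |deriv (D.slice f v) x| ≤ M)
    {γ : ℝ → D.Space} {ℓ : ℝ} (hγ : D.IsArcLengthCurve γ ℓ) :
    LipschitzOnWith (Real.toNNReal M) (f ∘ γ) (Icc 0 ℓ) := by
  refine LipschitzOnWith.of_dist_le_mul fun s' hs' s hs => ?_
  rw [Real.coe_toNNReal M hM0, Real.dist_eq, Real.dist_eq]
  wlog h : s ≤ s' generalizing s s'
  · rw [abs_sub_comm, abs_sub_comm s']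
    exact this s hs s' hs' (le_of_not_ge h)
  have hsub : Icc s s' ⊆ Icc 0 ℓ := Icc_subset_Icc hs.1 hs'.2
  have hc : ContinuousOn (fun r => |(f ∘ γ) r - (f ∘ γ) s|) (Icc s s') :=
    ((f.continuous.comp_continuousOn (hγ.cont.mono hsub)).sub continuousOn_const).abs
  have key := image_le_of_liminf_slope_right_le_deriv_boundary hc (B := fun r => M * (r - s))
    (B' := fun _ => M) (by simp) (by fun_prop)
    (fun r _ => by simpa using (((hasDerivAt_id r).sub_const s).const_mul M).hasDerivWithinAt)
    (fun r hr C hC => ?_) ⟨h, le_rfl⟩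
  · rwa [abs_of_nonneg (sub_nonneg.2 h)]
  · have h1 : Tendsto γ (𝓝[Ioc r s'] r) (𝓝 (γ r)) :=
      (hγ.cont r (hsub ⟨hr.1, hr.2.le⟩)).mono
        ((Ioc_subset_Icc_self.trans (Icc_subset_Icc_left hr.1)).trans hsub)
    rw [nhdsWithin_Ioc_eq_nhdsGT hr.2] at h1
    have h2 := h1.eventually (eventually_abs_sub_le hf hM (γ r))
    refine Eventually.frequently ?_
    filter_upwards [h2, Ioc_mem_nhdsGT hr.2] with z hz hzI
    refine lt_of_le_of_lt ?_ hC
    rw [slope_def_field, div_le_iff₀ (sub_pos.2 hzI.1)]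
    have h3 := abs_coord_sub_le hγ (hsub ⟨hr.1, hr.2.le⟩) (hsub ⟨hr.1.trans hzI.1.le, hzI.2⟩)
    rw [abs_of_pos (sub_pos.2 hzI.1)] at h3
    have h4 := abs_sub_abs_le_abs_sub ((f ∘ γ) z - (f ∘ γ) s) ((f ∘ γ) r - (f ∘ γ) s)
    rw [sub_sub_sub_cancel_right] at h4
    exact h4.trans (hz.trans (mul_le_mul_of_nonneg_left h3 hM0))

theorem eventually_apply_eq_slice {n : ℕ} {f : C(D.Space, ℝ)} (hf : f ∈ D.GLevel n) {p : D.Pre}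
    (hp : (p.1 : ℝ) ∉ D.wormholesUpTo n) :
    ∀ᶠ q in 𝓝 (D.proj p), f q = D.slice f p.2 (D.coord q) := by
  filter_upwards [eventually_slice_eq_of_mem_GLevel hf hp] with q hq
  obtain ⟨p', rfl⟩ := D.proj_surjective q
  rw [← hq p' rfl, slice, coord_proj, projIcc_val]

/-- At the exceptional coordinates the Lipschitz constant `M` is used, so nothing needs to be known
about the time that the curve spends there. -/
theorem abs_deriv_comp_le {n : ℕ} {f : C(D.Space, ℝ)} (hf : f ∈ D.GLevel n) {M : ℝ}
    (hM0 : 0 ≤ M)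
    (hM : ∀ v, ∀ x ∈ Ioo 0 1 \ D.wormholesUpTo n, |deriv (D.slice f v) x| ≤ M)
    {γ : ℝ → D.Space} {ℓ : ℝ} (hγ : D.IsArcLengthCurve γ ℓ) {s : ℝ} (hs : s ∈ Ioo 0 ℓ) :
    |deriv (f ∘ γ) s| ≤ D.absDx f n M (γ s) := by
  have hcont : ContinuousAt γ s :=
    (hγ.cont s (Ioo_subset_Icc_self hs)).continuousAt (Icc_mem_nhds hs.1 hs.2)
  have hcoord : ∀ᶠ s' in 𝓝 s, |D.coord (γ s') - D.coord (γ s)| ≤ |s' - s| := by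
    filter_upwards [Icc_mem_nhds hs.1 hs.2] with s' hs'
      using abs_coord_sub_le hγ (Ioo_subset_Icc_self hs) hs'
  have key : ∀ C : ℝ, 0 ≤ C → (∀ᶠ q in 𝓝 (γ s), |f q - f (γ s)| ≤
      C * |D.coord q - D.coord (γ s)|) → |deriv (f ∘ γ) s| ≤ C := by
    intro C hC h
    refine norm_deriv_le_of_lip' (f := f ∘ γ) hC ?_
    filter_upwards [hcont.eventually h, hcoord] with s' h1 h2
    exact h1.trans (mul_le_mul_of_nonneg_left h2 hC)
  unfold absDx
  split_ifs with h
  · obtain ⟨p, hp⟩ := D.proj_surjective (γ s)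
    rw [← hp] at h ⊢
    have hd := (((mem_GLevel_iff.1 hf).2 p.2).differentiableAt (D.finite_wormholesUpTo n)
      h).hasDerivAt
    have hev := eventually_apply_eq_slice hf h.2
    rw [dx_proj hf h.2]
    -- Near a regular point, increments of `f` are at most `|∂f| + ε` times the increments of the
    -- coordinate.
    refine le_of_forall_pos_le_add fun ε hε => key _ (by positivity) ?_
    have h1 := D.continuous_coord.continuousAt.eventually
      ((hasDerivAt_iff_isLittleO.1 hd).def hε)
    rw [← hp]
    filter_upwards [hev, h1] with q hq hq'
    rw [hq, hev.self_of_nhds]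
    rw [Real.norm_eq_abs, Real.norm_eq_abs, smul_eq_mul] at hq'
    have h2 := abs_add_le (D.slice f p.2 (D.coord q) - D.slice f p.2 (D.coord (D.proj p)) -
      (D.coord q - D.coord (D.proj p)) * deriv (D.slice f p.2) (D.coord (D.proj p)))
      ((D.coord q - D.coord (D.proj p)) * deriv (D.slice f p.2) (D.coord (D.proj p)))
    rw [sub_add_cancel, abs_mul] at h2
    rw [add_mul, ← coord_proj]
    linarith
  · exact key M hM0 (eventually_abs_sub_le hf hM _)

/-- The absolute value of the derivative in the direction of `I` is an upper gradient. -/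
theorem isUpperGradient_absDx {n : ℕ} {f : C(D.Space, ℝ)} (hf : f ∈ D.GLevel n) {M : ℝ}
    (hM0 : 0 ≤ M)
    (hM : ∀ v, ∀ x ∈ Ioo 0 1 \ D.wormholesUpTo n, |deriv (D.slice f v) x| ≤ M) :
    D.IsUpperGradient f fun q => ENNReal.ofReal (D.absDx f n M q) := by
  intro γ ℓ hγ
  have hL := lipschitzOnWith_of_mem_GLevel hf hM0 hM hγ
  have hac : AbsolutelyContinuousOnInterval (f ∘ γ) 0 ℓ := by
    rw [← uIcc_of_le hγ.nonneg] at hL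
    exact hL.absolutelyContinuousOnInterval
  have h1 := hac.integral_deriv_eq_sub
  have h2 : |f (γ 0) - f (γ ℓ)| = ‖∫ s in Icc 0 ℓ, deriv (f ∘ γ) s‖ := by
    rw [integral_Icc_eq_integral_Ioc, ← intervalIntegral.integral_of_le hγ.nonneg, h1, abs_sub_comm]
    rfl
  rw [h2, ofReal_norm]
  refine (enorm_integral_le_lintegral_enorm _).trans ?_
  rw [setLIntegral_congr Ioo_ae_eq_Icc.symm, setLIntegral_congr Ioo_ae_eq_Icc.symm]
  refine setLIntegral_mono' measurableSet_Ioo fun s hs => ?_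
  rw [Real.enorm_eq_ofReal_abs]
  exact ENNReal.ofReal_le_ofReal (abs_deriv_comp_le hf hM0 hM hγ hs)

end LaaksoData

/-! ### Subsequences converging almost everywhere, and differentiation of integrals -/

/-- Along a subsequence with integrals at most `2⁻ⁿ` the sum of the functions is integrable, hence
finite almost everywhere. -/
theorem exists_subseq_ae_tendsto_zero {α : Type*} [MeasurableSpace α] {μ : Measure α}
    {ψ : ℕ → α → ℝ≥0∞} (hψ : ∀ n, AEMeasurable (ψ n) μ)
    (h : Tendsto (fun n => ∫⁻ x, ψ n x ∂μ) atTop (𝓝 0)) :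
    ∃ φ : ℕ → ℕ, StrictMono φ ∧ ∀ᵐ x ∂μ, Tendsto (fun n => ψ (φ n) x) atTop (𝓝 0) := by
  obtain ⟨φ, hφ, hle⟩ := extraction_forall_of_eventually
    (P := fun n m => ∫⁻ x, ψ m x ∂μ ≤ 2⁻¹ ^ n) fun n =>
      (ENNReal.tendsto_nhds_zero.1 h) (2⁻¹ ^ n) (ENNReal.pow_pos (by simp) n)
  refine ⟨φ, hφ, ?_⟩
  have h1 : ∫⁻ x, ∑' n, ψ (φ n) x ∂μ ≠ ∞ := by
    rw [lintegral_tsum fun n => hψ (φ n)]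
    refine ((ENNReal.tsum_le_tsum hle).trans_lt ?_).ne
    rw [ENNReal.tsum_geometric]
    simp
  filter_upwards [ae_lt_top' (AEMeasurable.tsum fun n => hψ (φ n)) h1] with x hx
  exact ENNReal.tendsto_atTop_zero_of_tsum_ne_top hx.ne

theorem ae_nonneg_of_integral_Ioc_nonneg {h : ℝ → ℝ}
    (hi : Integrable h (volume.restrict (Icc 0 1)))
    (hn : ∀ᵐ a ∂volume.restrict (Icc (0 : ℝ) 1), ∀ᵐ b ∂volume.restrict (Icc (0 : ℝ) 1), a ≤ b →
      0 ≤ ∫ x in Ioc a b, h x ∂volume.restrict (Icc (0 : ℝ) 1)) :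
    ∀ᵐ x ∂volume.restrict (Icc (0 : ℝ) 1), 0 ≤ h x := by
  have hi' : IntervalIntegrable h volume 0 1 := by
    rw [intervalIntegrable_iff_integrableOn_Icc_of_le zero_le_one]
    exact hi
  have h1 : ∀ᵐ x ∂volume.restrict (Icc (0 : ℝ) 1), x ≠ 1 :=
    ae_restrict_of_ae (Measure.ae_ne volume 1)
  rw [ae_restrict_iff' measurableSet_Icc] at hn h1 ⊢
  filter_upwards [hn, h1, hi'.ae_hasDerivAt_integral] with x hx hx1 hd hxI
  have hd := hd (by rwa [uIcc_of_le zero_le_one]) 0 (by simp)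
  have hlt : x < 1 := hxI.2.lt_of_ne (hx1 hxI)
  have h2 := hd.tendsto_slope.mono_left (nhdsWithin_mono x fun y (hy : x < y) => hy.ne')
  refine ge_of_tendsto_of_frequently h2 ?_
  -- Only almost every endpoint `b` is admissible, so the slopes are known to be nonnegative merely
  -- at points accumulating at `x`; as their limit exists, this suffices.
  have h3 : ∃ᶠ y in 𝓝[>] x, y ∈ Ioo x 1 ∧ (y ∈ Icc (0 : ℝ) 1 → x ≤ y →
      0 ≤ ∫ x in Ioc x y, h x ∂volume.restrict (Icc (0 : ℝ) 1)) := by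
    have h4 := hx hxI
    rw [ae_restrict_iff' measurableSet_Icc] at h4
    intro hcon
    obtain ⟨u, hu, hsub⟩ := (mem_nhdsGT_iff_exists_Ioo_subset' hlt).1 hcon
    have hpos : 0 < volume (Ioo x (min u 1)) := by
      rw [Real.volume_Ioo, ENNReal.ofReal_pos, sub_pos]
      exact lt_min hu hlt
    refine hpos.ne' (measure_mono_null (fun y hy => ?_) h4)
    intro hyn
    exact hsub ⟨hy.1, hy.2.trans_le (min_le_left _ _)⟩
      ⟨⟨hy.1, hy.2.trans_le (min_le_right _ _)⟩, hyn⟩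
  refine h3.mono fun y hy => ?_
  have h5 := hy.2 ⟨hxI.1.trans hy.1.1.le, hy.1.2.le⟩ hy.1.1.le
  have hsub : Ioc x y ⊆ Icc 0 1 := fun z hz => ⟨hxI.1.trans hz.1.le, hz.2.trans hy.1.2.le⟩
  rw [Measure.restrict_restrict measurableSet_Ioc, inter_eq_left.2 hsub,
    ← intervalIntegral.integral_of_le hy.1.1.le] at h5
  rw [slope_def_field]
  refine div_nonneg ?_ (sub_nonneg.2 hy.1.1.le)
  rw [intervalIntegral.integral_interval_sub_left]
  · exact h5
  · exact hi'.mono_set (by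
      rw [uIcc_of_le zero_le_one, uIcc_of_le (hxI.1.trans hy.1.1.le)]
      exact Icc_subset_Icc_right hy.1.2.le)
  · exact hi'.mono_set (by
      rw [uIcc_of_le zero_le_one, uIcc_of_le hxI.1]
      exact Icc_subset_Icc_right hxI.2)

instance (t : ℝ) : IsFiniteMeasure (cantorMeasure t) := by
  unfold cantorMeasure
  infer_instance

/-! ### The measure on `L` as an integral over segments -/

namespace LaaksoData

variable (D : LaaksoData)

/-- The Bernoulli measure on `K^k`. -/
def fiberMeasure : Measure (Fin D.k → cantorK D.t) := Measure.pi fun _ => cantorMeasure D.t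

instance : IsFiniteMeasure D.fiberMeasure := by
  unfold fiberMeasure
  infer_instance

/-- The segment in `L` over `v`, as a function of `v` and of the `I`-coordinate. -/
def path (p : (Fin D.k → cantorK D.t) × ℝ) : D.Space := D.proj (projIcc 0 1 zero_le_one p.2, p.1)

theorem continuous_path : Continuous D.path :=
  D.continuous_proj.comp ((continuous_projIcc.comp continuous_snd).prodMk continuous_fst)

theorem measurePreserving_path :
    MeasurePreserving D.path (D.fiberMeasure.prod (volume.restrict (Icc (0 : ℝ) 1))) D.μ := by
  have h1 : MeasurePreserving (projIcc (0 : ℝ) 1 zero_le_one) (volume.restrict (Icc (0 : ℝ) 1))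
      (volume : Measure unitInterval) := by
    refine ⟨continuous_projIcc.measurable, ?_⟩
    rw [← (measurePreserving_subtype_coe (measurableSet_Icc (a := (0 : ℝ)) (b := 1))).map_eq,
      Measure.map_map continuous_projIcc.measurable measurable_subtype_coe]
    have : projIcc (0 : ℝ) 1 zero_le_one ∘ Subtype.val = id := funext fun x => projIcc_val _ x
    rw [this, Measure.map_id]
    rfl
  have h2 := h1.prod (MeasurePreserving.id D.fiberMeasure)
  have h3 : MeasurePreserving D.proj (volume.prod D.fiberMeasure) D.μ :=
    ⟨D.continuous_proj.measurable, rfl⟩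
  exact h3.comp (h2.comp Measure.measurePreserving_swap)

instance : IsFiniteMeasure D.μ := by
  rw [← D.measurePreserving_path.map_eq]
  infer_instance

variable {D}

theorem ae_ae_path {P : D.Space → Prop} (h : ∀ᵐ q ∂D.μ, P q) :
    ∀ᵐ v ∂D.fiberMeasure, ∀ᵐ x ∂volume.restrict (Icc (0 : ℝ) 1), P (D.path (v, x)) :=
  Measure.ae_ae_of_ae_prod (D.measurePreserving_path.quasiMeasurePreserving.ae h)

theorem ae_of_ae_ae_path {P : D.Space → Prop} (hP : MeasurableSet {q | P q})
    (h : ∀ᵐ v ∂D.fiberMeasure, ∀ᵐ x ∂volume.restrict (Icc (0 : ℝ) 1), P (D.path (v, x))) :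
    ∀ᵐ q ∂D.μ, P q := by
  rw [← D.measurePreserving_path.map_eq,
    ae_map_iff D.continuous_path.measurable.aemeasurable hP]
  exact (Measure.ae_prod_iff_ae_ae (D.continuous_path.measurable hP)).2 h

theorem ae_integrable_path {g : D.Space → ℝ} (hg : MemLp g 2 D.μ) : ∀ᵐ v ∂D.fiberMeasure,
    Integrable (fun x => g (D.path (v, x))) (volume.restrict (Icc (0 : ℝ) 1)) :=
  (D.measurePreserving_path.integrable_comp_of_integrable
    (hg.integrable one_le_two)).prod_right_ae

theorem tendsto_lintegral_enorm_of_eLpNorm {f : ℕ → D.Space → ℝ} {g : D.Space → ℝ}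
    (hf : ∀ n, MemLp (f n) 2 D.μ) (hg : MemLp g 2 D.μ)
    (h : Tendsto (fun n => eLpNorm (fun q => f n q - g q) 2 D.μ) atTop (𝓝 0)) :
    Tendsto (fun n => ∫⁻ q, ‖f n q - g q‖ₑ ∂D.μ) atTop (𝓝 0) := by
  have h1 : ∀ n, ∫⁻ q, ‖f n q - g q‖ₑ ∂D.μ ≤ eLpNorm (fun q => f n q - g q) 2 D.μ *
      D.μ univ ^ (1 / (1 : ℝ≥0∞).toReal - 1 / (2 : ℝ≥0∞).toReal) := fun n => by
    rw [← eLpNorm_one_eq_lintegral_enorm]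
    exact eLpNorm_le_eLpNorm_mul_rpow_measure_univ one_le_two ((hf n).sub hg).1
  refine tendsto_of_tendsto_of_tendsto_of_le_of_le tendsto_const_nhds ?_ (fun _ => zero_le) h1
  rw [← zero_mul (D.μ univ ^ (1 / (1 : ℝ≥0∞).toReal - 1 / (2 : ℝ≥0∞).toReal))]
  refine ENNReal.Tendsto.mul_const h
    (Or.inr (ENNReal.rpow_ne_top_of_nonneg ?_ (measure_ne_top _ _)))
  norm_num

theorem exists_subseq_ae_tendsto {f : ℕ → D.Space → ℝ} {g : D.Space → ℝ}
    (hf : ∀ n, MemLp (f n) 2 D.μ) (hg : MemLp g 2 D.μ)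
    (h : Tendsto (fun n => eLpNorm (fun q => f n q - g q) 2 D.μ) atTop (𝓝 0)) :
    ∃ φ : ℕ → ℕ, StrictMono φ ∧ ∀ᵐ q ∂D.μ, Tendsto (fun n => f (φ n) q) atTop (𝓝 (g q)) := by
  obtain ⟨φ, hφ, hae⟩ := exists_subseq_ae_tendsto_zero
    (fun n => ((hf n).1.aemeasurable.sub hg.1.aemeasurable).enorm)
    (tendsto_lintegral_enorm_of_eLpNorm hf hg h)
  refine ⟨φ, hφ, hae.mono fun q hq => ?_⟩
  rw [tendsto_iff_edist_tendsto_0]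
  simp only [edist_eq_enorm_sub]
  exact hq

/-- By Fubini the `L¹` distances on the segments integrate to the `L¹` distance on `L`, which the
`L²` distance controls since `μ` is finite. -/
theorem exists_subseq_ae_tendsto_lintegral {f : ℕ → D.Space → ℝ} {g : D.Space → ℝ}
    (hf : ∀ n, MemLp (f n) 2 D.μ) (hg : MemLp g 2 D.μ)
    (h : Tendsto (fun n => eLpNorm (fun q => f n q - g q) 2 D.μ) atTop (𝓝 0)) :
    ∃ φ : ℕ → ℕ, StrictMono φ ∧ ∀ᵐ v ∂D.fiberMeasure,
      Tendsto (fun n => ∫⁻ x in Icc (0 : ℝ) 1, ‖f (φ n) (D.path (v, x)) - g (D.path (v, x))‖ₑ)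
        atTop (𝓝 0) := by
  have hm : ∀ n, AEMeasurable (fun q => ‖f n q - g q‖ₑ) D.μ := fun n =>
    ((hf n).1.aemeasurable.sub hg.1.aemeasurable).enorm
  have hm' : ∀ n, AEMeasurable (fun p => ‖f n (D.path p) - g (D.path p)‖ₑ)
      (D.fiberMeasure.prod (volume.restrict (Icc (0 : ℝ) 1))) := fun n =>
    (hm n).comp_quasiMeasurePreserving D.measurePreserving_path.quasiMeasurePreserving
  refine exists_subseq_ae_tendsto_zero (fun n => (hm' n).lintegral_prod_right') ?_
  have h2 := tendsto_lintegral_enorm_of_eLpNorm hf hg h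
  refine h2.congr fun n => ?_
  rw [← lintegral_prod _ (hm' n), ← D.measurePreserving_path.map_eq, lintegral_map' _
    D.continuous_path.measurable.aemeasurable]
  rw [D.measurePreserving_path.map_eq]
  exact hm n

/-! ## Increments along segments -/

/-- The increments of `f` along almost all segments are bounded by the integrals of `g`. -/
def SubGrad (f g : D.Space → ℝ) : Prop :=
  ∀ᵐ v ∂D.fiberMeasure, ∀ᵐ a ∂volume.restrict (Icc (0 : ℝ) 1),
    ∀ᵐ b ∂volume.restrict (Icc (0 : ℝ) 1), a ≤ b → f (D.path (v, b)) - f (D.path (v, a)) ≤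
      ∫ x in Ioc a b, g (D.path (v, x)) ∂volume.restrict (Icc (0 : ℝ) 1)

theorem SubGrad.congr {f f' g g' : D.Space → ℝ} (h : SubGrad f g) (hf : f =ᵐ[D.μ] f')
    (hg : g =ᵐ[D.μ] g') : SubGrad f' g' := by
  filter_upwards [h, ae_ae_path hf, ae_ae_path hg] with v hv hfv hgv
  filter_upwards [hv, hfv] with a ha hfa
  filter_upwards [ha, hfv] with b hb hfb hab
  rw [← hfa, ← hfb, ← integral_congr_ae (ae_restrict_of_ae hgv)]
  exact hb hab

theorem SubGrad.add {f f' g g' : D.Space → ℝ} (h : SubGrad f g) (h' : SubGrad f' g')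
    (hg : MemLp g 2 D.μ) (hg' : MemLp g' 2 D.μ) :
    SubGrad (fun q => f q + f' q) fun q => g q + g' q := by
  filter_upwards [h, h', ae_integrable_path hg, ae_integrable_path hg'] with v hv hv' hi hi'
  filter_upwards [hv, hv'] with a ha ha'
  filter_upwards [ha, ha'] with b hb hb' hab
  rw [integral_add hi.restrict hi'.restrict]
  linarith [hb hab, hb' hab]

theorem SubGrad.of_tendsto {f g : ℕ → D.Space → ℝ} {f' g' : D.Space → ℝ}
    (h : ∀ n, SubGrad (f n) (g n)) (hf : ∀ n, MemLp (f n) 2 D.μ) (hf' : MemLp f' 2 D.μ)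
    (hg : ∀ n, MemLp (g n) 2 D.μ) (hg' : MemLp g' 2 D.μ)
    (hft : Tendsto (fun n => eLpNorm (fun q => f n q - f' q) 2 D.μ) atTop (𝓝 0))
    (hgt : Tendsto (fun n => eLpNorm (fun q => g n q - g' q) 2 D.μ) atTop (𝓝 0)) :
    SubGrad f' g' := by
  -- The first subsequence gives convergence of the values of `f` at almost all endpoints, a further
  -- one convergence of the integrals of `g` along almost all segments.
  obtain ⟨φ, hφ, h1⟩ := exists_subseq_ae_tendsto hf hf' hft
  obtain ⟨ψ, hψ, h2⟩ := exists_subseq_ae_tendsto_lintegral (fun n => hg (φ n)) hg'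
    (hgt.comp hφ.tendsto_atTop)
  filter_upwards [ae_all_iff.2 h, ae_ae_path h1, h2, ae_integrable_path hg',
    ae_all_iff.2 fun n => ae_integrable_path (hg n)] with v hv hfv hgv hi hin
  filter_upwards [ae_all_iff.2 hv, hfv] with a ha hfa
  filter_upwards [ae_all_iff.2 ha, hfv] with b hb hfb hab
  refine le_of_tendsto_of_tendsto' ((hfb.comp hψ.tendsto_atTop).sub (hfa.comp hψ.tendsto_atTop))
    (tendsto_setIntegral_of_L1 _ hi.1 (Eventually.of_forall fun n => hin _) hgv (Ioc a b))
    fun n => hb _ hab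

/-- This is the comparison principle: applied to the sum of a relation for `u` and one for `-u`, it
yields an inequality between the two gradients almost everywhere. -/
theorem SubGrad.nonneg {f g : D.Space → ℝ} (h : SubGrad f g) (hf : f =ᵐ[D.μ] 0)
    (hg : MemLp g 2 D.μ) : ∀ᵐ q ∂D.μ, 0 ≤ g q := by
  have hm := hg.1.aemeasurable
  have h1 : SubGrad (0 : D.Space → ℝ) (hm.mk g) := h.congr hf hm.ae_eq_mk
  have h2 := ae_integrable_path ((memLp_congr_ae hm.ae_eq_mk).1 hg)
  have h3 : ∀ᵐ q ∂D.μ, 0 ≤ hm.mk g q := by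
    refine ae_of_ae_ae_path (measurableSet_le measurable_const hm.measurable_mk) ?_
    filter_upwards [h1, h2] with v hv hi
    refine ae_nonneg_of_integral_Ioc_nonneg hi ?_
    filter_upwards [hv] with a ha
    filter_upwards [ha] with b hb hab
    simpa using hb hab
  filter_upwards [h3, hm.ae_eq_mk] with q hq hq'
  rwa [hq']

/-- The pieces of the segments are themselves curves of unit speed, so the upper gradient inequality
may be tested on them. -/
theorem subGrad_of_isUpperGradient {f : D.Space → ℝ} {g : D.Space → ℝ≥0∞} (hg : Measurable g)
    (hg2 : ∫⁻ q, g q ^ 2 ∂D.μ < ∞) (hi : MemLp (fun q => (g q).toReal) 2 D.μ)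
    (h : D.IsUpperGradient f g) : SubGrad f fun q => (g q).toReal := by
  have h1 : ∀ᵐ q ∂D.μ, g q < ∞ := by
    filter_upwards [ae_lt_top (hg.pow_const 2) hg2.ne] with q hq
    simpa using hq
  filter_upwards [ae_ae_path h1, ae_integrable_path hi] with v hv hiv
  have hmem : ∀ᵐ a ∂volume.restrict (Icc (0 : ℝ) 1), a ∈ Icc (0 : ℝ) 1 :=
    ae_restrict_mem measurableSet_Icc
  filter_upwards [hmem] with a ha
  filter_upwards [hmem] with b hb hab
  have hcoord : ∀ s ∈ Icc 0 (b - a), D.coord (D.path (v, a + s)) = a + s := fun s hs => by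
    rw [path, coord_proj, projIcc_of_mem]
    exact ⟨by linarith [ha.1, hs.1], by linarith [hb.2, hs.2]⟩
  have hγ : D.IsArcLengthCurve (fun s => D.path (v, a + s)) (b - a) := by
    refine ⟨sub_nonneg.2 hab, (D.continuous_path.comp (by fun_prop)).continuousOn, ?_⟩
    rw [HasUnitSpeedOn, hasConstantSpeedOnWith_iff_ordered]
    intro x hx y hy hxy
    have hm : MonotoneOn (fun s => a + s) (Icc 0 (b - a)) := fun s _ s' _ hss =>
      add_le_add_right hss a
    have he : EqOn (D.coord ∘ fun s => D.path (v, a + s)) (fun s => a + s)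
        (Icc 0 (b - a) ∩ Icc x y) := fun s hs => hcoord s hs.1
    rw [eVariationOn.congr he]
    rw [hm.eVariationOn_eq hx hy]
    simp
  have h2 := h _ _ hγ
  simp only [add_zero, add_sub_cancel] at h2
  have h3 : ∫⁻ s in Icc 0 (b - a), g (D.path (v, a + s)) = ∫⁻ x in Icc a b, g (D.path (v, x)) := by
    have h4 := (measurePreserving_add_left volume a).setLIntegral_comp_preimage
      (measurableSet_Icc (a := a) (b := b)) (f := fun x => g (D.path (v, x)))
      (hg.comp (D.continuous_path.measurable.comp measurable_prodMk_left))
    rw [← h4, Set.preimage_const_add_Icc, sub_self]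
  have hsub : Ioc a b ⊆ Icc 0 1 := fun z hz => ⟨ha.1.trans hz.1.le, hz.2.trans hb.2⟩
  rw [h3, ← setLIntegral_congr Ioc_ae_eq_Icc] at h2
  rw [Measure.restrict_restrict measurableSet_Ioc, inter_eq_left.2 hsub]
  have h5 : ∫⁻ x in Ioc a b, g (D.path (v, x)) =
      ENNReal.ofReal (∫ x in Ioc a b, (g (D.path (v, x))).toReal) := by
    rw [ofReal_integral_eq_lintegral_ofReal (IntegrableOn.mono_set hiv hsub)
      (Eventually.of_forall fun x => ENNReal.toReal_nonneg)]
    refine lintegral_congr_ae ?_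
    filter_upwards [ae_restrict_of_ae_restrict_of_subset hsub hv] with x hx
    rw [ENNReal.ofReal_toReal hx.ne]
  rw [h5, ENNReal.ofReal_le_ofReal_iff (integral_nonneg fun x => ENNReal.toReal_nonneg)] at h2
  exact (le_abs_self _).trans (by rwa [abs_sub_comm])

theorem IsUpperGradient.neg {f : D.Space → ℝ} {g : D.Space → ℝ≥0∞} (h : D.IsUpperGradient f g) :
    D.IsUpperGradient (fun q => -f q) g := fun γ ℓ hγ => by
  have := h γ ℓ hγ
  rwa [← abs_neg, neg_sub', ] at this

theorem ae_mem_regular (D : LaaksoData) (n : ℕ) :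
    ∀ᵐ q ∂D.μ, q ∈ D.coord ⁻¹' (Ioo 0 1 \ D.wormholesUpTo n) := by
  refine ae_of_ae_ae_path (isOpen_regular D n).measurableSet (Eventually.of_forall fun v => ?_)
  have h1 : ∀ᵐ x ∂volume.restrict (Icc (0 : ℝ) 1), x ∉ D.wormholesUpTo n ∪ {0, 1} :=
    ae_restrict_of_ae (compl_mem_ae_iff.2
      (((D.finite_wormholesUpTo n).union (toFinite {0, 1})).measure_zero _))
  filter_upwards [h1, ae_restrict_mem measurableSet_Icc] with x hx hxI
  rw [mem_preimage, path, coord_proj, projIcc_of_mem _ hxI]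
  simp only [mem_union, mem_insert_iff, mem_singleton_iff, not_or] at hx
  exact ⟨⟨hxI.1.lt_of_ne' hx.2.1, hxI.2.lt_of_ne hx.2.2⟩, hx.1⟩

theorem memLp_dx {f : C(D.Space, ℝ)} (hf : f ∈ D.G) : MemLp (D.dx f) 2 D.μ := by
  obtain ⟨n, hn⟩ := mem_iUnion.1 hf
  obtain ⟨M, -, hM⟩ := exists_bound_deriv_slice hn
  have h1 := (continuousOn_dx hn).aestronglyMeasurable (μ := D.μ) (isOpen_regular D n).measurableSet
  rw [Measure.restrict_eq_self_of_ae_mem (ae_mem_regular D n)] at h1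
  refine MemLp.of_bound h1 M ?_
  filter_upwards [ae_mem_regular D n] with q hq
  obtain ⟨p, rfl⟩ := D.proj_surjective q
  rw [dx_proj hn hq.2]
  exact hM _ _ hq

theorem dx_path {n : ℕ} {f : C(D.Space, ℝ)} (hf : f ∈ D.GLevel n) {v : Fin D.k → cantorK D.t}
    {x : ℝ} (hx : x ∈ Icc (0 : ℝ) 1 \ D.wormholesUpTo n) :
    D.dx f (D.path (v, x)) = deriv (D.slice f v) x := by
  have h : ((projIcc 0 1 zero_le_one x : unitInterval) : ℝ) = x := by rw [projIcc_of_mem _ hx.1]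
  rw [path, dx_proj hf (by simpa only [h] using hx.2)]
  simp only [h]

theorem integral_dx_path {f : C(D.Space, ℝ)} (hf : f ∈ D.G) (v : Fin D.k → cantorK D.t) {a b : ℝ}
    (ha : a ∈ Icc (0 : ℝ) 1) (hb : b ∈ Icc (0 : ℝ) 1) (hab : a ≤ b) :
    ∫ x in Ioc a b, D.dx f (D.path (v, x)) ∂volume.restrict (Icc (0 : ℝ) 1) =
      f (D.path (v, b)) - f (D.path (v, a)) := by
  obtain ⟨n, hn⟩ := mem_iUnion.1 hf
  have hsub : Ioc a b ⊆ Icc 0 1 := fun z hz => ⟨ha.1.trans hz.1.le, hz.2.trans hb.2⟩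
  have h1 := ((mem_GLevel_iff.1 hn).2 v).integral_deriv (continuous_slice f.continuous v)
    (D.finite_wormholesUpTo n) ha hb
  rw [Measure.restrict_restrict measurableSet_Ioc, inter_eq_left.2 hsub]
  rw [intervalIntegral.integral_of_le hab] at h1
  refine Eq.trans (integral_congr_ae ?_) h1
  have h2 : ∀ᵐ x ∂volume.restrict (Ioc a b), x ∉ D.wormholesUpTo n :=
    ae_restrict_of_ae (compl_mem_ae_iff.2 ((D.finite_wormholesUpTo n).measure_zero _))
  filter_upwards [h2, ae_restrict_mem measurableSet_Ioc] with x hx hxI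
  exact dx_path hn ⟨hsub hxI, hx⟩

theorem subGrad_dx {f : C(D.Space, ℝ)} (hf : f ∈ D.G) : SubGrad f (D.dx f) := by
  have hmem : ∀ᵐ a ∂volume.restrict (Icc (0 : ℝ) 1), a ∈ Icc (0 : ℝ) 1 :=
    ae_restrict_mem measurableSet_Icc
  refine Eventually.of_forall fun v => ?_
  filter_upwards [hmem] with a ha
  filter_upwards [hmem] with b hb hab
  rw [integral_dx_path hf v ha hb hab]

/-- At a regular point this is the ordinary chain rule for the slices through the chosen
representative. -/
theorem dx_comp₂ {f g : C(D.Space, ℝ)} (hf : f ∈ D.G) (hg : g ∈ D.G) {Φ : ℝ × ℝ → ℝ}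
    (hΦ : ContDiff ℝ 1 Φ) : D.dx (fun q => Φ (f q, g q)) =ᵐ[D.μ]
      fun q => fderiv ℝ Φ (f q, g q) (D.dx f q, D.dx g q) := by
  obtain ⟨m, hm⟩ := mem_iUnion.1 hf
  obtain ⟨n, hn⟩ := mem_iUnion.1 hg
  have hf' := GLevel_mono (le_max_left m n) hm
  have hg' := GLevel_mono (le_max_right m n) hn
  have hW := D.finite_wormholesUpTo (max m n)
  filter_upwards [ae_mem_regular D (max m n)] with q hq
  have hp : D.proj (Quotient.out q) = q := Quotient.out_eq q
  rw [← hp] at hq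
  have hs : ∀ h : D.Space → ℝ, h q = D.slice h (Quotient.out q).2 (Quotient.out q).1 := fun h => by
    rw [slice, projIcc_val]
    exact congrArg h hp.symm
  rw [hs f, hs g]
  exact ((hΦ.differentiable one_ne_zero _).hasFDerivAt.comp_hasDerivAt _
    ((((mem_GLevel_iff.1 hf').2 _).differentiableAt hW hq).hasDerivAt.prodMk
      (((mem_GLevel_iff.1 hg').2 _).differentiableAt hW hq).hasDerivAt)).deriv

/-! ## The gradient -/

theorem dx_add {f g : C(D.Space, ℝ)} (hf : f ∈ D.G) (hg : g ∈ D.G) :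
    D.dx ⇑(f + g) =ᵐ[D.μ] D.dx f + D.dx g := by
  have h := dx_comp₂ hf hg (ContinuousLinearMap.fst ℝ ℝ ℝ + ContinuousLinearMap.snd ℝ ℝ ℝ).contDiff
  simp only [ContinuousLinearMap.fderiv] at h
  exact h

theorem dx_smul (c : ℝ) {f : C(D.Space, ℝ)} (hf : f ∈ D.G) :
    D.dx ⇑(c • f) =ᵐ[D.μ] c • D.dx f := by
  have h := dx_comp₂ hf hf (c • ContinuousLinearMap.fst ℝ ℝ ℝ).contDiff
  simp only [ContinuousLinearMap.fderiv] at h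
  exact h

theorem dx_comp {f : C(D.Space, ℝ)} (hf : f ∈ D.G) {φ ψ : ℝ → ℝ} (hφ : ContDiff ℝ 1 φ)
    (hψ : ∀ x, HasDerivAt φ (ψ x) x) :
    D.dx (φ ∘ f) =ᵐ[D.μ] fun q => ψ (f q) * D.dx f q := by
  filter_upwards [dx_comp₂ hf hf (hφ.comp contDiff_fst)] with q hq
  refine hq.trans ?_
  have h1 : HasFDerivAt (φ ∘ Prod.fst) (ψ (f q) • ContinuousLinearMap.fst ℝ ℝ ℝ) (f q, f q) :=
    (hψ (f q)).comp_hasFDerivAt (f q, f q) hasFDerivAt_fst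
  rw [h1.fderiv]
  rfl

/-- The graph of `f ↦ ∂f/∂x` on `𝒢`. -/
def coreGraph (D : LaaksoData) : Submodule ℝ (L2 D.μ × L2 D.μ) where
  carrier := {p | ∃ f ∈ D.G, (p.1 : D.Space → ℝ) =ᵐ[D.μ] f ∧ (p.2 : D.Space → ℝ) =ᵐ[D.μ] D.dx f}
  zero_mem' := by
    refine ⟨(0 : ℝ) • ContinuousMap.const D.Space 0, smul_mem_G 0 (const_mem_G 0), ?_, ?_⟩
    · filter_upwards [Lp.coeFn_zero ℝ 2 D.μ] with q hq
      simpa using hq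
    · filter_upwards [Lp.coeFn_zero ℝ 2 D.μ, dx_smul 0 (const_mem_G (D := D) 0)] with q hq hq'
      rw [hq']
      simpa using hq
  add_mem' := by
    rintro p p' ⟨f, hf, h1, h2⟩ ⟨g, hg, h1', h2'⟩
    refine ⟨f + g, add_mem_G hf hg, ?_, ?_⟩
    · filter_upwards [Lp.coeFn_add p.1 p'.1, h1, h1'] with q hq hq1 hq2
      rw [Prod.fst_add, hq, Pi.add_apply, hq1, hq2]
      rfl
    · filter_upwards [Lp.coeFn_add p.2 p'.2, h2, h2', dx_add hf hg] with q hq hq1 hq2 hq3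
      rw [Prod.snd_add, hq, Pi.add_apply, hq1, hq2, hq3]
      rfl
  smul_mem' := by
    rintro c p ⟨f, hf, h1, h2⟩
    refine ⟨c • f, smul_mem_G c hf, ?_, ?_⟩
    · filter_upwards [Lp.coeFn_smul c p.1, h1] with q hq hq1
      rw [Prod.smul_fst, hq, Pi.smul_apply, hq1]
      rfl
    · filter_upwards [Lp.coeFn_smul c p.2, h2, dx_smul c hf] with q hq hq1 hq2
      rw [Prod.smul_snd, hq, Pi.smul_apply, hq1, hq2]
      rfl

theorem gradientGraph_eq : D.gradientGraph = D.coreGraph.topologicalClosure := by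
  have h : Submodule.span ℝ (D.coreGraph : Set (L2 D.μ × L2 D.μ)) = D.coreGraph :=
    Submodule.span_eq _
  rw [← h]
  rfl

theorem memLp_continuousMap (f : C(D.Space, ℝ)) : MemLp f 2 D.μ :=
  MemLp.of_bound f.continuous.aestronglyMeasurable ‖f‖ (Eventually.of_forall f.norm_coe_le_norm)

theorem exists_mem_coreGraph {f : C(D.Space, ℝ)} (hf : f ∈ D.G) : ∃ p ∈ D.coreGraph,
    (p.1 : D.Space → ℝ) =ᵐ[D.μ] f ∧ (p.2 : D.Space → ℝ) =ᵐ[D.μ] D.dx f := by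
  have h1 := (memLp_continuousMap f).coeFn_toLp
  have h2 := (memLp_dx hf).coeFn_toLp
  exact ⟨((memLp_continuousMap f).toLp, (memLp_dx hf).toLp), ⟨f, hf, h1, h2⟩, h1, h2⟩

theorem coreGraph_le : D.coreGraph ≤ D.gradientGraph := by
  rw [gradientGraph_eq]
  exact D.coreGraph.le_topologicalClosure

theorem isClosed_gradientGraph : IsClosed (D.gradientGraph : Set (L2 D.μ × L2 D.μ)) :=
  Submodule.isClosed_topologicalClosure _

theorem exists_seq_of_mem_gradientGraph {p : L2 D.μ × L2 D.μ} (hp : p ∈ D.gradientGraph) :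
    ∃ z : ℕ → L2 D.μ × L2 D.μ, (∀ n, z n ∈ D.coreGraph) ∧
      Tendsto (fun n => (z n).1) atTop (𝓝 p.1) ∧ Tendsto (fun n => (z n).2) atTop (𝓝 p.2) := by
  rw [gradientGraph_eq] at hp
  obtain ⟨z, hz, hz'⟩ := mem_closure_iff_seq_limit.1 hp
  exact ⟨z, hz, (continuous_fst.tendsto p).comp hz', (continuous_snd.tendsto p).comp hz'⟩

/-- On `𝒢` the relation is an equality by the fundamental theorem of calculus; it then passes to
`L²` limits. -/
theorem subGrad_of_mem_gradientGraph {p : L2 D.μ × L2 D.μ} (hp : p ∈ D.gradientGraph) :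
    SubGrad (p.1 : D.Space → ℝ) p.2 := by
  obtain ⟨z, hz, h1, h2⟩ := exists_seq_of_mem_gradientGraph hp
  refine SubGrad.of_tendsto (f := fun n => (z n).1) (g := fun n => (z n).2) (fun n => ?_)
    (fun n => Lp.memLp _) (Lp.memLp _) (fun n => Lp.memLp _) (Lp.memLp _)
    ((Lp.tendsto_Lp_iff_tendsto_eLpNorm' _ _).1 h1) ((Lp.tendsto_Lp_iff_tendsto_eLpNorm' _ _).1 h2)
  obtain ⟨f, hf, hf1, hf2⟩ := hz n
  exact (subGrad_dx hf).congr hf1.symm hf2.symm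

theorem subGrad_neg_of_mem_gradientGraph {p : L2 D.μ × L2 D.μ} (hp : p ∈ D.gradientGraph) :
    SubGrad (fun q => -p.1 q) fun q => -p.2 q :=
  (subGrad_of_mem_gradientGraph (D.gradientGraph.neg_mem hp)).congr (Lp.coeFn_neg _)
    (Lp.coeFn_neg _)

/-- The operator `∂/∂x` on `𝒢` is closable. -/
theorem gradientGraph_functional {p : L2 D.μ × L2 D.μ} (hp : p ∈ D.gradientGraph)
    (h0 : p.1 = 0) : p.2 = 0 := by
  have h1 : (p.1 : D.Space → ℝ) =ᵐ[D.μ] 0 := by rw [h0]; exact Lp.coeFn_zero _ _ _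
  have h2 := (subGrad_of_mem_gradientGraph hp).nonneg h1 (Lp.memLp _)
  have h3 := (subGrad_neg_of_mem_gradientGraph hp).nonneg
    (h1.mono fun q hq => by simp [hq]) (Lp.memLp p.2).neg
  refine Lp.ext ?_
  filter_upwards [h2, h3, Lp.coeFn_zero ℝ 2 D.μ] with q hq hq' hq0
  rw [hq0]
  exact le_antisymm (neg_nonneg.1 hq') hq

theorem gradient_graph : D.gradient.graph = D.gradientGraph :=
  Submodule.toLinearPMap_graph_eq _ fun _ hp h0 => gradientGraph_functional hp h0

theorem mem_graph_gradient (u : D.gradient.domain) :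
    ((u : L2 D.μ), D.gradient u) ∈ D.gradientGraph := by
  rw [← gradient_graph]
  exact D.gradient.mem_graph u

theorem exists_gradient_eq {p : L2 D.μ × L2 D.μ} (hp : p ∈ D.gradientGraph) :
    ∃ h : p.1 ∈ D.gradient.domain, D.gradient ⟨p.1, h⟩ = p.2 := by
  rw [← gradient_graph] at hp
  have h := LinearPMap.mem_domain_of_mem_graph (x := p.1) (y := p.2) hp
  exact ⟨h, D.gradient.mem_graph_snd_inj (D.gradient.mem_graph ⟨p.1, h⟩) hp rfl⟩

/-! ## Generalized upper gradients -/

theorem toReal_ofReal_absDx {f : D.Space → ℝ} {n : ℕ} {M : ℝ} (hM : 0 ≤ M) :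
    (fun q => (ENNReal.ofReal (D.absDx f n M q)).toReal) =ᵐ[D.μ] fun q => |D.dx f q| := by
  filter_upwards [ae_mem_regular D n] with q hq
  rw [ENNReal.toReal_ofReal (absDx_nonneg hM q), absDx, if_pos hq]

theorem isGenUpperGradient_abs {p : L2 D.μ × L2 D.μ} (hp : p ∈ D.gradientGraph) :
    D.IsGenUpperGradient p.1 |p.2| := by
  obtain ⟨z, hz, h1, h2⟩ := exists_seq_of_mem_gradientGraph hp
  choose f hf hf1 hf2 using hz
  choose n hn using fun i => mem_iUnion.1 (hf i)
  choose M hM0 hM using fun i => exists_bound_deriv_slice (hn i)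
  rw [Lp.tendsto_Lp_iff_tendsto_eLpNorm'] at h1 h2
  refine ⟨fun i => f i, fun i q => ENNReal.ofReal (D.absDx (f i) (n i) (M i) q), fun i =>
    ⟨memLp_continuousMap _, (measurable_absDx (hn i) _).ennreal_ofReal, ?_,
      isUpperGradient_absDx (hn i) (hM0 i) (hM i)⟩, ?_, ?_⟩
  · refine (lintegral_mono fun q => pow_le_pow_left' (ENNReal.ofReal_le_ofReal
      (absDx_le (hn i) (hM i) q)) 2).trans_lt ?_
    rw [lintegral_const]
    exact ENNReal.mul_lt_top (ENNReal.pow_lt_top ENNReal.ofReal_lt_top) (measure_lt_top _ _)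
  · refine h1.congr fun i => eLpNorm_congr_ae ?_
    filter_upwards [hf1 i] with q hq
    rw [Pi.sub_apply, hq]
  · refine tendsto_of_tendsto_of_tendsto_of_le_of_le tendsto_const_nhds h2 (fun _ => zero_le)
      -- Since the absolute value is 1-Lipschitz, `L²` convergence of the gradients gives that of
      -- their absolute values.
      fun i => eLpNorm_mono_ae ?_
    filter_upwards [toReal_ofReal_absDx (f := f i) (n := n i) (hM0 i), hf2 i, Lp.coeFn_abs p.2]
      with q hq hq1 hq2
    rw [hq, hq2, Pi.sub_apply, hq1]
    exact abs_abs_sub_abs_le_abs_sub _ _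

theorem memLp_toReal {g : D.Space → ℝ≥0∞} (hg : Measurable g) (hg2 : ∫⁻ q, g q ^ 2 ∂D.μ < ∞) :
    MemLp (fun q => (g q).toReal) 2 D.μ := by
  refine ⟨hg.ennreal_toReal.aestronglyMeasurable, ?_⟩
  rw [eLpNorm_lt_top_iff_lintegral_rpow_enorm_lt_top two_ne_zero ENNReal.ofNat_ne_top]
  refine (lintegral_mono fun q => ?_).trans_lt hg2
  rw [ENNReal.toReal_ofNat, ENNReal.rpow_ofNat, Real.enorm_of_nonneg ENNReal.toReal_nonneg]
  exact pow_le_pow_left' ENNReal.ofReal_toReal_le 2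

theorem IsGenUpperGradient.subGrad {u p : L2 D.μ} (h : D.IsGenUpperGradient u p) :
    SubGrad (u : D.Space → ℝ) p := by
  obtain ⟨f, g, hfg, hf, hg⟩ := h
  exact SubGrad.of_tendsto (fun n => subGrad_of_isUpperGradient (hfg n).2.1 (hfg n).2.2.1
    (memLp_toReal (hfg n).2.1 (hfg n).2.2.1) (hfg n).2.2.2) (fun n => (hfg n).1) (Lp.memLp _)
    (fun n => memLp_toReal (hfg n).2.1 (hfg n).2.2.1) (Lp.memLp _) hf hg

theorem IsGenUpperGradient.neg {u p : L2 D.μ} (h : D.IsGenUpperGradient u p) :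
    D.IsGenUpperGradient (-u) p := by
  obtain ⟨f, g, hfg, hf, hg⟩ := h
  refine ⟨fun n q => -f n q, g, fun n => ⟨(hfg n).1.neg, (hfg n).2.1, (hfg n).2.2.1,
    (hfg n).2.2.2.neg⟩, hf.congr fun n => ?_, hg⟩
  rw [← eLpNorm_neg]
  refine eLpNorm_congr_ae ?_
  filter_upwards [Lp.coeFn_neg u] with q hq
  rw [hq, Pi.neg_apply, Pi.neg_apply]
  ring

theorem tendsto_eLpNorm_add_sub_add {f f' : ℕ → D.Space → ℝ} {g g' : D.Space → ℝ}
    (hf : ∀ n, MemLp (f n) 2 D.μ) (hg : MemLp g 2 D.μ) (hf' : ∀ n, MemLp (f' n) 2 D.μ)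
    (hg' : MemLp g' 2 D.μ)
    (h : Tendsto (fun n => eLpNorm (fun q => f n q - g q) 2 D.μ) atTop (𝓝 0))
    (h' : Tendsto (fun n => eLpNorm (fun q => f' n q - g' q) 2 D.μ) atTop (𝓝 0)) :
    Tendsto (fun n => eLpNorm (fun q => (f n q + f' n q) - (g q + g' q)) 2 D.μ) atTop (𝓝 0) := by
  refine tendsto_of_tendsto_of_tendsto_of_le_of_le tendsto_const_nhds
    (by simpa using h.add h') (fun _ => zero_le) fun n => ?_
  have e : (fun q => (f n q + f' n q) - (g q + g' q)) =
      (fun q => f n q - g q) + fun q => f' n q - g' q := funext fun q => add_sub_add_comm _ _ _ _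
  simp only [e]
  exact eLpNorm_add_le ((hf n).sub hg).1 ((hf' n).sub hg').1 one_le_two

theorem IsGenUpperGradient.add {u p u' p' : L2 D.μ} (h : D.IsGenUpperGradient u p)
    (h' : D.IsGenUpperGradient u' p') : D.IsGenUpperGradient (u + u') (p + p') := by
  obtain ⟨f, g, hfg, hf, hg⟩ := h
  obtain ⟨f', g', hfg', hf', hg'⟩ := h'
  refine ⟨fun n q => f n q + f' n q, fun n q => g n q + g' n q, fun n => ⟨(hfg n).1.add (hfg' n).1,
    (hfg n).2.1.add (hfg' n).2.1, ?_, fun γ ℓ hγ => ?_⟩, ?_, ?_⟩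
  · have := ENNReal.lintegral_rpow_add_lt_top_of_lintegral_rpow_lt_top (p := 2) (μ := D.μ)
      (hfg n).2.1.aemeasurable (by simpa using (hfg n).2.2.1)
      (by simpa using (hfg' n).2.2.1) one_le_two
    simpa using this
  · have h1 := (hfg n).2.2.2 γ ℓ hγ
    have h2 := (hfg' n).2.2.2 γ ℓ hγ
    -- Superadditivity of the lower integral suffices, so measurability along `γ` is not required.
    refine le_trans ?_ ((add_le_add h1 h2).trans (le_lintegral_add _ _))
    rw [← ENNReal.ofReal_add (abs_nonneg _) (abs_nonneg _)]
    refine ENNReal.ofReal_le_ofReal ?_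
    rw [add_sub_add_comm]
    exact abs_add_le _ _
  · refine (tendsto_eLpNorm_add_sub_add (fun n => (hfg n).1) (Lp.memLp u) (fun n => (hfg' n).1)
      (Lp.memLp u') hf hf').congr fun n => eLpNorm_congr_ae ?_
    filter_upwards [Lp.coeFn_add u u'] with q hq
    rw [hq, Pi.add_apply]
  · refine (tendsto_eLpNorm_add_sub_add (fun n => memLp_toReal (hfg n).2.1 (hfg n).2.2.1)
      (Lp.memLp p) (fun n => memLp_toReal (hfg' n).2.1 (hfg' n).2.2.1) (Lp.memLp p') hg hg').congr
      fun n => eLpNorm_congr_ae ?_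
    filter_upwards [Lp.coeFn_add p p', ae_lt_top ((hfg n).2.1.pow_const 2) (hfg n).2.2.1.ne,
      ae_lt_top ((hfg' n).2.1.pow_const 2) (hfg' n).2.2.1.ne] with q hq h1 h2
    rw [hq, Pi.add_apply, ENNReal.toReal_add (by rintro h; simp [h] at h1)
      (by rintro h; simp [h] at h2)]

/-- Adding the relations `(-u, -∂u)` and `(u, p')`, and likewise `(u, ∂u)` and `(-u, p')`, leaves
the zero function on the left, so `p' - ∂u` and `p' + ∂u` are nonnegative. -/
theorem abs_le_of_isGenUpperGradient {p : L2 D.μ × L2 D.μ} (hp : p ∈ D.gradientGraph)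
    {p' : L2 D.μ} (h : D.IsGenUpperGradient p.1 p') : ∀ᵐ q ∂D.μ, |p.2 q| ≤ p' q := by
  have h1 := ((subGrad_neg_of_mem_gradientGraph hp).add h.subGrad (Lp.memLp p.2).neg
    (Lp.memLp p')).nonneg (Eventually.of_forall fun q => by simp)
    ((Lp.memLp p.2).neg.add (Lp.memLp p'))
  have h2 := ((subGrad_of_mem_gradientGraph hp).add (h.neg.subGrad.congr (Lp.coeFn_neg _)
    EventuallyEq.rfl) (Lp.memLp p.2) (Lp.memLp p')).nonneg (Eventually.of_forall fun q => by simp)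
    ((Lp.memLp p.2).add (Lp.memLp p'))
  filter_upwards [h1, h2] with q hq hq'
  rw [abs_le]
  constructor <;> linarith

theorem isMinGenUpperGradient_abs {p : L2 D.μ × L2 D.μ} (hp : p ∈ D.gradientGraph) :
    D.IsMinGenUpperGradient p.1 |p.2| := by
  refine ⟨isGenUpperGradient_abs hp, fun p' hp' => ?_⟩
  filter_upwards [abs_le_of_isGenUpperGradient hp hp', Lp.coeFn_abs p.2] with q hq hq'
  rwa [hq']

end LaaksoData

/-! ## Compositions with Lipschitz functions -/

theorem tendsto_eLpNorm_two_zero_of_dominated {α : Type*} [MeasurableSpace α] {μ : Measure α}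
    {h : ℕ → α → ℝ} {G : α → ℝ} (hm : ∀ n, AEStronglyMeasurable (h n) μ) (hG : MemLp G 2 μ)
    (hb : ∀ n, ∀ᵐ x ∂μ, ‖h n x‖ ≤ ‖G x‖) (ht : ∀ᵐ x ∂μ, Tendsto (fun n => h n x) atTop (𝓝 0)) :
    Tendsto (fun n => eLpNorm (h n) 2 μ) atTop (𝓝 0) := by
  have h1 : Tendsto (fun n => ∫⁻ x, ‖h n x‖ₑ ^ (2 : ℝ) ∂μ) atTop (𝓝 (∫⁻ _, 0 ∂μ)) := by
    refine tendsto_lintegral_of_dominated_convergence' (fun x => ‖G x‖ₑ ^ (2 : ℝ))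
      (fun n => (hm n).enorm.pow_const _) (fun n => ?_) ?_ ?_
    · filter_upwards [hb n] with x hx
      exact ENNReal.rpow_le_rpow (enorm_le_iff_norm_le.2 hx) two_pos.le
    · have := (eLpNorm_lt_top_iff_lintegral_rpow_enorm_lt_top two_ne_zero ENNReal.ofNat_ne_top).1
        hG.2
      rw [ENNReal.toReal_ofNat] at this
      exact this.ne
    · filter_upwards [ht] with x hx
      have := ((ENNReal.continuous_rpow_const (y := 2)).tendsto _).comp hx.enorm
      simpa [Function.comp_def] using this
  rw [lintegral_zero] at h1
  have h2 := ((ENNReal.continuous_rpow_const (y := 1 / 2)).tendsto _).comp h1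
  have h3 : ∀ n, eLpNorm (h n) 2 μ = (∫⁻ x, ‖h n x‖ₑ ^ (2 : ℝ) ∂μ) ^ (1 / 2 : ℝ) := fun n => by
    rw [eLpNorm_eq_lintegral_rpow_enorm_toReal two_ne_zero ENNReal.ofNat_ne_top,
      ENNReal.toReal_ofNat]
  simp only [h3]
  simpa [Function.comp_def] using h2

theorem tendsto_min_one_mul {d : ℝ} (hd : 0 ≤ d) :
    Tendsto (fun n : ℕ => min 1 (n * d)) atTop (𝓝 (if 0 < d then 1 else 0)) := by
  split_ifs with h
  · have h1 : ∀ᶠ n : ℕ in atTop, 1 ≤ (n : ℝ) * d :=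
      (tendsto_natCast_atTop_atTop.atTop_mul_const h).eventually_ge_atTop 1
    exact tendsto_const_nhds.congr' (h1.mono fun n hn => (min_eq_left hn).symm)
  · obtain rfl : d = 0 := le_antisymm (not_lt.1 h) hd
    simp

namespace LaaksoData

variable {D : LaaksoData}

theorem mem_gradientGraph_of_tendsto {z : ℕ → L2 D.μ × L2 D.μ}
    (hz : ∀ n, z n ∈ D.gradientGraph) {u F : D.Space → ℝ} (hu : MemLp u 2 D.μ) (hF : MemLp F 2 D.μ)
    (h1 : Tendsto (fun n => eLpNorm (fun q => (z n).1 q - u q) 2 D.μ) atTop (𝓝 0))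
    (h2 : Tendsto (fun n => eLpNorm (fun q => (z n).2 q - F q) 2 D.μ) atTop (𝓝 0)) :
    (hu.toLp, hF.toLp) ∈ D.gradientGraph := by
  have key : ∀ {y : ℕ → L2 D.μ} {g : D.Space → ℝ} (hg : MemLp g 2 D.μ),
      Tendsto (fun n => eLpNorm (fun q => y n q - g q) 2 D.μ) atTop (𝓝 0) →
      Tendsto y atTop (𝓝 hg.toLp) := by
    intro y g hg h
    rw [Lp.tendsto_Lp_iff_tendsto_eLpNorm']
    refine h.congr fun n => eLpNorm_congr_ae ?_
    filter_upwards [hg.coeFn_toLp] with q hq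
    rw [Pi.sub_apply, hq]
  exact isClosed_gradientGraph.mem_of_tendsto ((key hu h1).prodMk_nhds (key hF h2))
    (Eventually.of_forall hz)

theorem comp_mem_gradientGraph {p : L2 D.μ × L2 D.μ} (hp : p ∈ D.gradientGraph) {φ ψ : ℝ → ℝ}
    (hψ : Continuous ψ) (hψ1 : ∀ x, |ψ x| ≤ 1) (hφ : ∀ x, HasDerivAt φ (ψ x) x) :
    ∃ p' ∈ D.gradientGraph, (p'.1 : D.Space → ℝ) =ᵐ[D.μ] (fun q => φ (p.1 q)) ∧
      (p'.2 : D.Space → ℝ) =ᵐ[D.μ] fun q => ψ (p.1 q) * p.2 q := by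
  have hφd : ContDiff ℝ 1 φ := by
    rw [contDiff_one_iff_deriv]
    refine ⟨fun x => (hφ x).differentiableAt, ?_⟩
    rwa [funext fun x => (hφ x).deriv]
  have hφL : ∀ x y, |φ x - φ y| ≤ |x - y| := fun x y => by
    have := Convex.norm_image_sub_le_of_norm_hasDerivWithin_le (f := φ) (f' := ψ) (C := 1)
      (s := univ) (fun z _ => (hφ z).hasDerivWithinAt) (fun z _ => hψ1 z) convex_univ
      (mem_univ y) (mem_univ x)
    simpa using this
  obtain ⟨z, hz, h1, h2⟩ := exists_seq_of_mem_gradientGraph hp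
  rw [Lp.tendsto_Lp_iff_tendsto_eLpNorm'] at h1 h2
  obtain ⟨σ, hσ, hae⟩ := exists_subseq_ae_tendsto (fun n => Lp.memLp (z n).1) (Lp.memLp p.1) h1
  choose f hf hf1 hf2 using fun n => hz (σ n)
  choose y hy hy1 hy2 using fun n => exists_mem_coreGraph (comp_mem_G (hf n) hφd)
  have hu : MemLp (fun q => φ (p.1 q)) 2 D.μ := by
    refine MemLp.of_le ((Lp.memLp p.1).norm.add (memLp_const |φ 0|))
      (hφd.continuous.comp_aestronglyMeasurable (Lp.aestronglyMeasurable _))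
      (Eventually.of_forall fun q => ?_)
    have h3 := hφL (p.1 q) 0
    have h4 := abs_sub_abs_le_abs_sub (φ (p.1 q)) (φ 0)
    rw [sub_zero] at h3
    rw [Real.norm_eq_abs, Pi.add_apply, Real.norm_eq_abs, Real.norm_eq_abs,
      abs_of_nonneg (a := |p.1 q| + _) (by positivity)]
    linarith
  have hF : MemLp (fun q => ψ (p.1 q) * p.2 q) 2 D.μ := by
    refine MemLp.of_le (Lp.memLp p.2)
      ((hψ.comp_aestronglyMeasurable (Lp.aestronglyMeasurable _)).mul (Lp.aestronglyMeasurable _))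
      (Eventually.of_forall fun q => ?_)
    rw [norm_mul]
    exact mul_le_of_le_one_left (norm_nonneg _) (hψ1 _)
  refine ⟨(hu.toLp, hF.toLp), mem_gradientGraph_of_tendsto (fun n => coreGraph_le (hy n)) hu hF
    ?_ ?_, hu.coeFn_toLp, hF.coeFn_toLp⟩
  · refine tendsto_of_tendsto_of_tendsto_of_le_of_le tendsto_const_nhds
      (h1.comp hσ.tendsto_atTop) (fun _ => zero_le) fun n => eLpNorm_mono_ae ?_
    filter_upwards [hy1 n, hf1 n] with q hq hq'
    rw [hq, Pi.sub_apply, hq']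
    exact hφL _ _
  -- The difference of the gradients splits as `(ψ(fₙ) - ψ(u)) ∂u + ψ(fₙ) (∂fₙ - ∂u)`: dominated
  -- convergence for the first term, `|ψ| ≤ 1` for the second.
  · have h3 : Tendsto (fun n => eLpNorm (fun q => (ψ ((z (σ n)).1 q) - ψ (p.1 q)) * p.2 q) 2 D.μ)
        atTop (𝓝 0) := by
      refine tendsto_eLpNorm_two_zero_of_dominated (fun n => ?_) ((Lp.memLp p.2).const_mul 2)
        (fun n => Eventually.of_forall fun q => ?_) ?_
      · exact ((hψ.comp_aestronglyMeasurable (Lp.aestronglyMeasurable _)).sub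
          (hψ.comp_aestronglyMeasurable (Lp.aestronglyMeasurable _))).mul
            (Lp.aestronglyMeasurable _)
      · rw [norm_mul, norm_mul]
        refine mul_le_mul_of_nonneg_right ?_ (norm_nonneg _)
        have h4 := abs_sub (ψ ((z (σ n)).1 q)) (ψ (p.1 q))
        have h5 := hψ1 ((z (σ n)).1 q)
        have h6 := hψ1 (p.1 q)
        rw [Real.norm_eq_abs, Real.norm_eq_abs, abs_two]
        linarith
      · filter_upwards [hae] with q hq
        have := (((hψ.tendsto _).comp hq).sub_const (ψ (p.1 q))).mul_const (p.2 q)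
        simpa using this
    have h4 : Tendsto (fun n => eLpNorm (fun q => ψ ((z (σ n)).1 q) * ((z (σ n)).2 q - p.2 q))
        2 D.μ) atTop (𝓝 0) := by
      refine tendsto_of_tendsto_of_tendsto_of_le_of_le tendsto_const_nhds
        (h2.comp hσ.tendsto_atTop) (fun _ => zero_le) fun n => eLpNorm_mono fun q => ?_
      rw [norm_mul]
      exact mul_le_of_le_one_left (norm_nonneg _) (hψ1 _)
    refine tendsto_of_tendsto_of_tendsto_of_le_of_le tendsto_const_nhds
      (by simpa using h3.add h4) (fun _ => zero_le) fun n => ?_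
    refine le_trans (le_of_eq (eLpNorm_congr_ae ?_)) (eLpNorm_add_le ?_ ?_ one_le_two)
    · filter_upwards [hy2 n, hf1 n, hf2 n, dx_comp (hf n) hφd hφ] with q hq hq1 hq2 hq3
      rw [hq, Pi.add_apply, hq1, hq2]
      refine (congrArg (· - _) hq3).trans ?_
      ring
    · exact ((hψ.comp_aestronglyMeasurable (Lp.aestronglyMeasurable _)).sub
        (hψ.comp_aestronglyMeasurable (Lp.aestronglyMeasurable _))).mul (Lp.aestronglyMeasurable _)
    · exact (hψ.comp_aestronglyMeasurable (Lp.aestronglyMeasurable _)).mul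
        ((Lp.aestronglyMeasurable _).sub (Lp.aestronglyMeasurable _))

/-- The chain rule for a function `φ` whose derivative is the indicator function of `{d > 0}`. -/
theorem comp_indicator_mem_gradientGraph {p : L2 D.μ × L2 D.μ} (hp : p ∈ D.gradientGraph)
    {φ d : ℝ → ℝ} (hφ : Continuous φ) (hφ0 : φ 0 = 0) (hd : Continuous d) (hd0 : ∀ x, 0 ≤ d x)
    {S : Set ℝ} (hS : S.Countable)
    (hφd : ∀ x, x ∉ S → HasDerivAt φ (if 0 < d x then 1 else 0) x) :
    ∃ p' ∈ D.gradientGraph, (p'.1 : D.Space → ℝ) =ᵐ[D.μ] (fun q => φ (p.1 q)) ∧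
      (p'.2 : D.Space → ℝ) =ᵐ[D.μ] fun q => (if 0 < d (p.1 q) then 1 else 0) * p.2 q := by
  -- These continuous functions increase to the indicator of `{d > 0}`, and their primitives
  -- converge to `φ`, so the differentiable chain rule can be passed to the limit.
  set ψ : ℕ → ℝ → ℝ := fun n x => min 1 (n * d x) with hψ
  have hψc : ∀ n, Continuous (ψ n) := fun n => continuous_const.min (continuous_const.mul hd)
  have hψ1 : ∀ n x, |ψ n x| ≤ 1 := fun n x => by
    rw [abs_of_nonneg (le_min zero_le_one (mul_nonneg n.cast_nonneg (hd0 x)))]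
    exact min_le_left _ _
  have hψt : ∀ x, Tendsto (fun n => ψ n x) atTop (𝓝 (if 0 < d x then 1 else 0)) := fun x =>
    tendsto_min_one_mul (hd0 x)
  have hm : Measurable fun x => if 0 < d x then (1 : ℝ) else 0 :=
    Measurable.ite (measurableSet_lt measurable_const hd.measurable) measurable_const
      measurable_const
  have hb : ∀ x, |if 0 < d x then (1 : ℝ) else 0| ≤ 1 := fun x => by split_ifs <;> simp
  have hint : ∀ s, ∫ x in 0..s, (if 0 < d x then (1 : ℝ) else 0) = φ s := fun s => by
    have := integral_eq_of_hasDerivAt_off_countable φ (fun x => if 0 < d x then (1 : ℝ) else 0)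
      (a := 0) (b := s) hS hφ.continuousOn (fun x hx => hφd x hx.2)
      ((intervalIntegrable_const (c := (1 : ℝ))).mono_fun hm.aestronglyMeasurable
        (Eventually.of_forall fun x => by simpa using hb x))
    rw [this, hφ0, sub_zero]
  set Φ : ℕ → ℝ → ℝ := fun n s => ∫ x in 0..s, ψ n x with hΦ
  have hΦd : ∀ n s, HasDerivAt (Φ n) (ψ n s) s := fun n s =>
    (hψc n).integral_hasStrictDerivAt 0 s |>.hasDerivAt
  have hΦb : ∀ n s, |Φ n s| ≤ |s| := fun n s => by
    have := intervalIntegral.norm_integral_le_of_norm_le_const (a := 0) (b := s) (f := ψ n)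
      (C := 1) fun x _ => hψ1 n x
    simpa using this
  have hΦt : ∀ s, Tendsto (fun n => Φ n s) atTop (𝓝 (φ s)) := fun s => by
    rw [← hint s]
    exact intervalIntegral.tendsto_integral_filter_of_dominated_convergence (fun _ => 1)
      (Eventually.of_forall fun n => (hψc n).aestronglyMeasurable)
      (Eventually.of_forall fun n => Eventually.of_forall fun x _ => hψ1 n x)
      intervalIntegrable_const (Eventually.of_forall fun x _ => hψt x)
  have hφb : ∀ s, |φ s| ≤ |s| := fun s =>
    le_of_tendsto' (hΦt s).abs fun n => hΦb n s
  choose y hy hy1 hy2 using fun n => comp_mem_gradientGraph hp (hψc n) (hψ1 n) (hΦd n)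
  have hu : MemLp (fun q => φ (p.1 q)) 2 D.μ :=
    MemLp.of_le (Lp.memLp p.1) (hφ.comp_aestronglyMeasurable (Lp.aestronglyMeasurable _))
      (Eventually.of_forall fun q => hφb _)
  have hF : MemLp (fun q => (if 0 < d (p.1 q) then (1 : ℝ) else 0) * p.2 q) 2 D.μ := by
    refine MemLp.of_le (Lp.memLp p.2) ((hm.comp_aemeasurable
      (Lp.aestronglyMeasurable p.1).aemeasurable).aestronglyMeasurable.mul
        (Lp.aestronglyMeasurable _)) (Eventually.of_forall fun q => ?_)
    rw [norm_mul]
    exact mul_le_of_le_one_left (norm_nonneg _) (hb _)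
  refine ⟨(hu.toLp, hF.toLp), mem_gradientGraph_of_tendsto hy hu hF ?_ ?_, hu.coeFn_toLp,
    hF.coeFn_toLp⟩
  · refine tendsto_eLpNorm_two_zero_of_dominated
      (fun n => (Lp.aestronglyMeasurable _).sub hu.1) ((Lp.memLp p.1).const_mul 2) (fun n => ?_) ?_
    · filter_upwards [hy1 n] with q hq
      rw [hq, norm_mul, Real.norm_eq_abs, Real.norm_eq_abs, Real.norm_eq_abs, abs_two]
      have h1 := abs_sub (Φ n (p.1 q)) (φ (p.1 q))
      linarith [hΦb n (p.1 q), hφb (p.1 q)]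
    · filter_upwards [ae_all_iff.2 hy1] with q hq
      simp only [hq]
      simpa using (hΦt (p.1 q)).sub_const (φ (p.1 q))
  · refine tendsto_eLpNorm_two_zero_of_dominated
      (fun n => (Lp.aestronglyMeasurable _).sub hF.1) ((Lp.memLp p.2).const_mul 2) (fun n => ?_) ?_
    · filter_upwards [hy2 n] with q hq
      rw [hq, ← sub_mul, norm_mul, norm_mul]
      refine mul_le_mul_of_nonneg_right ?_ (norm_nonneg _)
      have h1 := abs_sub (ψ n (p.1 q)) (if 0 < d (p.1 q) then 1 else 0)
      rw [Real.norm_eq_abs, Real.norm_eq_abs, abs_two]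
      linarith [hψ1 n (p.1 q), hb (p.1 q)]
    · filter_upwards [ae_all_iff.2 hy2] with q hq
      simp only [hq]
      have := ((hψt (p.1 q)).mul_const (p.2 q)).sub_const
        ((if 0 < d (p.1 q) then (1 : ℝ) else 0) * p.2 q)
      simpa using this

theorem gradientGraph_snd_eq {p p' : L2 D.μ × L2 D.μ} (hp : p ∈ D.gradientGraph)
    (hp' : p' ∈ D.gradientGraph) (h : p.1 = p'.1) : p.2 = p'.2 :=
  sub_eq_zero.1 (gradientGraph_functional (D.gradientGraph.sub_mem hp hp') (sub_eq_zero.2 h))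

/-- The gradient of `u` vanishes almost everywhere on `{u = 0}`. -/
theorem ae_eq_zero_of_fst_eq_zero {p : L2 D.μ × L2 D.μ} (hp : p ∈ D.gradientGraph) :
    ∀ᵐ q ∂D.μ, p.1 q = 0 → p.2 q = 0 := by
  -- With the identity as `φ` and `{d > 0} = {x ≠ 0}`, uniqueness of the gradient forces it to equal
  -- its product with the indicator of `{u ≠ 0}`.
  obtain ⟨p', hp', h1, h2⟩ := comp_indicator_mem_gradientGraph hp (φ := fun x => x)
    (d := fun x => |x|) continuous_id rfl continuous_abs abs_nonneg (countable_singleton (0 : ℝ))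
    fun x hx => by
      rw [if_pos (abs_pos.2 hx)]
      exact hasDerivAt_id x
  rw [gradientGraph_snd_eq hp' hp (Lp.ext h1)] at h2
  filter_upwards [h2] with q hq h0
  rw [hq, h0, abs_zero, if_neg (lt_irrefl _), zero_mul]

theorem exists_truncation {p : L2 D.μ × L2 D.μ} (hp : p ∈ D.gradientGraph) :
    ∃ p' ∈ D.gradientGraph, (p'.1 : D.Space → ℝ) =ᵐ[D.μ] (fun q => min (max (p.1 q) 0) 1) ∧
      ‖p'.2‖ ≤ ‖p.2‖ := by
  -- This `d` is positive exactly on `(0, 1)`, where the truncation has slope one; its corners `0`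
  -- and `1` are exceptional.
  obtain ⟨p', hp', h1, h2⟩ := comp_indicator_mem_gradientGraph hp
    (φ := fun x => min (max x 0) 1) (d := fun x => max 0 (min x (1 - x))) (by fun_prop) (by simp)
    (by fun_prop) (fun x => le_max_left _ _) (toFinite ({0, 1} : Set ℝ)).countable fun x hx => by
      simp only [mem_insert_iff, mem_singleton_iff, not_or] at hx
      rcases lt_or_gt_of_ne hx.1 with h | h
      · rw [if_neg (by simp [h.le])]
        refine (hasDerivAt_const x (0 : ℝ)).congr_of_eventuallyEq ?_
        filter_upwards [Iio_mem_nhds h] with y hy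
        rw [max_eq_right (le_of_lt hy), min_eq_left zero_le_one]
      · rcases lt_or_gt_of_ne hx.2 with h' | h'
        · rw [if_pos (by simp [h, h'])]
          refine (hasDerivAt_id x).congr_of_eventuallyEq ?_
          filter_upwards [Ioo_mem_nhds h h'] with y hy
          rw [max_eq_left hy.1.le, min_eq_left hy.2.le, id]
        · rw [if_neg (by simp [h'.le])]
          refine (hasDerivAt_const x (1 : ℝ)).congr_of_eventuallyEq ?_
          filter_upwards [Ioi_mem_nhds h'] with y hy
          rw [max_eq_left (zero_le_one.trans (le_of_lt hy)), min_eq_right (le_of_lt hy)]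
  refine ⟨p', hp', h1, Lp.norm_le_norm_of_ae_le ?_⟩
  filter_upwards [h2] with q hq
  rw [hq, norm_mul]
  refine mul_le_of_le_one_left (norm_nonneg _) ?_
  split_ifs <;> simp

/-! ## The Dirichlet form -/

theorem dense_GL2 : Dense D.GL2 := by
  have h1 : Dense (D.G : Set C(D.Space, ℝ)) := by
    intro g
    refine Metric.mem_closure_iff.2 fun ε hε => ?_
    obtain ⟨f, hf, h⟩ := exists_mem_G_near g hε
    exact ⟨f, hf, by rwa [dist_comm, dist_eq_norm]⟩
  have h2 : DenseRange (ContinuousMap.toLp 2 D.μ ℝ : C(D.Space, ℝ) →L[ℝ] L2 D.μ) :=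
    ContinuousMap.toLp_denseRange ℝ D.μ ℝ ENNReal.ofNat_ne_top
  refine (h2.dense_image (ContinuousLinearMap.continuous _) h1).mono ?_
  rintro _ ⟨f, hf, rfl⟩
  exact ⟨f, hf, ContinuousMap.coeFn_toLp D.μ f⟩

theorem exists_mem_gradientGraph_of_mem_GL2 {u : L2 D.μ} (hu : u ∈ D.GL2) :
    ∃ F, (u, F) ∈ D.gradientGraph := by
  obtain ⟨f, hf, h⟩ := hu
  obtain ⟨p, hp, h1, -⟩ := exists_mem_coreGraph hf
  have : p.1 = u := Lp.ext (h1.trans h.symm)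
  exact ⟨p.2, this ▸ coreGraph_le hp⟩

theorem GL2_subset_domain : D.GL2 ⊆ D.gradient.domain := fun u hu => by
  obtain ⟨F, hF⟩ := exists_mem_gradientGraph_of_mem_GL2 hu
  exact (exists_gradient_eq hF).1

theorem dense_domain_gradient : Dense (D.gradient.domain : Set (L2 D.μ)) :=
  dense_GL2.mono GL2_subset_domain

theorem isClosed_gradient : D.gradient.IsClosed := by
  rw [LinearPMap.IsClosed, gradient_graph]
  exact isClosed_gradientGraph

theorem exists_mem_coreGraph_near {p : L2 D.μ × L2 D.μ} (hp : p ∈ D.gradientGraph) {ε : ℝ}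
    (hε : 0 < ε) : ∃ z ∈ D.coreGraph, ‖p.1 - z.1‖ + ‖p.2 - z.2‖ < ε := by
  obtain ⟨z, hz, h1, h2⟩ := exists_seq_of_mem_gradientGraph hp
  have h3 := ((tendsto_const_nhds (x := p.1)).sub h1).norm.add
    ((tendsto_const_nhds (x := p.2)).sub h2).norm
  simp only [sub_self, norm_zero, add_zero] at h3
  obtain ⟨n, hn⟩ := (h3.eventually (gt_mem_nhds hε)).exists
  exact ⟨z n, hz n, hn⟩

theorem energy_form_apply (u v : D.energy.domain) :
    D.energy.form u v = ⟪D.gradient u, D.gradient v⟫_ℝ := rfl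

theorem energy_normSq (u : D.energy.domain) :
    D.energy.normSq u = ‖D.gradient u‖ ^ 2 + ‖(u : L2 D.μ)‖ ^ 2 := by
  rw [FormL2.normSq, energy_form_apply, real_inner_self_eq_norm_sq]

theorem energy_normSq_sub (u v : D.energy.domain) : D.energy.normSq (u - v) =
    ‖D.gradient u - D.gradient v‖ ^ 2 + ‖(u : L2 D.μ) - v‖ ^ 2 := by
  rw [energy_normSq]
  congr 3
  exact D.gradient.map_sub _ _

theorem isClosed_energy : D.energy.IsClosed := by
  intro u hu
  have h1 : CauchySeq fun n => (u n : L2 D.μ) := by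
    refine Metric.cauchySeq_iff.2 fun ε hε => ?_
    obtain ⟨N, hN⟩ := hu (ε ^ 2) (by positivity)
    refine ⟨N, fun m hm n hn => ?_⟩
    have := hN m hm n hn
    rw [energy_normSq_sub] at this
    rw [dist_eq_norm]
    exact lt_of_pow_lt_pow_left₀ 2 hε.le (by
      nlinarith [sq_nonneg ‖D.gradient (u m) - D.gradient (u n)‖])
  have h2 : CauchySeq fun n => D.gradient (u n) := by
    refine Metric.cauchySeq_iff.2 fun ε hε => ?_
    obtain ⟨N, hN⟩ := hu (ε ^ 2) (by positivity)
    refine ⟨N, fun m hm n hn => ?_⟩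
    have := hN m hm n hn
    rw [energy_normSq_sub] at this
    rw [dist_eq_norm]
    exact lt_of_pow_lt_pow_left₀ 2 hε.le (by nlinarith [sq_nonneg ‖(u m : L2 D.μ) - u n‖])
  obtain ⟨v, hv⟩ := cauchySeq_tendsto_of_complete h1
  obtain ⟨F, hF⟩ := cauchySeq_tendsto_of_complete h2
  have h3 : (v, F) ∈ D.gradientGraph := isClosed_gradientGraph.mem_of_tendsto
    (hv.prodMk_nhds hF) (Eventually.of_forall fun n => mem_graph_gradient (u n))
  obtain ⟨hd, he⟩ := exists_gradient_eq h3
  refine ⟨⟨v, hd⟩, ?_⟩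
  have h4 : ∀ n, D.energy.normSq (u n - ⟨v, hd⟩) =
      ‖D.gradient (u n) - F‖ ^ 2 + ‖(u n : L2 D.μ) - v‖ ^ 2 := fun n =>
    (energy_normSq_sub _ _).trans
      (congrArg (fun G => ‖D.gradient (u n) - G‖ ^ 2 + ‖(u n : L2 D.μ) - v‖ ^ 2) he)
  simp only [h4]
  have h5 := ((hF.sub_const F).norm.pow 2).add ((hv.sub_const v).norm.pow 2)
  simpa using h5

theorem isDirichlet_energy : D.energy.IsDirichlet where
  dense := dense_domain_gradient
  symm u v := by rw [energy_form_apply, energy_form_apply, real_inner_comm]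
  nonneg u := by rw [energy_form_apply]; exact real_inner_self_nonneg
  closed := isClosed_energy
  markov u := by
    obtain ⟨p, hp, h1, h2⟩ := exists_truncation (mem_graph_gradient u)
    obtain ⟨hd, he⟩ := exists_gradient_eq hp
    refine ⟨⟨p.1, hd⟩, h1, ?_⟩
    rw [energy_form_apply, energy_form_apply, real_inner_self_eq_norm_sq,
      real_inner_self_eq_norm_sq]
    exact pow_le_pow_left₀ (norm_nonneg _) ((congrArg norm he).trans_le h2) 2

/-- Every point has a neighbourhood on which `u` or `v` vanishes almost everywhere, hence also its
gradient. Compactness of `L` reduces this cover by null conditions to a finite one. -/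
theorem isLocal_energy : D.energy.IsLocal := by
  intro u v _ _ huv
  have hz : ∀ w : D.energy.domain, ∀ᵐ q ∂D.μ, (w : L2 D.μ) q = 0 → D.gradient w q = 0 := fun w =>
    ae_eq_zero_of_fst_eq_zero (mem_graph_gradient w)
  have key : ∀ᵐ q ∂D.μ, q ∈ (univ : Set D.Space) → D.gradient u q * D.gradient v q = 0 := by
    refine isCompact_univ.induction_on (p := fun S => ∀ᵐ q ∂D.μ, q ∈ S →
      D.gradient u q * D.gradient v q = 0) (by simp) ?_ ?_ ?_
    · intro S T hST hT
      filter_upwards [hT] with q hq hqS using hq (hST hqS)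
    · intro S T hS hT
      filter_upwards [hS, hT] with q hq hq' h using h.elim hq hq'
    · intro x _
      by_cases hx : x ∈ FormL2.aeSupport D.μ (u : L2 D.μ)
      · have hx' : x ∉ FormL2.aeSupport D.μ (v : L2 D.μ) := disjoint_left.1 huv hx
        simp only [FormL2.aeSupport, Set.mem_ofPred_eq, not_forall, not_not] at hx'
        obtain ⟨U, hU, hxU, h⟩ := hx'
        refine ⟨U, mem_nhdsWithin_of_mem_nhds (hU.mem_nhds hxU), ?_⟩
        filter_upwards [h, hz v] with q hq hq' hqU
        rw [hq' (hq hqU), mul_zero]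
      · simp only [FormL2.aeSupport, Set.mem_ofPred_eq, not_forall, not_not] at hx
        obtain ⟨U, hU, hxU, h⟩ := hx
        refine ⟨U, mem_nhdsWithin_of_mem_nhds (hU.mem_nhds hxU), ?_⟩
        filter_upwards [h, hz u] with q hq hq' hqU
        rw [hq' (hq hqU), zero_mul]
  rw [energy_form_apply, L2.inner_def]
  refine integral_eq_zero_of_ae ?_
  filter_upwards [key] with q hq
  rw [real_inner_comm, RCLike.inner_apply, conj_trivial, hq (mem_univ q)]
  rfl

theorem exists_energy_normSq_sub_lt (u : D.energy.domain) {ε : ℝ} (hε : 0 < ε) :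
    ∃ f ∈ D.G, ∃ v : D.energy.domain, ((v : L2 D.μ) : D.Space → ℝ) =ᵐ[D.μ] f ∧
      D.energy.normSq (u - v) < ε := by
  obtain ⟨z, hz, h⟩ := exists_mem_coreGraph_near (mem_graph_gradient u)
    -- Once the sum of the two norms is below one, the sum of their squares is at most the sum
    -- itself.
    (ε := min 1 (ε / 2)) (by positivity)
  obtain ⟨hd, he⟩ := exists_gradient_eq (coreGraph_le hz)
  obtain ⟨f, hf, hv, -⟩ := hz
  refine ⟨f, hf, ⟨z.1, hd⟩, hv, ?_⟩
  have h1 : D.energy.normSq (u - ⟨z.1, hd⟩) =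
      ‖D.gradient u - z.2‖ ^ 2 + ‖(u : L2 D.μ) - z.1‖ ^ 2 :=
    (energy_normSq_sub _ _).trans
      (congrArg (fun G => ‖D.gradient u - G‖ ^ 2 + ‖(u : L2 D.μ) - z.1‖ ^ 2) he)
  have h2 : ‖(u : L2 D.μ) - z.1‖ + ‖D.gradient u - z.2‖ < 1 := h.trans_le (min_le_left _ _)
  have h3 : ‖(u : L2 D.μ) - z.1‖ + ‖D.gradient u - z.2‖ < ε / 2 := h.trans_le (min_le_right _ _)
  have h4 : 0 ≤ ‖D.gradient u - z.2‖ := norm_nonneg _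
  have h5 : 0 ≤ ‖(u : L2 D.μ) - z.1‖ := norm_nonneg _
  rw [h1]
  nlinarith

theorem exists_mem_domain_of_mem_G {f : C(D.Space, ℝ)} (hf : f ∈ D.G) :
    ∃ v : D.energy.domain, ((v : L2 D.μ) : D.Space → ℝ) =ᵐ[D.μ] f := by
  obtain ⟨p, hp, h1, -⟩ := exists_mem_coreGraph hf
  obtain ⟨hd, -⟩ := exists_gradient_eq (coreGraph_le hp)
  exact ⟨⟨p.1, hd⟩, h1⟩

theorem isRegular_energy : D.energy.IsRegular := by
  refine ⟨fun u ε hε => ?_, fun g hg _ ε hε => ?_⟩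
  · obtain ⟨f, -, h⟩ := exists_energy_normSq_sub_lt u hε
    exact ⟨f, f.continuous, HasCompactSupport.of_compactSpace _, h⟩
  · obtain ⟨f, hf, h⟩ := exists_mem_G_near ⟨g, hg⟩ hε
    refine ⟨f, f.continuous, HasCompactSupport.of_compactSpace _, exists_mem_domain_of_mem_G hf,
      fun x => ?_⟩
    have h1 : |f x - g x| ≤ ‖f - ⟨g, hg⟩‖ := (f - ⟨g, hg⟩).norm_coe_le_norm x
    rw [abs_sub_comm]
    exact h1.trans_lt h

/-! ## The Sobolev space -/

theorem isMinGenUpperGradient_gradient (u : D.gradient.domain) :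
    D.IsMinGenUpperGradient (u : L2 D.μ) |D.gradient u| := by
  have h := isMinGenUpperGradient_abs (mem_graph_gradient u)
  exact h

theorem domain_subset_sobolevClosure :
    (D.energy.domain : Set (L2 D.μ)) ⊆ D.sobolevClosure D.GL2 := by
  intro u hu ε hε
  obtain ⟨z, hz, h⟩ := exists_mem_coreGraph_near (mem_graph_gradient ⟨u, hu⟩) hε
  have h1 := isMinGenUpperGradient_abs
    (D.gradientGraph.sub_mem (mem_graph_gradient ⟨u, hu⟩) (coreGraph_le hz))
  obtain ⟨f, hf, hv, -⟩ := hz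
  refine ⟨z.1, ⟨f, hf, hv⟩, _, h1, ?_⟩
  rw [norm_abs_eq_norm]
  exact h

/-- No gradient of `u` is known beforehand. But `p n + p m` is a generalized upper gradient of `f m
- f n`, so it dominates `|F m - F n|`. Thus the gradients of the approximants are Cauchy and the
closed graph contains the limit. -/
theorem sobolevClosure_subset_domain :
    D.sobolevClosure D.GL2 ⊆ (D.energy.domain : Set (L2 D.μ)) := by
  intro u hu
  have hpos : ∀ n : ℕ, (0 : ℝ) < 1 / (n + 1) := fun n => Nat.one_div_pos_of_nat
  choose f hf p hp hlt using fun n : ℕ => hu _ (hpos n)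
  choose F hF using fun n => exists_mem_gradientGraph_of_mem_GL2 (hf n)
  have h0 : Tendsto (fun n : ℕ => 1 / ((n : ℝ) + 1)) atTop (𝓝 0) :=
    tendsto_one_div_add_atTop_nhds_zero_nat
  have h1 : Tendsto f atTop (𝓝 u) := by
    rw [tendsto_iff_norm_sub_tendsto_zero]
    refine squeeze_zero (fun n => norm_nonneg _) (fun n => ?_) h0
    rw [norm_sub_rev]
    linarith [hlt n, norm_nonneg (p n)]
  have h2 : ∀ m n, ‖F m - F n‖ ≤ ‖p n‖ + ‖p m‖ := fun m n => by
    have h3 := (hp n).1.add (hp m).1.neg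
    have e : u - f n + -(u - f m) = f m - f n := by abel
    rw [e] at h3
    have h4 := abs_le_of_isGenUpperGradient (D.gradientGraph.sub_mem (hF m) (hF n)) h3
    refine (Lp.norm_le_norm_of_ae_le ?_).trans (norm_add_le (p n) (p m))
    filter_upwards [h4] with q hq
    exact hq.trans (le_abs_self _)
  have h3 : CauchySeq F := by
    refine cauchySeq_of_le_tendsto_0 (fun N : ℕ => 1 / ((N : ℝ) + 1) + 1 / ((N : ℝ) + 1))
      (fun m n N hm hn => ?_) (by simpa using h0.add h0)
    rw [dist_eq_norm]
    refine (h2 m n).trans (add_le_add ?_ ?_)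
    · have := one_div_le_one_div_of_le (by positivity : (0 : ℝ) < N + 1)
        (by exact_mod_cast Nat.succ_le_succ hn : (N : ℝ) + 1 ≤ n + 1)
      linarith [hlt n, norm_nonneg (u - f n)]
    · have := one_div_le_one_div_of_le (by positivity : (0 : ℝ) < N + 1)
        (by exact_mod_cast Nat.succ_le_succ hm : (N : ℝ) + 1 ≤ m + 1)
      linarith [hlt m, norm_nonneg (u - f m)]
  obtain ⟨F', hF'⟩ := cauchySeq_tendsto_of_complete h3
  exact (exists_gradient_eq (isClosed_gradientGraph.mem_of_tendsto (h1.prodMk_nhds hF')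
    (Eventually.of_forall hF))).1

/-! ## The generator -/

theorem negGenerator_graph (w f : L2 D.μ) :
    (w, f) ∈ D.energy.negGenerator.graph ↔ IsFormRep D.gradient w f := by
  have h : D.energy.negGenerator.graph = D.energy.generatorGraph := by
    refine Submodule.toLinearPMap_graph_eq _ ?_
    rintro ⟨w, f⟩ ⟨hw, h⟩ (h0 : w = 0)
    refine dense_domain_gradient.eq_zero_of_inner_left ℝ fun v hv => ?_
    have h1 := h ⟨v, hv⟩
    have e : (⟨w, hw⟩ : D.gradient.domain) = 0 := Subtype.ext h0
    rw [energy_form_apply] at h1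
    rw [← h1]
    have h2 : D.gradient ⟨w, hw⟩ = 0 := by rw [e, LinearPMap.map_zero]
    exact (congrArg (fun x => ⟪x, D.gradient ⟨v, hv⟩⟫_ℝ) h2).trans (inner_zero_left _)
  rw [h]
  rfl

theorem inner_negGenerator_nonneg (u : D.energy.negGenerator.domain) :
    0 ≤ ⟪D.energy.negGenerator u, (u : L2 D.μ)⟫_ℝ := by
  have h := (negGenerator_graph _ _).1 (D.energy.negGenerator.mem_graph u)
  rw [← h.norm_sq_eq (D.gradient.mem_graph ⟨_, h.1⟩)]
  positivity

theorem graphNormClosure_GL2_eq {S : L2 D.μ →ₗ.[ℝ] L2 D.μ} (hS : S.domain = D.gradient.domain)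
    (h : ∀ (u v : D.gradient.domain) (u' v' : S.domain), (u : L2 D.μ) = u' → (v : L2 D.μ) = v' →
      ⟪D.gradient u, D.gradient v⟫_ℝ = ⟪S u', S v'⟫_ℝ) :
    graphNormClosure S D.GL2 = S.domain := by
  refine Subset.antisymm (fun u hu => hu.1) fun u hu => ⟨hu, fun ε hε => ?_⟩
  have hu' : u ∈ D.gradient.domain := hS.le hu
  obtain ⟨z, hz, hlt⟩ := exists_mem_coreGraph_near (mem_graph_gradient ⟨u, hu'⟩) hε
  obtain ⟨hd, he⟩ := exists_gradient_eq (coreGraph_le hz)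
  have hdS : z.1 ∈ S.domain := hS.ge hd
  obtain ⟨f, hf, hv, -⟩ := hz
  refine ⟨z.1, ⟨f, hf, hv⟩, hdS, ?_⟩
  have h1 := h (⟨u, hu'⟩ - ⟨z.1, hd⟩) (⟨u, hu'⟩ - ⟨z.1, hd⟩) (⟨u, hu⟩ - ⟨z.1, hdS⟩)
    (⟨u, hu⟩ - ⟨z.1, hdS⟩) rfl rfl
  rw [real_inner_self_eq_norm_sq, real_inner_self_eq_norm_sq,
    sq_eq_sq₀ (norm_nonneg _) (norm_nonneg _), LinearPMap.map_sub, LinearPMap.map_sub, he] at h1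
  rwa [← h1]

end LaaksoData

end

theorem mainTheorem4 (D : LaaksoData) :
    -- `f ↦ ∂f/∂x` on `𝒢` is closable, so that its closure is a well-defined operator;
    D.gradient.graph = D.gradientGraph ∧
    -- `E(u, u) = ∫ p_u² dμ = ∫ (∂u/∂x)² dμ`;
    (∀ u : D.energy.domain, ∃ p : L2 D.μ, D.IsMinGenUpperGradient u p ∧
      (∀ᵐ q ∂D.μ, p q = |D.gradient u q|) ∧
      D.energy.form u u = ∫ q, p q ^ 2 ∂D.μ ∧
      D.energy.form u u = ∫ q, D.gradient u q ^ 2 ∂D.μ) ∧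
    -- `E` is a local, regular Dirichlet form;
    D.energy.IsDirichlet ∧ D.energy.IsLocal ∧ D.energy.IsRegular ∧
    -- the domain lies in `H^{1,2}` and is the closure of `𝒢` there;
    (D.energy.domain : Set (L2 D.μ)) ⊆ D.H12 ∧
    D.sobolevClosure D.GL2 = D.energy.domain ∧
    -- the operator `-A` of the form is self-adjoint and nonnegative and has a square root;
    IsSelfAdjoint D.energy.negGenerator ∧
    (∀ u : D.energy.negGenerator.domain, 0 ≤ ⟪D.energy.negGenerator u, (u : L2 D.μ)⟫_ℝ) ∧
    (∃ S, IsPosSqrt S D.energy.negGenerator) ∧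
    -- the graph norm closure of `𝒢`, the domain of `√(-A)` and the domain of `E` agree.
    ∀ S, IsPosSqrt S D.energy.negGenerator →
      D.GL2 ⊆ S.domain ∧
      graphNormClosure S D.GL2 = S.domain ∧
      S.domain = D.energy.domain ∧
      ∀ (u v : D.energy.domain) (u' v' : S.domain), (u : L2 D.μ) = u' → (v : L2 D.μ) = v' →
        D.energy.form u v = ⟪S u', S v'⟫_ℝ := by
  refine ⟨LaaksoData.gradient_graph, fun u => ?_, LaaksoData.isDirichlet_energy,
    LaaksoData.isLocal_energy, LaaksoData.isRegular_energy,
    fun u hu => ⟨_, LaaksoData.isMinGenUpperGradient_gradient ⟨u, hu⟩⟩,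
    Subset.antisymm LaaksoData.sobolevClosure_subset_domain LaaksoData.domain_subset_sobolevClosure,
    isSelfAdjoint_of_isFormRep LaaksoData.isClosed_gradient LaaksoData.dense_domain_gradient
      LaaksoData.negGenerator_graph,
    LaaksoData.inner_negGenerator_nonneg,
    exists_isPosSqrt_of_isFormRep LaaksoData.isClosed_gradient LaaksoData.dense_domain_gradient
      LaaksoData.negGenerator_graph, fun S hS => ?_⟩
  · have habs := Lp.coeFn_abs (D.gradient u)
    have h1 : D.energy.form u u = ∫ q, D.gradient u q ^ 2 ∂D.μ := by
      rw [LaaksoData.energy_form_apply, L2.inner_def]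
      refine integral_congr_ae (Eventually.of_forall fun q => ?_)
      simp only [RCLike.inner_apply, conj_trivial, sq]
    refine ⟨_, LaaksoData.isMinGenUpperGradient_gradient u, habs, ?_, h1⟩
    rw [h1]
    refine integral_congr_ae ?_
    filter_upwards [habs] with q hq
    rw [hq, sq_abs]
  -- Both `S⋆ S` and `T⋆ T`, with `T` the gradient, are the operator of the form, so the conclusions
  -- hold for every such root without an appeal to its uniqueness.
  · obtain ⟨h1, h2⟩ := domain_eq_and_inner_eq_of_isFormRep_iff hS.selfAdjoint.isClosed
      LaaksoData.isClosed_gradient fun w f =>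
        (hS.mem_graph_iff_isFormRep w f).symm.trans (LaaksoData.negGenerator_graph w f)
    refine ⟨?_, LaaksoData.graphNormClosure_GL2_eq h1 h2, h1, h2⟩
    rw [h1]
    exact LaaksoData.GL2_subset_domain
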